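/- Let $m,l,g>0$ and $A,B,C\in\mathbb R$, and consider the averaged Hamiltonian of a pendulum with fast vibrating suspension point $$\bar H=\frac{p^2}{2ml^2}+\bar V(\varphi),\qquad \bar V(\varphi)=\frac m2\left[(A-B)\cos2\varphi+C\sin2\varphi\right]-mgl\cos\varphi ,$$ on the phase cylinder $(\varphi \bmod 2\pi,\,p)\in(\mathbb R/2\pi\mathbb Z)\times\mathbb R$, with Hamilton's equations $\dot\varphi=\partial\bar H/\partial p$, $\dot p=-\partial\bar H/\partial\varphi$. An equilibrium $(\varphi,0)$ is degenerate if $\bar V'(\varphi)=\bar V''(\varphi)=0$, a saddle if $\bar V'(\varphi)=0>\bar V''(\varphi)$, and a centre if $\bar V'(\varphi)=0<\bar V''(\varphi)$. Two systems have phase portraits of the same type if there is a homeomorphism of the phase cylinder which maps phase curves of the first system to phase curves of the second one, and whose inverse maps phase curves of the second to phase curves of the first, preserving the direction of time. An eight-shaped separatrix consists of a saddle $(s,0)$ and two trajectories homoclinic to it, the left loop and the right loop, which do not go around the cylinder: if $\varphi$ is followed on the real line, they tend to $(s,0)$ for $t\to\pm\infty$ and satisfy $\varphi(t)<s$, respectively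 $\varphi(t)>s$, for all $t$. In the parameter plane with coordinates $\left(\frac{B-A}{gl},\frac{C}{gl}\right)$ let $\Gamma$ be the set of parameters for which there is a degenerate equilibrium, and let $\mathcal R$ be the ray $\{C=0,\ \frac{2(B-A)}{gl}>1\}$. Then: 1. Whether a system has a degenerate equilibrium depends only on its point in the parameter plane, and $\Gamma$ is the curve $\frac{B-A}{gl}=\cos^3\varphi-\frac32\cos\varphi,\ \frac C{gl}=\sin^3\varphi$ $(\varphi\in\mathbb R)$. 2. The complement of $\Gamma$ is the disjoint union of two connected nonempty open sets, a bounded domain $I$ and a domain $II\supset\mathcal R$; the boundary of each of them is $\Gamma$. The system has exactly 2 equilibria (one centre, one saddle) if its parameters are in $I$, and exactly 4 equilibria (two centres, two saddles) if they are in $II$. 3. The type of the phase portrait changes only across $\Gamma$ and $\mathcal R$: any two systems with parameters both in $I$, or both in $II\setminus\mathcal R$, or both in $\mathcal R$, have phase portraits of the same type. Systems with parameters in $I$ and in $II$, respectively, have phase portraits of different types, and so do systems with parameters in $II\setminus\mathcal R$ and in $\mathcal R$, respectively. 4. There is a heteroclinic trajectory (joining two different saddles) if and only if the parameters are in $\mathcal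 R$. 5. There is an eight-shaped separatrix if and only if the parameters are in $II\setminus\mathcal R$; its saddle is unique modulo $2\pi$. 6. The asymmetry of the eight-shaped separatrix is determined by the sign of $C$, hence it is swapped by a passage through $\mathcal R$. If $C>0$, the right loop is the smaller one: its mirror image in the line $\varphi=s$ passes strictly inside the left loop, i.e. for each point $(s+x,p)$ of the right loop there is a point $(s-x,p')$ of the left loop with $|p'|>|p|$. If $C<0$, the same holds with left and right exchanged. If $C=0$, the loops are mirror images of each other. 7. As the parameters approach $\Gamma$ from domain $II$ at $C>0$ (respectively $C<0$), the right (respectively the left) loop shrinks to a point, a degenerate equilibrium. Precisely: if $P_0$ is a system with parameters on $\Gamma$, then it has a degenerate equilibrium $(\varphi_0,0)$ such that for every $\varepsilon>0$ there is $\delta>0$ with the following property: for every system with the same $m,l,g$ and with parameters in $II$ at distance less than $\delta$ from those of $P_0$, the right loop (if $C>0$), respectively the left loop (if $C<0$), of any eight-shaped separatrix lies in the $\varepsilon$-neighbourhood of $(\varphi_0+2\pi k,0)$ for some integer $k$. (Distances are taken in the maximum norm.) -/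

import Mathlib

open Filter Topology

/-- The data on which the averaged Hamiltonian of a pendulum with rapidly vibrating suspension
point depends: the mass `m` of the bob, the length `l` of the rod, the gravity acceleration `g`,
and the averages `A`, `B`, `C` of `ξ̇² / 2`, `η̇² / 2`, `ξ̇ η̇`, where `ξ`, `η` are the horizontal
and the vertical coordinate of the suspension point. -/
structure AveragedPendulum where
  m : ℝ
  l : ℝ
  g : ℝ
  A : ℝ
  B : ℝ
  C : ℝ
  m_pos : 0 < m
  l_pos : 0 < l
  g_pos : 0 < g

namespace AveragedPendulum

/-- The averaged potential energy. -/
noncomputable def V (P : AveragedPendulum) (φ : ℝ) : ℝ :=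
  P.m / 2 * ((P.A - P.B) * Real.cos (2 * φ) + P.C * Real.sin (2 * φ))
    - P.m * P.g * P.l * Real.cos φ

/-- The averaged Hamiltonian. -/
noncomputable def H (P : AveragedPendulum) (φ p : ℝ) : ℝ :=
  p ^ 2 / (2 * P.m * P.l ^ 2) + P.V φ

/-- The point `((B - A) / (g l), C / (g l))` of the parameter plane. -/
noncomputable def param (P : AveragedPendulum) : ℝ × ℝ :=
  ((P.B - P.A) / (P.g * P.l), P.C / (P.g * P.l))

/-- `γ = (φ, p)` is a solution, defined for all times, of Hamilton's equations
`φ' = ∂H/∂p`, `p' = -∂H/∂φ`. The angle `φ` is followed on the real line. -/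
def IsSolution (P : AveragedPendulum) (γ : ℝ → ℝ × ℝ) : Prop :=
  ∀ t : ℝ,
    HasDerivAt (fun u => (γ u).1) (deriv (fun p => P.H (γ t).1 p) (γ t).2) t ∧
    HasDerivAt (fun u => (γ u).2) (-deriv (fun φ => P.H φ (γ t).2) (γ t).1) t

/-- The point `z = (φ, p)` is an equilibrium of Hamilton's equations. -/
def IsEquilibrium (P : AveragedPendulum) (z : ℝ × ℝ) : Prop :=
  deriv (fun p => P.H z.1 p) z.2 = 0 ∧ deriv (fun φ => P.H φ z.2) z.1 = 0

/-- `(φ, 0)` is a degenerate equilibrium. -/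
def IsDegenerate (P : AveragedPendulum) (φ : ℝ) : Prop :=
  P.IsEquilibrium (φ, 0) ∧ deriv (deriv P.V) φ = 0

/-- `(φ, 0)` is a (nondegenerate) saddle equilibrium. -/
def IsSaddle (P : AveragedPendulum) (φ : ℝ) : Prop :=
  P.IsEquilibrium (φ, 0) ∧ deriv (deriv P.V) φ < 0

/-- `(φ, 0)` is a (nondegenerate) centre equilibrium. -/
def IsCentre (P : AveragedPendulum) (φ : ℝ) : Prop :=
  P.IsEquilibrium (φ, 0) ∧ 0 < deriv (deriv P.V) φ

/-- The projection of the `(φ, p)`-plane to the phase cylinder, on which `φ` is an angle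
modulo `2π`. -/
noncomputable def toCylinder (z : ℝ × ℝ) : Real.Angle × ℝ := ((z.1 : Real.Angle), z.2)

/-- The equilibria on the phase cylinder. -/
def equilibria (P : AveragedPendulum) : Set (Real.Angle × ℝ) :=
  toCylinder '' {z | P.IsEquilibrium z}

/-- The angles (modulo `2π`) of the saddles. -/
def saddles (P : AveragedPendulum) : Set Real.Angle :=
  (fun φ : ℝ => (φ : Real.Angle)) '' {φ | P.IsSaddle φ}

/-- The angles (modulo `2π`) of the centres. -/
def centres (P : AveragedPendulum) : Set Real.Angle :=
  (fun φ : ℝ => (φ : Real.Angle)) '' {φ | P.IsCentre φ}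

/-- The homeomorphism `h` of the phase cylinder maps the phase curves of `P` to phase curves of
`Q`, preserving the direction of time (but not necessarily its rate). -/
def MapsPhaseCurves (P Q : AveragedPendulum) (h : (Real.Angle × ℝ) ≃ₜ (Real.Angle × ℝ)) : Prop :=
  ∀ γ : ℝ → ℝ × ℝ, P.IsSolution γ →
    ∃ δ : ℝ → ℝ × ℝ, Q.IsSolution δ ∧
      ∃ τ : ℝ ≃o ℝ, ∀ t : ℝ, h (toCylinder (γ t)) = toCylinder (δ (τ t))

/-- `P` and `Q` have phase portraits of the same (topological) type. -/
def SamePortrait (P Q : AveragedPendulum) : Prop :=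
  ∃ h : (Real.Angle × ℝ) ≃ₜ (Real.Angle × ℝ),
    MapsPhaseCurves P Q h ∧ MapsPhaseCurves Q P h.symm

/-- There is a heteroclinic trajectory: it joins two different saddles. -/
def HasHeteroclinic (P : AveragedPendulum) : Prop :=
  ∃ s₁ s₂ : ℝ, P.IsSaddle s₁ ∧ P.IsSaddle s₂ ∧ (s₁ : Real.Angle) ≠ (s₂ : Real.Angle) ∧
    ∃ γ : ℝ → ℝ × ℝ, P.IsSolution γ ∧
      Tendsto γ atBot (𝓝 (s₁, 0)) ∧ Tendsto γ atTop (𝓝 (s₂, 0))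

/-- `γ` is a solution homoclinic to `(s, 0)`. As `φ` is followed on the real line, its loop does
not go around the phase cylinder. -/
def IsHomoclinic (P : AveragedPendulum) (s : ℝ) (γ : ℝ → ℝ × ℝ) : Prop :=
  P.IsSolution γ ∧ Tendsto γ atBot (𝓝 (s, 0)) ∧ Tendsto γ atTop (𝓝 (s, 0))

/-- The point `(s, 0)` with the curves `L` and `R` is an eight-shaped separatrix: `(s, 0)` is a
saddle, `L` and `R` are homoclinic trajectories to the left and to the right of it. -/
def IsEight (P : AveragedPendulum) (s : ℝ) (L R : Set (ℝ × ℝ)) : Prop :=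
  P.IsSaddle s ∧
    (∃ γ : ℝ → ℝ × ℝ, P.IsHomoclinic s γ ∧ (∀ t, (γ t).1 < s) ∧ L = Set.range γ) ∧
    (∃ γ : ℝ → ℝ × ℝ, P.IsHomoclinic s γ ∧ (∀ t, s < (γ t).1) ∧ R = Set.range γ)

/-- The reflection of the `(φ, p)`-plane in the line `φ = s`. -/
def mirror (s : ℝ) (z : ℝ × ℝ) : ℝ × ℝ := (2 * s - z.1, z.2)

/-- The mirror image of the loop `K` in the line `φ = s` passes strictly inside the loop `K'`:
at the abscissa of each of its points, `K'` has a point of larger `|p|`. (Loops of a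
separatrix are symmetric under `p ↦ -p`.) -/
def MirrorInside (s : ℝ) (K K' : Set (ℝ × ℝ)) : Prop :=
  ∀ z ∈ K, ∃ z' ∈ K', z'.1 = (mirror s z).1 ∧ |z.2| < |z'.2|

/-- The critical curve `Γ` in the parameter plane: the parameters for which there is a degenerate
equilibrium. -/
def criticalCurve : Set (ℝ × ℝ) :=
  {q | ∃ P : AveragedPendulum, P.param = q ∧ ∃ φ : ℝ, P.IsDegenerate φ}

/-- The ray `C = 0`, `2 (B - A) / (g l) > 1` in the parameter plane. -/
def ray : Set (ℝ × ℝ) := {q | q.2 = 0 ∧ 1 < 2 * q.1}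

end AveragedPendulum

/-! Division of the potential by `m g l` leaves a function `redV q` of the angle which depends only
on the point `q = (a, c)` of the parameter plane. Its derivative `redV₁ q` is a trigonometric
polynomial of degree two, so everything rests on the zeros of such a polynomial.

The curve. For a given angle the two equations of degeneracy are linear in `(a, c)` with a nonzero
determinant, which yields the parametrization (`redV₁_redV₂_eq_zero_iff`). Implicitly the curve is
the zero set of `discr`. With `c = s ^ 3` this becomes a difference of two cubes; hence `discr < 0`
is star-shaped about the origin and `discr > 0` is stable under expansion (`discr_smul_neg`,
`discr_smul_pos`). This gives connectedness and the frontiers.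

Equilibria. A maximum and a minimum of the potential are two zeros of the force. They split off, and
the quotient is a harmonic of degree one whose own discriminant has the sign of `discr`
(`redV₁_factor`). So there are two zeros on a period in `I` and four in `II`, with alternating signs
of the force between them (`exists_two_zeros`, `exists_four_zeros`, packed as `WellSeq`).

The eight. At a saddle `s` one has `redV q (s + x) - redV q s = (1 - cos x) * loopFn q s x` with
`loopFn` a harmonic of degree one. Both loops exist exactly if `s` is not a global maximum
(`exists_isEight_iff`). Then `loopFn` changes sign, which forces `c = sin s * ρ` with `ρ > 0`
(`IsLowSaddle.exists_snd_eq`). As the difference of the potential at `s + x` and `s - x` is `2 sin s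
sin x (1 - cos x)`, the sign of `C` decides which loop is smaller. Two distinct saddles are equally
high only on the ray (`mem_ray_of_redV_eq`), and there the potential is a constant minus a square,
with both saddles on top. By conservation of energy this settles heteroclinic trajectories, and also
where the eight exists.

Shrinking. The equilibria around the smaller loop satisfy finitely or infinitely many weak
inequalities and equations, a closed condition. On the critical curve these force the loop to a
degenerate point (`LoopConfiguration.collapse`), and compactness extends this to a neighbourhood.

Same type. If the saddle levels of two systems correspond, there are an increasing map `κ` of the
angles and increasing maps of the energies, one for each strip between critical points, which carry
one potential to the other (`WellSeq.exists_matching`). Sending `(φ, p)` to the angle `κ φ`, with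
the momentum of the same sign and the transformed energy, is a homeomorphism taking level curves to
level curves. Away from equilibria a level curve is locally a trajectory, so the image of a
trajectory is a trajectory after an increasing change of time (`Matching.exists_timeIso`).

Different type. A homeomorphism of portraits preserves the number of equilibria, which separates `I`
from `II`. It carries a heteroclinic trajectory to one with two distinct limit equilibria, which
must be saddles of equal height; this separates the ray from the rest of `II`. -/

namespace AveragedPendulum

/-! ### The reduced potential -/

/-- The potential divided by `m g l`, as a function of the point of the parameter plane. -/
noncomputable def redV (q : ℝ × ℝ) (φ : ℝ) : ℝ :=
  -(q.1 / 2) * Real.cos (2 * φ) + q.2 / 2 * Real.sin (2 * φ) - Real.cos φ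

/-- The first derivative of the reduced potential. -/
noncomputable def redV₁ (q : ℝ × ℝ) (φ : ℝ) : ℝ :=
  q.1 * Real.sin (2 * φ) + q.2 * Real.cos (2 * φ) + Real.sin φ

/-- The second derivative of the reduced potential. -/
noncomputable def redV₂ (q : ℝ × ℝ) (φ : ℝ) : ℝ :=
  2 * q.1 * Real.cos (2 * φ) - 2 * q.2 * Real.sin (2 * φ) + Real.cos φ

lemma hasDerivAt_cos_two_mul (φ : ℝ) :
    HasDerivAt (fun φ => Real.cos (2 * φ)) (-(2 * Real.sin (2 * φ))) φ := by
  have := (Real.hasDerivAt_cos (2 * φ)).comp φ ((hasDerivAt_id φ).const_mul 2)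
  convert! this using 1; simp; ring

lemma hasDerivAt_sin_two_mul (φ : ℝ) :
    HasDerivAt (fun φ => Real.sin (2 * φ)) (2 * Real.cos (2 * φ)) φ := by
  have := (Real.hasDerivAt_sin (2 * φ)).comp φ ((hasDerivAt_id φ).const_mul 2)
  convert! this using 1; simp; ring

lemma hasDerivAt_redV (q : ℝ × ℝ) (φ : ℝ) : HasDerivAt (redV q) (redV₁ q φ) φ := by
  have := (((hasDerivAt_cos_two_mul φ).const_mul (-(q.1 / 2))).add
    ((hasDerivAt_sin_two_mul φ).const_mul (q.2 / 2))).sub (Real.hasDerivAt_cos φ)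
  convert! this using 1
  simp only [redV₁]; ring

lemma hasDerivAt_redV₁ (q : ℝ × ℝ) (φ : ℝ) : HasDerivAt (redV₁ q) (redV₂ q φ) φ := by
  have := (((hasDerivAt_sin_two_mul φ).const_mul q.1).add
    ((hasDerivAt_cos_two_mul φ).const_mul q.2)).add (Real.hasDerivAt_sin φ)
  convert! this using 1
  simp only [redV₂]; ring

@[fun_prop] lemma continuous_redV (q : ℝ × ℝ) : Continuous (redV q) := by
  unfold redV; fun_prop

@[fun_prop] lemma continuous_redV₁ (q : ℝ × ℝ) : Continuous (redV₁ q) := by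
  unfold redV₁; fun_prop

lemma redV_add_two_pi (q : ℝ × ℝ) (φ : ℝ) : redV q (φ + 2 * Real.pi) = redV q φ := by
  have h : 2 * (φ + 2 * Real.pi) = 2 * φ + (2 : ℕ) * (2 * Real.pi) := by push_cast; ring
  simp only [redV, h, Real.cos_add_nat_mul_two_pi, Real.sin_add_nat_mul_two_pi,
    Real.cos_add_two_pi]

lemma redV₁_add_two_pi (q : ℝ × ℝ) (φ : ℝ) : redV₁ q (φ + 2 * Real.pi) = redV₁ q φ := by
  have h : 2 * (φ + 2 * Real.pi) = 2 * φ + (2 : ℕ) * (2 * Real.pi) := by push_cast; ring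
  simp only [redV₁, h, Real.cos_add_nat_mul_two_pi, Real.sin_add_nat_mul_two_pi,
    Real.sin_add_two_pi]

lemma redV₂_add_two_pi (q : ℝ × ℝ) (φ : ℝ) : redV₂ q (φ + 2 * Real.pi) = redV₂ q φ := by
  have h : 2 * (φ + 2 * Real.pi) = 2 * φ + (2 : ℕ) * (2 * Real.pi) := by push_cast; ring
  simp only [redV₂, h, Real.cos_add_nat_mul_two_pi, Real.sin_add_nat_mul_two_pi,
    Real.cos_add_two_pi]

/-- The factor `m g l` between the potential and the reduced potential. -/
def scale (P : AveragedPendulum) : ℝ := P.m * P.g * P.l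

lemma scale_pos (P : AveragedPendulum) : 0 < P.scale :=
  mul_pos (mul_pos P.m_pos P.g_pos) P.l_pos

/-- The moment of inertia `m l²`. -/
def inertia (P : AveragedPendulum) : ℝ := P.m * P.l ^ 2

lemma inertia_pos (P : AveragedPendulum) : 0 < P.inertia :=
  mul_pos P.m_pos (pow_pos P.l_pos 2)

lemma V_eq (P : AveragedPendulum) (φ : ℝ) : P.V φ = P.scale * redV P.param φ := by
  have h1 := P.g_pos.ne'
  have h2 := P.l_pos.ne'
  simp only [V, scale, redV, param]
  field_simp
  ring

lemma V_eq_fun (P : AveragedPendulum) : P.V = fun φ => P.scale * redV P.param φ :=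
  funext P.V_eq

lemma hasDerivAt_V (P : AveragedPendulum) (φ : ℝ) :
    HasDerivAt P.V (P.scale * redV₁ P.param φ) φ := by
  rw [V_eq_fun]; exact (hasDerivAt_redV _ φ).const_mul _

lemma deriv_V (P : AveragedPendulum) : deriv P.V = fun φ => P.scale * redV₁ P.param φ :=
  funext fun φ => (P.hasDerivAt_V φ).deriv

lemma deriv_deriv_V (P : AveragedPendulum) (φ : ℝ) :
    deriv (deriv P.V) φ = P.scale * redV₂ P.param φ := by
  rw [deriv_V]; exact ((hasDerivAt_redV₁ _ φ).const_mul _).deriv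

@[fun_prop] lemma continuous_V (P : AveragedPendulum) : Continuous P.V := by
  rw [V_eq_fun]; fun_prop

lemma V_add_two_pi (P : AveragedPendulum) (φ : ℝ) : P.V (φ + 2 * Real.pi) = P.V φ := by
  rw [V_eq, V_eq, redV_add_two_pi]

lemma V_lt_V_iff (P : AveragedPendulum) {x y : ℝ} :
    P.V x < P.V y ↔ redV P.param x < redV P.param y := by
  rw [V_eq, V_eq, mul_lt_mul_iff_right₀ P.scale_pos]

lemma V_le_V_iff (P : AveragedPendulum) {x y : ℝ} :
    P.V x ≤ P.V y ↔ redV P.param x ≤ redV P.param y := by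
  rw [V_eq, V_eq, mul_le_mul_iff_right₀ P.scale_pos]

lemma H_eq (P : AveragedPendulum) (φ p : ℝ) : P.H φ p = p ^ 2 / (2 * P.inertia) + P.V φ := by
  simp only [H, inertia, mul_assoc]

lemma V_eq_V_iff (P : AveragedPendulum) {x y : ℝ} :
    P.V x = P.V y ↔ redV P.param x = redV P.param y := by
  rw [V_eq, V_eq, mul_right_inj' P.scale_pos.ne']

lemma deriv_H_snd (P : AveragedPendulum) (φ p : ℝ) :
    deriv (fun p => P.H φ p) p = p / P.inertia := by
  have h : HasDerivAt (fun p => P.H φ p) (p / P.inertia) p := by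
    simp only [H_eq]
    have := ((hasDerivAt_pow 2 p).div_const (2 * P.inertia)).add_const (P.V φ)
    convert! this using 1
    have := P.inertia_pos.ne'
    push_cast; field_simp
  exact h.deriv

lemma deriv_H_fst (P : AveragedPendulum) (φ p : ℝ) :
    deriv (fun φ => P.H φ p) φ = P.scale * redV₁ P.param φ := by
  simp only [H_eq]
  exact ((P.hasDerivAt_V φ).const_add _).deriv

lemma isEquilibrium_iff (P : AveragedPendulum) (z : ℝ × ℝ) :
    P.IsEquilibrium z ↔ z.2 = 0 ∧ redV₁ P.param z.1 = 0 := by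
  simp only [IsEquilibrium, deriv_H_snd, deriv_H_fst, div_eq_zero_iff, mul_eq_zero,
    P.inertia_pos.ne', P.scale_pos.ne', or_false, false_or]

lemma isDegenerate_iff (P : AveragedPendulum) (φ : ℝ) :
    P.IsDegenerate φ ↔ redV₁ P.param φ = 0 ∧ redV₂ P.param φ = 0 := by
  simp [IsDegenerate, isEquilibrium_iff, deriv_deriv_V, P.scale_pos.ne']

lemma isSaddle_iff (P : AveragedPendulum) (φ : ℝ) :
    P.IsSaddle φ ↔ redV₁ P.param φ = 0 ∧ redV₂ P.param φ < 0 := by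
  simp [IsSaddle, isEquilibrium_iff, deriv_deriv_V, mul_neg_iff, P.scale_pos,
    P.scale_pos.not_gt]

lemma isCentre_iff (P : AveragedPendulum) (φ : ℝ) :
    P.IsCentre φ ↔ redV₁ P.param φ = 0 ∧ 0 < redV₂ P.param φ := by
  simp [IsCentre, isEquilibrium_iff, deriv_deriv_V, P.scale_pos]

/-! ### The Hamiltonian flow -/

/-- The Hamiltonian vector field. -/
noncomputable def field (P : AveragedPendulum) (z : ℝ × ℝ) : ℝ × ℝ :=
  (z.2 / P.inertia, -(P.scale * redV₁ P.param z.1))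

lemma isSolution_iff (P : AveragedPendulum) (γ : ℝ → ℝ × ℝ) :
    P.IsSolution γ ↔ ∀ t, HasDerivAt γ (P.field (γ t)) t := by
  simp only [IsSolution, deriv_H_snd, deriv_H_fst, field]
  refine forall_congr' fun t => ⟨fun h => h.1.prodMk h.2, fun h => ?_⟩
  exact ⟨(ContinuousLinearMap.fst ℝ ℝ ℝ).hasFDerivAt.comp_hasDerivAt t h,
    (ContinuousLinearMap.snd ℝ ℝ ℝ).hasFDerivAt.comp_hasDerivAt t h⟩

lemma IsSolution.hasDerivAt_fst {P : AveragedPendulum} {γ : ℝ → ℝ × ℝ} (h : P.IsSolution γ)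
    (t : ℝ) : HasDerivAt (fun t => (γ t).1) ((γ t).2 / P.inertia) t := by
  simpa only [deriv_H_snd] using (h t).1

lemma IsSolution.hasDerivAt_snd {P : AveragedPendulum} {γ : ℝ → ℝ × ℝ} (h : P.IsSolution γ)
    (t : ℝ) : HasDerivAt (fun t => (γ t).2) (-(P.scale * redV₁ P.param (γ t).1)) t := by
  simpa only [deriv_H_fst] using (h t).2

lemma IsSolution.continuous {P : AveragedPendulum} {γ : ℝ → ℝ × ℝ} (h : P.IsSolution γ) :
    Continuous γ :=
  continuous_iff_continuousAt.2 fun t => (((P.isSolution_iff γ).1 h) t).continuousAt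

lemma isSolution_mk {P : AveragedPendulum} {γ : ℝ → ℝ × ℝ}
    (h1 : ∀ t, HasDerivAt (fun t => (γ t).1) ((γ t).2 / P.inertia) t)
    (h2 : ∀ t, HasDerivAt (fun t => (γ t).2) (-(P.scale * redV₁ P.param (γ t).1)) t) :
    P.IsSolution γ := fun t => by
  rw [deriv_H_snd, deriv_H_fst]; exact ⟨h1 t, h2 t⟩

lemma abs_redV₂_le (q : ℝ × ℝ) (φ : ℝ) : |redV₂ q φ| ≤ 2 * |q.1| + 2 * |q.2| + 1 := by
  have h1 := Real.abs_cos_le_one (2 * φ)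
  have h2 := Real.abs_sin_le_one (2 * φ)
  have h3 := Real.abs_cos_le_one φ
  calc |redV₂ q φ| ≤ |2 * q.1 * Real.cos (2 * φ)| + |2 * q.2 * Real.sin (2 * φ)| + |Real.cos φ| :=
        (abs_add_le _ _).trans (add_le_add_left (abs_sub _ _) _)
    _ ≤ _ := by
        simp only [abs_mul, abs_two]
        have := abs_nonneg q.1
        have := abs_nonneg q.2
        nlinarith

lemma lipschitzWith_redV₁ (q : ℝ × ℝ) :
    LipschitzWith (2 * |q.1| + 2 * |q.2| + 1).toNNReal (redV₁ q) :=
  lipschitzWith_of_nnnorm_deriv_le (fun x => (hasDerivAt_redV₁ q x).differentiableAt) fun x => by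
    rw [(hasDerivAt_redV₁ q x).deriv, ← NNReal.coe_le_coe, coe_nnnorm, Real.norm_eq_abs,
      Real.coe_toNNReal _ (by positivity)]
    exact abs_redV₂_le q x

/-- The force is bounded together with its derivative, so the Lipschitz constant is global. This is
what gives uniqueness and solutions for all times. -/
lemma exists_lipschitzWith_field (P : AveragedPendulum) : ∃ K, LipschitzWith K P.field := by
  have h1 := (lipschitzWith_smul (P.inertia⁻¹ : ℝ)).comp
    (LipschitzWith.prod_snd (α := ℝ) (β := ℝ))
  have h2 := ((lipschitzWith_smul (-P.scale : ℝ)).comp (lipschitzWith_redV₁ P.param)).comp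
    (LipschitzWith.prod_fst (α := ℝ) (β := ℝ))
  have h3 : P.field = fun z => (P.inertia⁻¹ • z.2, -P.scale • redV₁ P.param z.1) := by
    funext z
    simp [field, div_eq_inv_mul]
  rw [h3]
  exact ⟨_, h1.prodMk h2⟩

lemma contDiff_field (P : AveragedPendulum) : ContDiff ℝ 1 P.field := by
  unfold field redV₁
  fun_prop

lemma isSolution_unique {P : AveragedPendulum} {γ δ : ℝ → ℝ × ℝ} (hγ : P.IsSolution γ)
    (hδ : P.IsSolution δ) {t₀ : ℝ} (h : γ t₀ = δ t₀) : γ = δ := by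
  obtain ⟨K, hK⟩ := P.exists_lipschitzWith_field
  exact ODE_solution_unique_univ (v := fun _ => P.field) (s := fun _ => Set.univ) (K := K)
    (fun _ => hK.lipschitzOnWith) (fun t => ⟨(P.isSolution_iff γ).1 hγ t, trivial⟩)
    (fun t => ⟨(P.isSolution_iff δ).1 hδ t, trivial⟩) h

/-- An autonomous Lipschitz vector field has local solutions on a uniform time interval. -/
lemma exists_local_solution {E : Type*} [NormedAddCommGroup E] [NormedSpace ℝ E] [CompleteSpace E]
    {v : E → E} {K : NNReal} (hv : LipschitzWith K v) (x : E) :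
    ∃ γ : ℝ → E, γ 0 = x ∧ ∀ t ∈ Set.Ioo (-(1 / (1 + K : ℝ))) (1 / (1 + K : ℝ)),
      HasDerivAt γ (v (γ t)) t := by
  set ε : ℝ := 1 / (1 + K : ℝ) with hε
  have hK : (0 : ℝ) < 1 + K := by positivity
  have hεpos : 0 < ε := by positivity
  have h0 : (0 : ℝ) ∈ Set.Icc (-ε) ε := ⟨by linarith, hεpos.le⟩
  -- On the ball of radius `‖v x‖ + 1` the field is at most `‖v x‖ + K (‖v x‖ + 1)`, which does not
  -- exceed `1 + K` times the radius. Hence the time `1 / (1 + K)` does not depend on `x`.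
  have hpl : IsPicardLindelof (fun _ : ℝ => v) (⟨0, h0⟩ : Set.Icc (-ε) ε) x (‖v x‖₊ + 1) 0
      (‖v x‖₊ + K * (‖v x‖₊ + 1)) K := by
    refine ⟨fun _ _ => hv.lipschitzOnWith, fun _ _ => continuousOn_const, fun _ _ y hy => ?_, ?_⟩
    · have h1 := hv.dist_le_mul y x
      rw [dist_eq_norm] at h1
      have h2 : dist y x ≤ ‖v x‖ + 1 := by simpa using hy
      have h3 : ‖v y‖ ≤ ‖v x‖ + ‖v y - v x‖ := by
        simpa using norm_add_le (v x) (v y - v x)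
      push_cast
      have := mul_le_mul_of_nonneg_left h2 K.coe_nonneg
      linarith
    · simp only [sub_zero, zero_sub, neg_neg, max_self]
      push_cast
      simp only [hε]
      rw [mul_one_div, div_le_iff₀ hK]
      nlinarith [norm_nonneg (v x), K.coe_nonneg]
  obtain ⟨α, h1, h2⟩ := hpl.exists_eq_forall_mem_Icc_hasDerivWithinAt₀
  exact ⟨α, h1, fun t ht => (h2 t ⟨ht.1.le, ht.2.le⟩).hasDerivAt (Icc_mem_nhds ht.1 ht.2)⟩

/-- Local solutions live on an interval of uniform length, so they continue indefinitely. -/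
lemma exists_isSolution (P : AveragedPendulum) (z : ℝ × ℝ) :
    ∃ γ : ℝ → ℝ × ℝ, γ 0 = z ∧ P.IsSolution γ := by
  obtain ⟨K, hK⟩ := P.exists_lipschitzWith_field
  have hpos : 0 < 1 / (1 + K : ℝ) := by positivity
  obtain ⟨γ, h0, h⟩ := exists_isMIntegralCurve_of_isMIntegralCurveOn
    (I := modelWithCornersSelf ℝ (ℝ × ℝ)) (M := ℝ × ℝ) (v := P.field)
    (contMDiff_vectorSpace_iff_contDiff.2 P.contDiff_field) hpos
    (fun x => by
      obtain ⟨γ, h0, h⟩ := exists_local_solution hK x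
      refine ⟨γ, h0, ?_⟩
      exact fun t ht => (h t ht).hasFDerivAt.hasMFDerivAt.hasMFDerivWithinAt) z
  refine ⟨γ, h0, (P.isSolution_iff γ).2 fun t => ?_⟩
  exact hasDerivAt_iff_hasFDerivAt.2 (hasMFDerivAt_iff_hasFDerivAt.1 (h t))

/-- The flow of Hamilton's equations. -/
noncomputable def flow (P : AveragedPendulum) (z : ℝ × ℝ) : ℝ → ℝ × ℝ :=
  (P.exists_isSolution z).choose

@[simp] lemma flow_zero (P : AveragedPendulum) (z : ℝ × ℝ) : P.flow z 0 = z :=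
  (P.exists_isSolution z).choose_spec.1

lemma isSolution_flow (P : AveragedPendulum) (z : ℝ × ℝ) : P.IsSolution (P.flow z) :=
  (P.exists_isSolution z).choose_spec.2

lemma IsSolution.comp_add_const {P : AveragedPendulum} {γ : ℝ → ℝ × ℝ} (h : P.IsSolution γ)
    (c : ℝ) : P.IsSolution fun t => γ (t + c) :=
  isSolution_mk (fun t => (h.hasDerivAt_fst (t + c)).comp_add_const t c)
    fun t => (h.hasDerivAt_snd (t + c)).comp_add_const t c

lemma IsSolution.eq_flow {P : AveragedPendulum} {γ : ℝ → ℝ × ℝ} (h : P.IsSolution γ) (c t : ℝ) :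
    γ (t + c) = P.flow (γ c) t :=
  congrFun (isSolution_unique (h.comp_add_const c) (P.isSolution_flow _) (t₀ := 0) (by simp)) t

lemma flow_add (P : AveragedPendulum) (z : ℝ × ℝ) (s t : ℝ) :
    P.flow z (s + t) = P.flow (P.flow z s) t := by
  rw [add_comm]; exact (P.isSolution_flow z).eq_flow s t

lemma isSolution_const {P : AveragedPendulum} {z : ℝ × ℝ} (h : P.IsEquilibrium z) :
    P.IsSolution fun _ => z := by
  rw [isEquilibrium_iff] at h
  refine isSolution_mk (fun t => ?_) fun t => ?_
  · simpa [h.1] using hasDerivAt_const t z.1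
  · simpa [h.2] using hasDerivAt_const t z.2

lemma IsSolution.eq_const {P : AveragedPendulum} {γ : ℝ → ℝ × ℝ} (h : P.IsSolution γ) {t₀ : ℝ}
    (h0 : P.IsEquilibrium (γ t₀)) (t : ℝ) : γ t = γ t₀ :=
  congrFun (isSolution_unique h (isSolution_const h0) (t₀ := t₀) rfl) t

lemma IsSolution.isEquilibrium_iff {P : AveragedPendulum} {γ : ℝ → ℝ × ℝ} (h : P.IsSolution γ)
    (t s : ℝ) : P.IsEquilibrium (γ t) ↔ P.IsEquilibrium (γ s) :=
  ⟨fun h0 => by rwa [h.eq_const h0 s], fun h0 => by rwa [h.eq_const h0 t]⟩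

lemma hasDerivAt_H_comp {P : AveragedPendulum} {γ : ℝ → ℝ × ℝ} (h : P.IsSolution γ) (t : ℝ) :
    HasDerivAt (fun t => P.H (γ t).1 (γ t).2) 0 t := by
  simp only [H_eq]
  have h1 := ((h.hasDerivAt_snd t).pow 2).div_const (2 * P.inertia)
  have h2 := (P.hasDerivAt_V (γ t).1).comp t (h.hasDerivAt_fst t)
  convert! h1.add h2 using 1
  have := P.inertia_pos.ne'
  field_simp
  ring

lemma IsSolution.H_const {P : AveragedPendulum} {γ : ℝ → ℝ × ℝ} (h : P.IsSolution γ) (t s : ℝ) :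
    P.H (γ t).1 (γ t).2 = P.H (γ s).1 (γ s).2 :=
  is_const_of_deriv_eq_zero (fun t => (hasDerivAt_H_comp h t).differentiableAt)
    (fun t => (hasDerivAt_H_comp h t).deriv) t s

@[fun_prop] lemma continuous_H (P : AveragedPendulum) : Continuous fun z : ℝ × ℝ => P.H z.1 z.2 := by
  simp only [H_eq]; fun_prop

/-- A function which converges together with its derivative has derivative tending to `0`. -/
lemma eq_zero_of_tendsto_deriv {f f' : ℝ → ℝ} {a b : ℝ} (hf : ∀ t, HasDerivAt f (f' t) t)
    (h : Tendsto f atTop (𝓝 a)) (h' : Tendsto f' atTop (𝓝 b)) : b = 0 := by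
  have h1 : Tendsto (fun t => f (t + 1) - f t) atTop (𝓝 0) := by
    simpa using (h.comp (tendsto_atTop_add_const_right _ 1 tendsto_id)).sub h
  have h2 : ∀ t, ∃ c ∈ Set.Ioo t (t + 1), f' c = f (t + 1) - f t := fun t => by
    obtain ⟨c, hc, h⟩ := exists_hasDerivAt_eq_slope f f' (lt_add_one t)
      (fun x _ => (hf x).continuousAt.continuousWithinAt) fun x _ => hf x
    exact ⟨c, hc, by rw [h]; simp⟩
  choose c hc hc' using h2
  have h3 : Tendsto c atTop atTop := tendsto_atTop_mono (fun t => (hc t).1.le) tendsto_id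
  have h4 := h'.comp h3
  refine tendsto_nhds_unique h4 ?_
  simpa [Function.comp_def, hc'] using h1

lemma IsSolution.isEquilibrium_of_tendsto {P : AveragedPendulum} {γ : ℝ → ℝ × ℝ}
    (h : P.IsSolution γ) {z : ℝ × ℝ} (hz : Tendsto γ atTop (𝓝 z)) : P.IsEquilibrium z := by
  have h1 : Tendsto (fun t => (γ t).1) atTop (𝓝 z.1) := (continuous_fst.tendsto z).comp hz
  have h2 : Tendsto (fun t => (γ t).2) atTop (𝓝 z.2) := (continuous_snd.tendsto z).comp hz
  have h3 := eq_zero_of_tendsto_deriv h.hasDerivAt_fst h1 (h2.div_const _)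
  have h4 := eq_zero_of_tendsto_deriv h.hasDerivAt_snd h2
    ((((continuous_redV₁ P.param).tendsto _).comp h1).const_mul P.scale).neg
  rw [AveragedPendulum.isEquilibrium_iff]
  refine ⟨by simpa [P.inertia_pos.ne'] using h3, by simpa [P.scale_pos.ne'] using h4⟩

/-! ### Symmetries -/

/-- The image of a solution under reversal of time. -/
lemma IsSolution.reverse {P : AveragedPendulum} {γ : ℝ → ℝ × ℝ} (h : P.IsSolution γ) :
    P.IsSolution fun t => ((γ (-t)).1, -(γ (-t)).2) := by
  refine isSolution_mk (fun t => ?_) fun t => ?_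
  · have := (h.hasDerivAt_fst (-t)).comp t (hasDerivAt_neg t)
    convert! this using 1
    ring
  · have := ((h.hasDerivAt_snd (-t)).comp t (hasDerivAt_neg t)).neg
    convert! this using 1
    ring

/-- The pendulum reflected in the vertical line. -/
def reflect (P : AveragedPendulum) : AveragedPendulum := { P with C := -P.C }

@[simp] lemma reflect_reflect (P : AveragedPendulum) : P.reflect.reflect = P := by
  simp [reflect]

lemma param_reflect (P : AveragedPendulum) : P.reflect.param = (P.param.1, -P.param.2) := by
  simp [reflect, param, neg_div]

lemma redV_reflect (a c φ : ℝ) : redV (a, -c) φ = redV (a, c) (-φ) := by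
  simp [redV]; ring

lemma redV₁_reflect (a c φ : ℝ) : redV₁ (a, -c) φ = -redV₁ (a, c) (-φ) := by
  simp [redV₁]; ring

lemma redV₂_reflect (a c φ : ℝ) : redV₂ (a, -c) φ = redV₂ (a, c) (-φ) := by
  simp [redV₂]

lemma V_reflect (P : AveragedPendulum) (φ : ℝ) : P.reflect.V φ = P.V (-φ) := by
  rw [V_eq, V_eq, param_reflect, redV_reflect]; rfl

lemma isSaddle_reflect {P : AveragedPendulum} {s : ℝ} :
    P.reflect.IsSaddle s ↔ P.IsSaddle (-s) := by
  rw [isSaddle_iff, isSaddle_iff, param_reflect, redV₁_reflect, redV₂_reflect, neg_eq_zero]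

lemma isDegenerate_reflect {P : AveragedPendulum} {s : ℝ} :
    P.reflect.IsDegenerate s ↔ P.IsDegenerate (-s) := by
  rw [isDegenerate_iff, isDegenerate_iff, param_reflect, redV₁_reflect, redV₂_reflect, neg_eq_zero]

lemma IsSolution.reflect {P : AveragedPendulum} {γ : ℝ → ℝ × ℝ} (h : P.IsSolution γ) :
    P.reflect.IsSolution fun t => -γ t := by
  refine isSolution_mk (fun t => ?_) fun t => ?_
  · convert! (h.hasDerivAt_fst t).neg using 1
    simp [inertia, AveragedPendulum.reflect, neg_div]
  · convert! (h.hasDerivAt_snd t).neg using 1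
    rw [param_reflect, redV₁_reflect]
    simp [scale, AveragedPendulum.reflect]


/-! ### The critical curve and its complement -/

/-- The discriminant, whose zero set is the critical curve. -/
noncomputable def discr (q : ℝ × ℝ) : ℝ := (q.1 ^ 2 + q.2 ^ 2 - 1 / 4) ^ 3 - 27 / 64 * q.2 ^ 2

@[fun_prop] lemma continuous_discr : Continuous discr := by
  unfold discr; fun_prop

/-- The bounded domain of the complement of the critical curve. -/
def domI : Set (ℝ × ℝ) := {q | discr q < 0}

/-- The unbounded domain of the complement of the critical curve. -/
def domII : Set (ℝ × ℝ) := {q | 0 < discr q}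

lemma exists_cube_eq (c : ℝ) : ∃ s : ℝ, s ^ 3 = c := by
  have h0 : Tendsto (fun s : ℝ => s ^ 3) atTop atTop := tendsto_pow_atTop (by norm_num)
  have h1 : Tendsto (fun s : ℝ => s ^ 3) atBot atBot := by
    have := tendsto_neg_atTop_atBot.comp (h0.comp tendsto_neg_atBot_atTop)
    refine this.congr fun s => ?_
    simp only [Function.comp_apply]; ring
  have h : Function.Surjective fun s : ℝ => s ^ 3 := (continuous_pow 3).surjective h0 h1
  exact h c

/-- With the cube root of `c` as coordinate the discriminant is a difference of cubes, and its sign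
is that of the difference of the bases. -/
lemma discr_cube (a s : ℝ) :
    discr (a, s ^ 3) = (a ^ 2 + s ^ 6 - 1 / 4) ^ 3 - (3 / 4 * s ^ 2) ^ 3 := by
  simp only [discr]; ring

lemma discr_cube_neg {a s : ℝ} : discr (a, s ^ 3) < 0 ↔ a ^ 2 + s ^ 6 - 1 / 4 < 3 / 4 * s ^ 2 := by
  rw [discr_cube, sub_neg]
  exact (Odd.strictMono_pow (by decide : Odd 3)).lt_iff_lt

lemma discr_cube_nonpos {a s : ℝ} :
    discr (a, s ^ 3) ≤ 0 ↔ a ^ 2 + s ^ 6 - 1 / 4 ≤ 3 / 4 * s ^ 2 := by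
  rw [discr_cube, sub_nonpos]
  exact (Odd.strictMono_pow (by decide : Odd 3)).le_iff_le

lemma discr_cube_eq_zero {a s : ℝ} :
    discr (a, s ^ 3) = 0 ↔ a ^ 2 + s ^ 6 - 1 / 4 = 3 / 4 * s ^ 2 := by
  rw [discr_cube, sub_eq_zero]
  exact (Odd.strictMono_pow (by decide : Odd 3)).injective.eq_iff

/-- With `t = u ^ 3` and `c = s ^ 3` the claim reads `u⁶ (a² + s⁶) < 1/4 + 3/4 u² s²`. It follows
from `u⁶ ≤ u²` and the inequality for `q` multiplied by `u² < 1`. -/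
lemma discr_smul_neg {q : ℝ × ℝ} (h : discr q ≤ 0) {t : ℝ} (h0 : 0 ≤ t) (h1 : t < 1) :
    discr (t • q) < 0 := by
  obtain ⟨a, c⟩ := q
  obtain ⟨s, rfl⟩ := exists_cube_eq c
  obtain ⟨u, rfl⟩ := exists_cube_eq t
  have hu : 0 ≤ u := by
    by_contra! hu
    exact absurd (Odd.pow_neg (by decide : Odd 3) hu) (not_lt.2 h0)
  have hu1 : u < 1 := by
    by_contra! hu1
    exact absurd (one_le_pow₀ hu1 : 1 ≤ u ^ 3) (not_le.2 h1)
  rw [discr_cube_nonpos] at h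
  have he : u ^ 3 • (a, s ^ 3) = (u ^ 3 * a, (u * s) ^ 3) := by
    simp [mul_pow]
  rw [he, discr_cube_neg]
  have h2 : u ^ 2 < 1 := by nlinarith
  have h6 : u ^ 6 ≤ u ^ 2 := pow_le_pow_of_le_one hu hu1.le (by norm_num)
  have h3 : 0 ≤ a ^ 2 + s ^ 6 := by positivity
  have h4 := mul_le_mul_of_nonneg_right h6 h3
  have h5 := mul_le_mul_of_nonneg_left h (sq_nonneg u)
  nlinarith

lemma discr_smul_pos {q : ℝ × ℝ} (h : 0 ≤ discr q) {t : ℝ} (h1 : 1 < t) : 0 < discr (t • q) := by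
  by_contra! h2
  have h3 := discr_smul_neg h2 (t := t⁻¹) (by positivity) (inv_lt_one_of_one_lt₀ h1)
  rw [smul_smul, inv_mul_cancel₀ (by positivity), one_smul] at h3
  linarith

/-- With `r = a² + c²` the discriminant is at least `(r - 1/4)³ - 27 r / 64`, which vanishes at `r =
1` and increases from there. -/
lemma discr_pos_of_one_lt {q : ℝ × ℝ} (h : 1 < q.1 ^ 2 + q.2 ^ 2) : 0 < discr q := by
  have h2 : q.2 ^ 2 ≤ q.1 ^ 2 + q.2 ^ 2 := by nlinarith [sq_nonneg q.1]
  simp only [discr]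
  set r := q.1 ^ 2 + q.2 ^ 2
  nlinarith [mul_pos (sub_pos.2 h) (sub_pos.2 h),
    mul_pos (mul_pos (sub_pos.2 h) (sub_pos.2 h)) (sub_pos.2 h)]

lemma discr_zero_neg : discr 0 < 0 := by norm_num [discr]

lemma isOpen_domI : IsOpen domI := isOpen_lt continuous_discr continuous_const

lemma isOpen_domII : IsOpen domII := isOpen_lt continuous_const continuous_discr

lemma isConnected_domI : IsConnected domI := by
  refine ⟨⟨0, discr_zero_neg⟩, isPreconnected_of_forall 0 fun q hq => ?_⟩
  refine ⟨(fun t : ℝ => t • q) '' Set.Icc 0 1, ?_, ⟨0, by simp⟩, ⟨1, by simp⟩,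
    isPreconnected_Icc.image _ (by fun_prop)⟩
  rintro _ ⟨t, ht, rfl⟩
  rcases ht.2.eq_or_lt with h | h
  · simpa [h] using hq
  · exact discr_smul_neg (le_of_lt hq) ht.1 h

lemma isPreconnected_exterior : IsPreconnected {q : ℝ × ℝ | 1 < q.1 ^ 2 + q.2 ^ 2} := by
  have h : {q : ℝ × ℝ | 1 < q.1 ^ 2 + q.2 ^ 2} =
      (fun z : ℝ × ℝ => (z.1 * Real.cos z.2, z.1 * Real.sin z.2)) '' (Set.Ioi 1 ×ˢ Set.univ) := by
    ext ⟨a, c⟩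
    simp only [Set.mem_ofPred_eq, Set.mem_image, Set.mem_prod, Set.mem_Ioi, Set.mem_univ, and_true,
      Prod.mk.injEq, Prod.exists]
    constructor
    · intro h
      refine ⟨‖(⟨a, c⟩ : ℂ)‖, Complex.arg ⟨a, c⟩, ?_, Complex.norm_mul_cos_arg _,
        Complex.norm_mul_sin_arg _⟩
      rw [← one_lt_sq_iff₀ (norm_nonneg _), ← Complex.normSq_eq_norm_sq, Complex.normSq_apply]
      simpa [sq] using h
    · rintro ⟨r, θ, hr, rfl, rfl⟩
      have : (r * Real.cos θ) ^ 2 + (r * Real.sin θ) ^ 2 = r ^ 2 := by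
        have := Real.sin_sq_add_cos_sq θ
        linear_combination r ^ 2 * this
      rw [this]
      nlinarith
  rw [h]
  exact (isPreconnected_Ioi.prod isPreconnected_univ).image _ (by fun_prop)

/-- Expansion from the origin keeps a point in the domain and moves it out of the unit disc, whose
exterior is connected and lies in the domain. -/
lemma isConnected_domII : IsConnected domII := by
  have h2 : ((2, 0) : ℝ × ℝ) ∈ {q : ℝ × ℝ | 1 < q.1 ^ 2 + q.2 ^ 2} := by norm_num
  refine ⟨⟨(2, 0), discr_pos_of_one_lt h2⟩, isPreconnected_of_forall (2, 0) fun q hq => ?_⟩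
  refine ⟨{q | 1 < q.1 ^ 2 + q.2 ^ 2} ∪ (fun t : ℝ => t • q) '' Set.Ici 1, ?_, Or.inl h2,
    Or.inr ⟨1, by simp⟩, ?_⟩
  · rintro z (hz | ⟨t, ht, rfl⟩)
    · exact discr_pos_of_one_lt hz
    · rcases (Set.mem_Ici.1 ht).eq_or_lt with h | h
      · simpa [← h] using hq
      · exact discr_smul_pos (le_of_lt hq) h
  · have hpos : 0 < q.1 ^ 2 + q.2 ^ 2 := by
      rcases (by positivity : 0 ≤ q.1 ^ 2 + q.2 ^ 2).eq_or_lt with h | h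
      · have h3 : 0 < discr q := hq
        have h1 : q.1 ^ 2 = 0 := by nlinarith [sq_nonneg q.1, sq_nonneg q.2]
        have h2 : q.2 ^ 2 = 0 := by nlinarith [sq_nonneg q.1, sq_nonneg q.2]
        simp only [discr, h1, h2] at h3
        norm_num at h3
      · exact h
    obtain ⟨t, ht⟩ := exists_gt (max 1 (1 / (q.1 ^ 2 + q.2 ^ 2)))
    have ht1 : 1 < t := (le_max_left _ _).trans_lt ht
    have ht2 := (le_max_right _ _).trans_lt ht
    refine isPreconnected_exterior.union (t • q) ?_ ⟨t, ht1.le, rfl⟩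
      (isPreconnected_Ici.image _ (by fun_prop))
    rw [div_lt_iff₀ hpos] at ht2
    simp only [Set.mem_ofPred_eq, Prod.smul_fst, Prod.smul_snd, smul_eq_mul]
    nlinarith

lemma isBounded_domI : Bornology.IsBounded domI := by
  refine (Metric.isBounded_closedBall (x := (0 : ℝ × ℝ)) (r := 1)).subset fun q hq => ?_
  have h : q.1 ^ 2 + q.2 ^ 2 ≤ 1 := by
    by_contra! h
    exact absurd (discr_pos_of_one_lt h) (not_lt.2 (le_of_lt hq))
  rw [mem_closedBall_zero_iff, Prod.norm_def, max_le_iff, Real.norm_eq_abs, Real.norm_eq_abs]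
  exact ⟨abs_le_one_iff_mul_self_le_one.2 (by nlinarith [sq_nonneg q.2]),
    abs_le_one_iff_mul_self_le_one.2 (by nlinarith [sq_nonneg q.1])⟩

lemma tendsto_smul_self (q : ℝ × ℝ) (l : Filter ℝ) (hl : l ≤ 𝓝 1) :
    Tendsto (fun t : ℝ => t • q) l (𝓝 q) := by
  have : Tendsto (fun t : ℝ => t • q) (𝓝 1) (𝓝 ((1 : ℝ) • q)) :=
    (by fun_prop : Continuous fun t : ℝ => t • q).tendsto 1
  rw [one_smul] at this
  exact this.mono_left hl

lemma frontier_domI : frontier domI = {q | discr q = 0} := by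
  refine (frontier_lt_subset_eq continuous_discr continuous_const).antisymm fun q hq => ?_
  have hq : discr q = 0 := hq
  change q ∈ frontier domI
  rw [isOpen_domI.frontier_eq]
  refine ⟨mem_closure_of_tendsto (tendsto_smul_self q (𝓝[<] 1) nhdsWithin_le_nhds) ?_,
    fun h : discr q < 0 => by linarith⟩
  filter_upwards [Ioo_mem_nhdsLT (zero_lt_one' ℝ)] with t ht
  exact discr_smul_neg hq.le ht.1.le ht.2

lemma frontier_domII : frontier domII = {q | discr q = 0} := by
  refine ((frontier_lt_subset_eq continuous_const continuous_discr).trans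
    fun q (h : 0 = discr q) => h.symm).antisymm fun q hq => ?_
  have hq : discr q = 0 := hq
  change q ∈ frontier domII
  rw [isOpen_domII.frontier_eq]
  refine ⟨mem_closure_of_tendsto (tendsto_smul_self q (𝓝[>] 1) nhdsWithin_le_nhds) ?_,
    fun h : 0 < discr q => by linarith⟩
  filter_upwards [self_mem_nhdsWithin] with t ht
  exact discr_smul_pos hq.ge ht

lemma ray_subset_domII : ray ⊆ domII := by
  rintro ⟨a, c⟩ ⟨h0, h1⟩
  simp only at h0 h1
  subst h0
  have : 0 < a ^ 2 - 1 / 4 := by nlinarith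
  simpa [domII, discr] using pow_pos this 3

/-- The parametrization of the critical curve. -/
noncomputable def criticalPoint (φ : ℝ) : ℝ × ℝ :=
  (Real.cos φ ^ 3 - 3 / 2 * Real.cos φ, Real.sin φ ^ 3)

/-- For a fixed angle the two equations form a linear system for `q` with determinant `-2`. -/
lemma redV₁_redV₂_eq_zero_iff (q : ℝ × ℝ) (φ : ℝ) :
    redV₁ q φ = 0 ∧ redV₂ q φ = 0 ↔ q = criticalPoint φ := by
  obtain ⟨a, c⟩ := q
  have h := Real.sin_sq_add_cos_sq φ
  simp only [redV₁, redV₂, criticalPoint, Prod.mk.injEq]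
  rw [Real.sin_two_mul, Real.cos_two_mul]
  set S := Real.sin φ
  set K := Real.cos φ
  have hS : S ^ 2 = 1 - K ^ 2 := by linarith
  have hS3 : S ^ 3 = S * (1 - K ^ 2) := by rw [← hS]; ring
  rw [hS3]
  constructor
  · rintro ⟨h1, h2⟩
    constructor
    · linear_combination 2 * S * K * h1 + (2 * K ^ 2 - 1) / 2 * h2 +
        (-4 * a * K ^ 2 - 2 * K) * hS
    · linear_combination (2 * K ^ 2 - 1) * h1 - S * K * h2 - 4 * c * K ^ 2 * hS
  · rintro ⟨rfl, rfl⟩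
    constructor
    · ring
    · linear_combination (-4 * K * (1 - K ^ 2)) * hS

lemma discr_eq_zero_iff (q : ℝ × ℝ) : discr q = 0 ↔ q ∈ Set.range criticalPoint := by
  constructor
  · obtain ⟨a, c⟩ := q
    obtain ⟨s, rfl⟩ := exists_cube_eq c
    intro h
    rw [discr_cube_eq_zero] at h
    have h1 : a ^ 2 = (1 - s ^ 2) * (1 / 2 + s ^ 2) ^ 2 := by linear_combination h
    have hp : 0 < 1 / 2 + s ^ 2 := by positivity
    -- On the curve `a = -cos φ (1/2 + sin² φ)`, so `k` and `s` are to be the cosine and the sine of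
    -- the parameter.
    set k := -a / (1 / 2 + s ^ 2) with hk
    have hk2 : k ^ 2 + s ^ 2 = 1 := by
      rw [hk, div_pow, neg_sq, h1, mul_div_cancel_right₀ _ (by positivity)]
      ring
    have hn : ‖(⟨k, s⟩ : ℂ)‖ = 1 := by
      rw [← sq_eq_sq₀ (norm_nonneg _) zero_le_one, ← Complex.normSq_eq_norm_sq,
        Complex.normSq_apply]
      simpa [← sq] using hk2
    have h2 := Complex.norm_mul_cos_arg ⟨k, s⟩
    have h3 := Complex.norm_mul_sin_arg ⟨k, s⟩
    rw [hn, one_mul] at h2 h3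
    refine ⟨Complex.arg ⟨k, s⟩, ?_⟩
    simp only [criticalPoint, h2, h3, Prod.mk.injEq, and_true]
    have h4 : a = -k * (1 / 2 + s ^ 2) := by rw [hk]; field_simp
    rw [h4]
    linear_combination k * hk2
  · rintro ⟨φ, rfl⟩
    have h := Real.sin_sq_add_cos_sq φ
    rw [criticalPoint, discr_cube_eq_zero]
    set S := Real.sin φ
    set K := Real.cos φ
    have hK : K ^ 2 = 1 - S ^ 2 := by linarith
    have : (K ^ 3 - 3 / 2 * K) ^ 2 = K ^ 2 * (K ^ 2 - 3 / 2) ^ 2 := by ring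
    rw [this, hK]
    ring

lemma isDegenerate_iff_param (P : AveragedPendulum) (φ : ℝ) :
    P.IsDegenerate φ ↔ P.param = criticalPoint φ := by
  rw [isDegenerate_iff, redV₁_redV₂_eq_zero_iff]

lemma exists_param_eq (q : ℝ × ℝ) : ∃ P : AveragedPendulum, P.param = q :=
  ⟨⟨1, 1, 1, 0, q.1, q.2, one_pos, one_pos, one_pos⟩, by simp [param]⟩

lemma criticalCurve_eq_range : criticalCurve = Set.range criticalPoint := by
  ext q
  simp only [criticalCurve, isDegenerate_iff_param, Set.mem_ofPred_eq, Set.mem_range]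
  constructor
  · rintro ⟨P, rfl, φ, h⟩
    exact ⟨φ, h.symm⟩
  · rintro ⟨φ, rfl⟩
    obtain ⟨P, hP⟩ := exists_param_eq (criticalPoint φ)
    exact ⟨P, hP, φ, hP⟩

lemma criticalCurve_eq : criticalCurve = {q | discr q = 0} := by
  rw [criticalCurve_eq_range]; ext q; exact (discr_eq_zero_iff q).symm

lemma mem_criticalCurve_iff (P : AveragedPendulum) :
    P.param ∈ criticalCurve ↔ ∃ φ, P.IsDegenerate φ := by
  rw [criticalCurve_eq_range]
  simp only [isDegenerate_iff_param, Set.mem_range, eq_comm]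

/-- Off the critical curve all the equilibria are nondegenerate. -/
lemma redV₂_ne_zero {q : ℝ × ℝ} (hq : discr q ≠ 0) {φ : ℝ} (h : redV₁ q φ = 0) :
    redV₂ q φ ≠ 0 := fun h2 =>
  hq ((discr_eq_zero_iff q).2 ⟨φ, ((redV₁_redV₂_eq_zero_iff q φ).1 ⟨h, h2⟩).symm⟩)

/-! ### Factorization of the force -/

lemma cos_sub_cos_eq (φ x y : ℝ) : Real.cos ((x - y) / 2) - Real.cos (φ - (x + y) / 2) =
    2 * (Real.sin ((φ - x) / 2) * Real.sin ((φ - y) / 2)) := by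
  rw [Real.cos_sub_cos]
  have h1 : ((x - y) / 2 + (φ - (x + y) / 2)) / 2 = (φ - y) / 2 := by ring
  have h2 : ((x - y) / 2 - (φ - (x + y) / 2)) / 2 = -((φ - x) / 2) := by ring
  rw [h1, h2, Real.sin_neg]
  ring

/-- A trigonometric polynomial of degree one with two zeros is a product. -/
lemma harmonic_eq_of_zeros {u₀ u₁ u₂ x y : ℝ}
    (hx : u₀ + u₁ * Real.cos x + u₂ * Real.sin x = 0)
    (hy : u₀ + u₁ * Real.cos y + u₂ * Real.sin y = 0) (hxy : Real.sin ((x - y) / 2) ≠ 0) :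
    ∃ B : ℝ, (∀ ψ, u₀ + u₁ * Real.cos ψ + u₂ * Real.sin ψ =
        B * (Real.sin ((ψ - x) / 2) * Real.sin ((ψ - y) / 2))) ∧
      u₁ ^ 2 + u₂ ^ 2 - u₀ ^ 2 = (B * Real.sin ((x - y) / 2) / 2) ^ 2 := by
  set μ := (x + y) / 2 with hμ
  set e := (x - y) / 2 with he
  have hx' : x = μ + e := by rw [hμ, he]; ring
  have hy' : y = μ - e := by rw [hμ, he]; ring
  set b := u₁ * Real.cos μ + u₂ * Real.sin μ with hb
  have h1 : u₀ = -(b * Real.cos e) := by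
    rw [hx', Real.cos_add, Real.sin_add] at hx
    rw [hy', Real.cos_sub, Real.sin_sub] at hy
    rw [hb]; linear_combination (hx + hy) / 2
  have h2 : u₂ * Real.cos μ - u₁ * Real.sin μ = 0 := by
    have : Real.sin e * (u₂ * Real.cos μ - u₁ * Real.sin μ) = 0 := by
      rw [hx', Real.cos_add, Real.sin_add] at hx
      rw [hy', Real.cos_sub, Real.sin_sub] at hy
      linear_combination (hx - hy) / 2
    exact (mul_eq_zero.1 this).resolve_left hxy
  have hμ1 := Real.sin_sq_add_cos_sq μ
  have h3 : u₁ = b * Real.cos μ := by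
    rw [hb]; linear_combination (-Real.sin μ) * h2 - u₁ * hμ1
  have h4 : u₂ = b * Real.sin μ := by
    rw [hb]; linear_combination (Real.cos μ) * h2 - u₂ * hμ1
  refine ⟨-2 * b, fun ψ => ?_, ?_⟩
  · have h5 := cos_sub_cos_eq ψ x y
    rw [← hμ, ← he, Real.cos_sub ψ μ] at h5
    rw [h1, h3, h4]
    linear_combination (-b) * h5
  · have he1 := Real.sin_sq_add_cos_sq e
    rw [h1, h3, h4]
    linear_combination b ^ 2 * hμ1 - b ^ 2 * he1

/-- In amplitude and phase the equation is `R cos (ψ - θ) = -u₀` with `|u₀| < R`, solved by `ψ = θ ±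
e`. -/
lemma exists_zeros_of_harmonic {u₀ u₁ u₂ : ℝ} (h : 0 < u₁ ^ 2 + u₂ ^ 2 - u₀ ^ 2) :
    ∃ x y, u₀ + u₁ * Real.cos x + u₂ * Real.sin x = 0 ∧
      u₀ + u₁ * Real.cos y + u₂ * Real.sin y = 0 ∧ Real.sin ((x - y) / 2) ≠ 0 := by
  set R := ‖(⟨u₁, u₂⟩ : ℂ)‖ with hR
  set θ := Complex.arg ⟨u₁, u₂⟩ with hθ
  have h1 : R * Real.cos θ = u₁ := Complex.norm_mul_cos_arg _
  have h2 : R * Real.sin θ = u₂ := Complex.norm_mul_sin_arg _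
  have hR2 : R ^ 2 = u₁ ^ 2 + u₂ ^ 2 := by
    rw [hR, ← Complex.normSq_eq_norm_sq, Complex.normSq_apply]
    ring
  have hR0 : 0 < R := by
    refine (norm_nonneg _).lt_of_ne' fun h0 => ?_
    rw [← hR] at h0
    rw [h0] at hR2
    nlinarith [sq_nonneg u₀]
  have hlt : |u₀| < R := abs_lt_of_sq_lt_sq (by linarith) hR0.le
  obtain ⟨hl1, hl2⟩ := abs_lt.1 hlt
  set e := Real.arccos (-u₀ / R) with he
  have hb1 : -1 < -u₀ / R := by rw [lt_div_iff₀ hR0]; linarith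
  have hb2 : -u₀ / R < 1 := by rw [div_lt_one hR0]; linarith
  have hce : R * Real.cos e = -u₀ := by
    rw [he, Real.cos_arccos hb1.le hb2.le]; field_simp
  have hs : Real.sin e ≠ 0 := by
    refine (Real.sin_pos_of_pos_of_lt_pi (Real.arccos_pos.2 hb2) ?_).ne'
    exact (Real.arccos_le_pi _).lt_of_ne fun h => by
      have := Real.arccos_eq_pi.1 h; linarith
  have hθ1 := Real.sin_sq_add_cos_sq θ
  refine ⟨θ + e, θ - e, ?_, ?_, ?_⟩
  · rw [Real.cos_add, Real.sin_add, ← h1, ← h2]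
    linear_combination (R * Real.cos e) * hθ1 + hce
  · rw [Real.cos_sub, Real.sin_sub, ← h1, ← h2]
    linear_combination (R * Real.cos e) * hθ1 + hce
  · rwa [show (θ + e - (θ - e)) / 2 = e by ring]

/-- Two zeros of the force split off as a factor. -/
lemma redV₁_factor {q : ℝ × ℝ} {x y : ℝ} (hx : redV₁ q x = 0) (hy : redV₁ q y = 0)
    (hxy : Real.sin ((x - y) / 2) ≠ 0) :
    ∃ u₀ u₁ u₂ : ℝ,
      (∀ φ, redV₁ q φ = 2 * (Real.sin ((φ - x) / 2) * Real.sin ((φ - y) / 2)) *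
        (u₀ + u₁ * Real.cos (φ - (x + y) / 2) + u₂ * Real.sin (φ - (x + y) / 2))) ∧
      64 * discr q = Real.sin ((x - y) / 2) ^ 2 * (u₁ ^ 2 + u₂ ^ 2 - u₀ ^ 2) *
        ((u₀ + u₁ * Real.cos (x - (x + y) / 2) + u₂ * Real.sin (x - (x + y) / 2)) *
         (u₀ + u₁ * Real.cos (y - (x + y) / 2) + u₂ * Real.sin (y - (x + y) / 2))) ^ 2 := by
  obtain ⟨a, c⟩ := q
  have hxe : x - (x + y) / 2 = (x - y) / 2 := by ring
  have hye : y - (x + y) / 2 = -((x - y) / 2) := by ring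
  simp_rw [← cos_sub_cos_eq]
  rw [hxe, hye, Real.cos_neg, Real.sin_neg]
  set σ := (x + y) / 2 with hσ
  set d := (x - y) / 2 with hd
  have hx' : x = σ + d := by rw [hσ, hd]; ring
  have hy' : y = σ - d := by rw [hσ, hd]; ring
  set X := a * Real.sin (2 * σ) + c * Real.cos (2 * σ) with hX
  set Y := a * Real.cos (2 * σ) - c * Real.sin (2 * σ) with hY
  -- Measured from the midpoint `σ` the two zeros are `±d`, so the even and the odd part in `ψ`
  -- vanish at `d` separately.
  have key : ∀ ψ, redV₁ (a, c) (σ + ψ) = X * (2 * Real.cos ψ ^ 2 - 1) +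
      Y * (2 * Real.sin ψ * Real.cos ψ) + Real.sin σ * Real.cos ψ + Real.cos σ * Real.sin ψ := by
    intro ψ
    simp only [redV₁, hX, hY]
    rw [show 2 * (σ + ψ) = 2 * σ + 2 * ψ by ring, Real.sin_add, Real.cos_add, Real.sin_add,
      Real.sin_two_mul ψ, Real.cos_two_mul ψ]
    ring
  rw [hx', key] at hx
  rw [hy', sub_eq_add_neg, key, Real.cos_neg, Real.sin_neg] at hy
  have h1 : X * (2 * Real.cos d ^ 2 - 1) + Real.sin σ * Real.cos d = 0 := by
    linear_combination (hx + hy) / 2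
  have h2 : 2 * Y * Real.cos d + Real.cos σ = 0 := by
    have : Real.sin d * (2 * Y * Real.cos d + Real.cos σ) = 0 := by
      linear_combination (hx - hy) / 2
    exact (mul_eq_zero.1 this).resolve_left hxy
  obtain ⟨u₀, hu₀⟩ : ∃ u₀, u₀ = -2 * X * Real.cos d - Real.sin σ := ⟨_, rfl⟩
  have hX' : X = -(u₀ * Real.cos d) := by rw [hu₀]; linear_combination -h1
  have hsσ : Real.sin σ = u₀ * (2 * Real.cos d ^ 2 - 1) := by
    linear_combination hu₀ - 2 * Real.cos d * hX'
  have hcσ : Real.cos σ = -2 * Y * Real.cos d := by linear_combination h2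
  have hd1 : Real.sin d ^ 2 = 1 - Real.cos d ^ 2 := by
    have := Real.sin_sq_add_cos_sq d; linarith
  refine ⟨u₀, -2 * X, -2 * Y, fun φ => ?_, ?_⟩
  · have h3 := key (φ - σ)
    rw [add_sub_cancel] at h3
    rw [h3, hsσ, hcσ, hX']
    ring
  · have hn := Real.sin_sq_add_cos_sq σ
    have h2σ := Real.sin_sq_add_cos_sq (2 * σ)
    have hr : a ^ 2 + c ^ 2 = X ^ 2 + Y ^ 2 := by
      rw [hX, hY]; linear_combination -(a ^ 2 + c ^ 2) * h2σ
    have hc : c = X * (Real.cos σ ^ 2 - Real.sin σ ^ 2) - Y * (2 * Real.sin σ * Real.cos σ) := by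
      have h4 : c = X * Real.cos (2 * σ) - Y * Real.sin (2 * σ) := by
        rw [hX, hY]; linear_combination -c * h2σ
      rw [Real.sin_two_mul, Real.cos_two_mul'] at h4
      exact h4
    -- Written this way the constant is quadratic in `sin σ`, `cos σ`. Both sides are then
    -- homogeneous of degree six in `u₀` and `Y`, and the claim is a polynomial identity.
    have hq : (1 : ℝ) / 4 = (Real.sin σ ^ 2 + Real.cos σ ^ 2) / 4 := by rw [hn]
    simp only [discr]
    have hE : ∀ u v S : ℝ, ((u + v * S) * (u + v * -S)) ^ 2 = (u ^ 2 - v ^ 2 * S ^ 2) ^ 2 := by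
      intros; ring
    rw [hr, hq, hc, hsσ, hcσ, hX', hE, hd1]
    ring

lemma not_forall_redV₁_eq_zero (q : ℝ × ℝ) : ¬ ∀ φ, redV₁ q φ = 0 := fun h => by
  have h1 := h (Real.pi / 2)
  have h2 := h (-(Real.pi / 2))
  have e1 : 2 * (Real.pi / 2) = Real.pi := by ring
  have e2 : 2 * -(Real.pi / 2) = -Real.pi := by ring
  simp only [redV₁, e1, e2, Real.sin_neg, Real.cos_neg, Real.sin_pi, Real.cos_pi,
    Real.sin_pi_div_two] at h1 h2
  linarith

/-- If the force has four zeros (modulo `2π`), then it is their product, and the discriminant is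
positive. -/
lemma discr_pos_of_zeros {q : ℝ × ℝ} {x y z w : ℝ} (hx : redV₁ q x = 0) (hy : redV₁ q y = 0)
    (hz : redV₁ q z = 0) (hw : redV₁ q w = 0) (hxy : Real.sin ((x - y) / 2) ≠ 0)
    (hzx : Real.sin ((z - x) / 2) ≠ 0) (hzy : Real.sin ((z - y) / 2) ≠ 0)
    (hwx : Real.sin ((w - x) / 2) ≠ 0) (hwy : Real.sin ((w - y) / 2) ≠ 0)
    (hzw : Real.sin ((z - w) / 2) ≠ 0) : 0 < discr q := by
  obtain ⟨u₀, u₁, u₂, h, hd⟩ := redV₁_factor hx hy hxy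
  rw [h] at hz hw
  obtain ⟨B, hB, hB2⟩ := harmonic_eq_of_zeros
    ((mul_eq_zero.1 hz).resolve_left (mul_ne_zero two_ne_zero (mul_ne_zero hzx hzy)))
    ((mul_eq_zero.1 hw).resolve_left (mul_ne_zero two_ne_zero (mul_ne_zero hwx hwy)))
    (by rwa [show (z - (x + y) / 2 - (w - (x + y) / 2)) / 2 = (z - w) / 2 by ring])
  have hB0 : B ≠ 0 := by
    rintro rfl
    refine not_forall_redV₁_eq_zero q fun φ => ?_
    rw [h, hB]; ring
  have hne : ∀ a b : ℝ, Real.sin ((b - a) / 2) ≠ 0 →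
      Real.sin ((a - (x + y) / 2 - (b - (x + y) / 2)) / 2) ≠ 0 := fun a b hab => by
    rw [show (a - (x + y) / 2 - (b - (x + y) / 2)) / 2 = -((b - a) / 2) by ring, Real.sin_neg]
    exact neg_ne_zero.2 hab
  have h64 : 0 < 64 * discr q := by
    rw [hd, hB2, hB, hB]
    have hzw' := hne w z hzw
    rw [show (w - (x + y) / 2 - (z - (x + y) / 2)) / 2 =
      -((z - (x + y) / 2 - (w - (x + y) / 2)) / 2) by ring, Real.sin_neg, neg_ne_zero] at hzw'
    exact mul_pos (mul_pos (by positivity) (by positivity)) (sq_pos_of_ne_zero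
      (mul_ne_zero (mul_ne_zero hB0 (mul_ne_zero (hne _ _ hzx) (hne _ _ hwx)))
        (mul_ne_zero hB0 (mul_ne_zero (hne _ _ hzy) (hne _ _ hwy)))))
  linarith


lemma redV_add_int (q : ℝ × ℝ) (φ : ℝ) (k : ℤ) : redV q (φ + 2 * Real.pi * k) = redV q φ := by
  have := (show Function.Periodic (redV q) (2 * Real.pi) from redV_add_two_pi q).int_mul k φ
  rwa [mul_comm] at this

lemma redV₁_add_int (q : ℝ × ℝ) (φ : ℝ) (k : ℤ) : redV₁ q (φ + 2 * Real.pi * k) = redV₁ q φ := by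
  have := (show Function.Periodic (redV₁ q) (2 * Real.pi) from redV₁_add_two_pi q).int_mul k φ
  rwa [mul_comm] at this

lemma redV₂_add_int (q : ℝ × ℝ) (φ : ℝ) (k : ℤ) : redV₂ q (φ + 2 * Real.pi * k) = redV₂ q φ := by
  have := (show Function.Periodic (redV₂ q) (2 * Real.pi) from redV₂_add_two_pi q).int_mul k φ
  rwa [mul_comm] at this

lemma sin_half_sub_eq_zero_iff {x y : ℝ} :
    Real.sin ((x - y) / 2) = 0 ↔ ∃ k : ℤ, x = y + 2 * Real.pi * k := by
  rw [Real.sin_eq_zero_iff]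
  refine exists_congr fun k => ⟨fun h => ?_, fun h => ?_⟩
  · linear_combination -2 * h
  · rw [h]; ring

lemma sin_half_sub_pos {x φ : ℝ} (h1 : x < φ) (h2 : φ < x + 2 * Real.pi) :
    0 < Real.sin ((φ - x) / 2) :=
  Real.sin_pos_of_pos_of_lt_pi (by linarith) (by linarith)

lemma sin_half_sub_neg {x φ : ℝ} (h1 : φ < x) (h2 : x < φ + 2 * Real.pi) :
    Real.sin ((φ - x) / 2) < 0 :=
  Real.sin_neg_of_neg_of_neg_pi_lt (by linarith) (by linarith)

lemma sin_half_sub_ne_zero {x y : ℝ} (h1 : x < y) (h2 : y < x + 2 * Real.pi) :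
    Real.sin ((x - y) / 2) ≠ 0 := (sin_half_sub_neg h1 h2).ne

lemma exists_redV_max (q : ℝ × ℝ) : ∃ x, ∀ φ, redV q φ ≤ redV q x := by
  obtain ⟨x, -, hx⟩ := (isCompact_Icc (a := (0 : ℝ)) (b := 2 * Real.pi)).exists_isMaxOn
    ⟨0, by simp [Real.pi_pos.le]⟩ (continuous_redV q).continuousOn
  refine ⟨x, fun φ => ?_⟩
  obtain ⟨y, hy, hφ⟩ := (show Function.Periodic (redV q) (2 * Real.pi) from
    redV_add_two_pi q).exists_mem_Ico₀ Real.two_pi_pos φ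
  rw [hφ]
  exact hx ⟨hy.1, hy.2.le⟩

lemma exists_redV_min (q : ℝ × ℝ) : ∃ x, ∀ φ, redV q x ≤ redV q φ := by
  obtain ⟨x, -, hx⟩ := (isCompact_Icc (a := (0 : ℝ)) (b := 2 * Real.pi)).exists_isMinOn
    ⟨0, by simp [Real.pi_pos.le]⟩ (continuous_redV q).continuousOn
  refine ⟨x, fun φ => ?_⟩
  obtain ⟨y, hy, hφ⟩ := (show Function.Periodic (redV q) (2 * Real.pi) from
    redV_add_two_pi q).exists_mem_Ico₀ Real.two_pi_pos φ
  rw [hφ]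
  exact hx ⟨hy.1, hy.2.le⟩

lemma redV₁_eq_zero_of_isLocalMin {q : ℝ × ℝ} {x : ℝ} (h : IsLocalMin (redV q) x) :
    redV₁ q x = 0 := h.hasDerivAt_eq_zero (hasDerivAt_redV q x)

lemma redV₁_eq_zero_of_isLocalMax {q : ℝ × ℝ} {x : ℝ} (h : IsLocalMax (redV q) x) :
    redV₁ q x = 0 := h.hasDerivAt_eq_zero (hasDerivAt_redV q x)

lemma redV_strictAntiOn {q : ℝ × ℝ} {x y : ℝ} (h : ∀ φ, x < φ → φ < y → redV₁ q φ < 0) :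
    StrictAntiOn (redV q) (Set.Icc x y) :=
  strictAntiOn_of_deriv_neg (convex_Icc x y) (continuous_redV q).continuousOn fun φ hφ => by
    rw [interior_Icc] at hφ
    rw [(hasDerivAt_redV q φ).deriv]
    exact h φ hφ.1 hφ.2

lemma redV_strictMonoOn {q : ℝ × ℝ} {x y : ℝ} (h : ∀ φ, x < φ → φ < y → 0 < redV₁ q φ) :
    StrictMonoOn (redV q) (Set.Icc x y) :=
  strictMonoOn_of_deriv_pos (convex_Icc x y) (continuous_redV q).continuousOn fun φ hφ => by
    rw [interior_Icc] at hφ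
    rw [(hasDerivAt_redV q φ).deriv]
    exact h φ hφ.1 hφ.2

/-- A global maximum and a global minimum of the potential are distinct modulo `2π`. -/
lemma sin_half_sub_ne_zero_of_max_min {q : ℝ × ℝ} {x y : ℝ} (hx : ∀ φ, redV q φ ≤ redV q x)
    (hy : ∀ φ, redV q y ≤ redV q φ) : Real.sin ((x - y) / 2) ≠ 0 := by
  intro h
  obtain ⟨k, rfl⟩ := sin_half_sub_eq_zero_iff.1 h
  simp only [redV_add_int] at hx
  refine not_forall_redV₁_eq_zero q fun φ => redV₁_eq_zero_of_isLocalMax ?_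
  exact Eventually.of_forall fun z => (hx z).trans (hy φ)

/-- Representation of the factor `sin ((φ - y) / 2)` with a point `y` from a given period. -/
lemma exists_representative {x y : ℝ} (h : Real.sin ((y - x) / 2) ≠ 0) :
    ∃ z, x < z ∧ z < x + 2 * Real.pi ∧ Real.sin ((y - z) / 2) = 0 ∧
      ∃ ε : ℝ, ε ≠ 0 ∧ ∀ φ, Real.sin ((φ - y) / 2) = ε * Real.sin ((φ - z) / 2) := by
  obtain ⟨k, hk, -⟩ := existsUnique_add_zsmul_mem_Ico Real.two_pi_pos y x
  rw [zsmul_eq_mul] at hk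
  have hy : y = y + k * (2 * Real.pi) + 2 * Real.pi * (-k : ℤ) := by push_cast; ring
  have h0 : Real.sin ((y - (y + k * (2 * Real.pi))) / 2) = 0 :=
    sin_half_sub_eq_zero_iff.2 ⟨_, hy⟩
  refine ⟨y + k * (2 * Real.pi), hk.1.lt_of_ne ?_, hk.2, h0, Real.cos (k * Real.pi), ?_, ?_⟩
  · intro h1
    rw [← h1] at h0
    exact h h0
  · intro h1
    have h2 := Real.sin_sq_add_cos_sq (k * Real.pi)
    rw [Real.sin_int_mul_pi, h1] at h2
    norm_num at h2
  · intro φ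
    rw [show (φ - y) / 2 = (φ - (y + k * (2 * Real.pi))) / 2 + k * Real.pi by ring, Real.sin_add,
      Real.sin_int_mul_pi]
    ring

lemma sin_half_trans {x y z : ℝ} (h1 : Real.sin ((x - z) / 2) = 0)
    (h2 : Real.sin ((y - z) / 2) = 0) : Real.sin ((x - y) / 2) = 0 := by
  rw [show (x - y) / 2 = (x - z) / 2 - (y - z) / 2 by ring, Real.sin_sub, h1, h2]; ring

lemma sin_half_symm {x y : ℝ} (h : Real.sin ((x - y) / 2) ≠ 0) : Real.sin ((y - x) / 2) ≠ 0 := by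
  rw [show (y - x) / 2 = -((x - y) / 2) by ring, Real.sin_neg]; exact neg_ne_zero.2 h

/-- In the domain `I` the force has two zeros on a period. -/
lemma exists_two_zeros {q : ℝ × ℝ} (hq : q ∈ domI) : ∃ x y, x < y ∧ y < x + 2 * Real.pi ∧
    (∀ φ, x < φ → φ < y → redV₁ q φ < 0) ∧
    (∀ φ, y < φ → φ < x + 2 * Real.pi → 0 < redV₁ q φ) := by
  have hq : discr q < 0 := hq
  obtain ⟨x, hx⟩ := exists_redV_max q
  obtain ⟨y, hy⟩ := exists_redV_min q
  have hxy := sin_half_sub_ne_zero_of_max_min hx hy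
  obtain ⟨u₀, u₁, u₂, h, hd⟩ := redV₁_factor (redV₁_eq_zero_of_isLocalMax (.of_forall hx))
    (redV₁_eq_zero_of_isLocalMin (.of_forall hy)) hxy
  -- The quotient has the discriminant of the sign of `discr q`, here negative; so it never vanishes
  -- and keeps the sign of `u₀`.
  have hD : u₁ ^ 2 + u₂ ^ 2 < u₀ ^ 2 := by
    by_contra! hD
    have : 0 ≤ 64 * discr q := by
      rw [hd]
      exact mul_nonneg (mul_nonneg (sq_nonneg _) (by linarith)) (sq_nonneg _)
    linarith
  have hu : ∀ ψ, 0 < u₀ * (u₀ + u₁ * Real.cos ψ + u₂ * Real.sin ψ) := fun ψ => by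
    set b := u₁ * Real.cos ψ + u₂ * Real.sin ψ with hb
    have h1 : b ^ 2 ≤ u₁ ^ 2 + u₂ ^ 2 := by
      have := Real.sin_sq_add_cos_sq ψ
      have : u₁ ^ 2 + u₂ ^ 2 - b ^ 2 = (u₁ * Real.sin ψ - u₂ * Real.cos ψ) ^ 2 := by
        rw [hb]; linear_combination (-(u₁ ^ 2 + u₂ ^ 2)) * this
      nlinarith [sq_nonneg (u₁ * Real.sin ψ - u₂ * Real.cos ψ)]
    have h2 : |b| < |u₀| := sq_lt_sq.1 (h1.trans_lt hD)
    have h3 : |u₀ * b| < u₀ * u₀ := by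
      rw [abs_mul, ← abs_mul_abs_self u₀]
      exact mul_lt_mul_of_pos_left h2 ((abs_nonneg b).trans_lt h2)
    have := neg_abs_le (u₀ * b)
    rw [show u₀ * (u₀ + u₁ * Real.cos ψ + u₂ * Real.sin ψ) = u₀ * u₀ + u₀ * b by rw [hb]; ring]
    linarith
  obtain ⟨z, hz1, hz2, -, ε, hε, hzε⟩ := exists_representative (sin_half_symm hxy)
  have hw : ∀ φ, ∃ r, 0 < r ∧ redV₁ q φ =
      (ε / u₀) * (r * (Real.sin ((φ - x) / 2) * Real.sin ((φ - z) / 2))) := fun φ => by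
    refine ⟨_, mul_pos two_pos (hu (φ - (x + y) / 2)), ?_⟩
    have hu0 : u₀ ≠ 0 := fun h0 => by
      have := hu 0; simp [h0] at this
    rw [h, hzε]
    field_simp
  -- The opposite sign would make the potential increase to the right of its maximum `x`, and zero
  -- would make it constant.
  have hneg : 0 < ε / u₀ := by
    rcases lt_trichotomy (ε / u₀) 0 with h0 | h0 | h0
    · have hmono : StrictMonoOn (redV q) (Set.Icc x z) := redV_strictMonoOn fun φ h1 h2 => by
        obtain ⟨r, hr, hr'⟩ := hw φ
        rw [hr']
        exact mul_pos_of_neg_of_neg h0 (mul_neg_of_pos_of_neg hr (mul_neg_of_pos_of_neg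
          (sin_half_sub_pos h1 (by linarith)) (sin_half_sub_neg h2 (by linarith))))
      exact absurd (hmono ⟨le_rfl, hz1.le⟩ ⟨hz1.le, le_rfl⟩ hz1) (not_lt.2 (hx z))
    · refine absurd (fun φ => ?_) (not_forall_redV₁_eq_zero q)
      obtain ⟨r, -, hr'⟩ := hw φ
      rw [hr', h0, zero_mul]
    · exact h0
  refine ⟨x, z, hz1, hz2, fun φ h1 h2 => ?_, fun φ h1 h2 => ?_⟩
  · obtain ⟨r, hr, hr'⟩ := hw φ
    rw [hr']
    exact mul_neg_of_pos_of_neg hneg (mul_neg_of_pos_of_neg hr (mul_neg_of_pos_of_neg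
      (sin_half_sub_pos h1 (by linarith)) (sin_half_sub_neg h2 (by linarith))))
  · obtain ⟨r, hr, hr'⟩ := hw φ
    rw [hr']
    exact mul_pos hneg (mul_pos hr (mul_pos
      (sin_half_sub_pos (by linarith) h2) (sin_half_sub_pos h1 (by linarith))))

/-- The two adjacent transpositions generate all permutations, so a property invariant under them
permits relabelling in increasing order. -/
lemma exists_ordered {a b : ℝ} {f : ℝ → ℝ → ℝ → Prop} {x y z : ℝ} (hx : x ∈ Set.Ioo a b)
    (hy : y ∈ Set.Ioo a b) (hz : z ∈ Set.Ioo a b) (hxy : x ≠ y) (hxz : x ≠ z) (hyz : y ≠ z)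
    (h : f x y z) (h1 : ∀ x y z, f x y z → f y x z) (h2 : ∀ x y z, f x y z → f x z y) :
    ∃ x y z, a < x ∧ x < y ∧ y < z ∧ z < b ∧ f x y z := by
  rcases hxy.lt_or_gt with hxy | hxy <;> rcases hxz.lt_or_gt with hxz | hxz <;>
    rcases hyz.lt_or_gt with hyz | hyz
  · exact ⟨x, y, z, hx.1, hxy, hyz, hz.2, h⟩
  · exact ⟨x, z, y, hx.1, hxz, hyz, hy.2, h2 _ _ _ h⟩
  · linarith
  · exact ⟨z, x, y, hz.1, hxz, hxy, hy.2, h1 _ _ _ (h2 _ _ _ h)⟩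
  · exact ⟨y, x, z, hy.1, hxy, hxz, hz.2, h1 _ _ _ h⟩
  · linarith
  · exact ⟨y, z, x, hy.1, hyz, hxz, hx.2, h2 _ _ _ (h1 _ _ _ h)⟩
  · exact ⟨z, y, x, hz.1, hyz, hxy, hx.2, h1 _ _ _ (h2 _ _ _ (h1 _ _ _ h))⟩

/-- In the domain `II` the force has four zeros on a period. -/
lemma exists_four_zeros {q : ℝ × ℝ} (hq : q ∈ domII) : ∃ x y z w,
    x < y ∧ y < z ∧ z < w ∧ w < x + 2 * Real.pi ∧
    (∀ φ, x < φ → φ < y → redV₁ q φ < 0) ∧ (∀ φ, y < φ → φ < z → 0 < redV₁ q φ) ∧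
    (∀ φ, z < φ → φ < w → redV₁ q φ < 0) ∧
    (∀ φ, w < φ → φ < x + 2 * Real.pi → 0 < redV₁ q φ) ∧ ∀ φ, redV q φ ≤ redV q x := by
  have hq : 0 < discr q := hq
  obtain ⟨x, hx⟩ := exists_redV_max q
  obtain ⟨y, hy⟩ := exists_redV_min q
  have hxy := sin_half_sub_ne_zero_of_max_min hx hy
  obtain ⟨u₀, u₁, u₂, h, hd⟩ := redV₁_factor (redV₁_eq_zero_of_isLocalMax (.of_forall hx))
    (redV₁_eq_zero_of_isLocalMin (.of_forall hy)) hxy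
  have hD : 0 < u₁ ^ 2 + u₂ ^ 2 - u₀ ^ 2 := by
    by_contra! hD
    have : 64 * discr q ≤ 0 := by
      rw [hd]
      exact mul_nonpos_of_nonpos_of_nonneg (mul_nonpos_of_nonneg_of_nonpos (sq_nonneg _) hD)
        (sq_nonneg _)
    linarith
  obtain ⟨z, w, hz, hw, hzw⟩ := exists_zeros_of_harmonic hD
  obtain ⟨B, hB, -⟩ := harmonic_eq_of_zeros hz hw hzw
  simp_rw [hB] at h hd
  -- The zeros of the quotient are new: if one of them agreed with `x` or `y` modulo `2π`, or if `B`
  -- were zero, the expression `hd` for the discriminant would vanish.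
  have hne : B ≠ 0 ∧ Real.sin ((x - (x + y) / 2 - z) / 2) ≠ 0 ∧
      Real.sin ((x - (x + y) / 2 - w) / 2) ≠ 0 ∧ Real.sin ((y - (x + y) / 2 - z) / 2) ≠ 0 ∧
      Real.sin ((y - (x + y) / 2 - w) / 2) ≠ 0 := by
    refine ⟨?_, ?_, ?_, ?_, ?_⟩ <;> intro h0 <;> rw [h0] at hd <;> simp at hd <;>
      exact hq.ne' hd
  obtain ⟨hB0, h1, h2, h3, h4⟩ := hne
  set z' := z + (x + y) / 2 with hz'
  set w' := w + (x + y) / 2 with hw'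
  have e : ∀ t u : ℝ, t - (x + y) / 2 - u = t - (u + (x + y) / 2) := by intros; ring
  simp only [e, ← hz', ← hw'] at h h1 h2 h3 h4
  have hzw' : Real.sin ((z' - w') / 2) ≠ 0 := by
    rwa [show z' - w' = z - w by rw [hz', hw']; ring]
  obtain ⟨Y, hY1, hY2, hY3, ε₁, hε₁, hYε⟩ := exists_representative (sin_half_symm hxy)
  obtain ⟨Z, hZ1, hZ2, hZ3, ε₂, hε₂, hZε⟩ := exists_representative (sin_half_symm h1)
  obtain ⟨W, hW1, hW2, hW3, ε₃, hε₃, hWε⟩ := exists_representative (sin_half_symm h2)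
  have hYZ : Y ≠ Z := by rintro rfl; exact h3 (sin_half_trans hY3 hZ3)
  have hYW : Y ≠ W := by rintro rfl; exact h4 (sin_half_trans hY3 hW3)
  have hZW : Z ≠ W := by rintro rfl; exact hzw' (sin_half_trans hZ3 hW3)
  obtain ⟨X₂, X₃, X₄, l1, l2, l3, l4, hf⟩ := exists_ordered (a := x) (b := x + 2 * Real.pi)
    (f := fun X Y Z => ∃ κ : ℝ, ∀ φ, redV₁ q φ = κ * (Real.sin ((φ - x) / 2) *
      (Real.sin ((φ - X) / 2) * (Real.sin ((φ - Y) / 2) * Real.sin ((φ - Z) / 2)))))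
    ⟨hY1, hY2⟩ ⟨hZ1, hZ2⟩ ⟨hW1, hW2⟩ hYZ hYW hZW
    ⟨2 * ε₁ * B * ε₂ * ε₃, fun φ => by rw [h, hYε, hZε, hWε]; ring⟩
    (fun X Y Z ⟨κ, hκ⟩ => ⟨κ, fun φ => by rw [hκ]; ring⟩)
    (fun X Y Z ⟨κ, hκ⟩ => ⟨κ, fun φ => by rw [hκ]; ring⟩)
  obtain ⟨κ, hκ⟩ := hf
  have hpi := Real.pi_pos
  have s1 : ∀ φ, x < φ → φ < X₂ → Real.sin ((φ - x) / 2) *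
      (Real.sin ((φ - X₂) / 2) * (Real.sin ((φ - X₃) / 2) * Real.sin ((φ - X₄) / 2))) < 0 :=
    fun φ g1 g2 => mul_neg_of_pos_of_neg (sin_half_sub_pos g1 (by linarith))
      (mul_neg_of_neg_of_pos (sin_half_sub_neg g2 (by linarith)) (mul_pos_of_neg_of_neg
        (sin_half_sub_neg (by linarith) (by linarith))
        (sin_half_sub_neg (by linarith) (by linarith))))
  have hpos : 0 < κ := by
    rcases lt_trichotomy κ 0 with h0 | h0 | h0
    · have hmono : StrictMonoOn (redV q) (Set.Icc x X₂) := redV_strictMonoOn fun φ h1 h2 => by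
        rw [hκ]
        exact mul_pos_of_neg_of_neg h0 (s1 φ h1 h2)
      exact absurd (hmono ⟨le_rfl, l1.le⟩ ⟨l1.le, le_rfl⟩ l1) (not_lt.2 (hx X₂))
    · exact absurd (fun φ => by rw [hκ, h0, zero_mul]) (not_forall_redV₁_eq_zero q)
    · exact h0
  refine ⟨x, X₂, X₃, X₄, l1, l2, l3, l4, fun φ g1 g2 => ?_, fun φ g1 g2 => ?_, fun φ g1 g2 => ?_,
    fun φ g1 g2 => ?_, hx⟩ <;> rw [hκ]
  · exact mul_neg_of_pos_of_neg hpos (s1 φ g1 g2)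
  · exact mul_pos hpos (mul_pos (sin_half_sub_pos (by linarith) (by linarith))
      (mul_pos (sin_half_sub_pos g1 (by linarith)) (mul_pos_of_neg_of_neg
        (sin_half_sub_neg (by linarith) (by linarith))
        (sin_half_sub_neg (by linarith) (by linarith)))))
  · exact mul_neg_of_pos_of_neg hpos (mul_neg_of_pos_of_neg
      (sin_half_sub_pos (by linarith) (by linarith))
      (mul_neg_of_pos_of_neg (sin_half_sub_pos (by linarith) (by linarith)) (mul_neg_of_pos_of_neg
        (sin_half_sub_pos (by linarith) (by linarith))
        (sin_half_sub_neg (by linarith) (by linarith)))))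
  · exact mul_pos hpos (mul_pos (sin_half_sub_pos (by linarith) (by linarith))
      (mul_pos (sin_half_sub_pos (by linarith) (by linarith)) (mul_pos
        (sin_half_sub_pos (by linarith) (by linarith))
        (sin_half_sub_pos (by linarith) (by linarith)))))

/-- The sequence of the saddles `S i` and of the centres `m i` between them, `n` of each on a
period. -/
structure WellSeq (q : ℝ × ℝ) (n : ℤ) where
  S : ℤ → ℝ
  m : ℤ → ℝ
  n_pos : 0 < n
  S_lt : ∀ i, S i < m i
  lt_S : ∀ i, m i < S (i + 1)
  S_add : ∀ i, S (i + n) = S i + 2 * Real.pi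
  m_add : ∀ i, m (i + n) = m i + 2 * Real.pi
  neg : ∀ i φ, S i < φ → φ < m i → redV₁ q φ < 0
  pos : ∀ i φ, m i < φ → φ < S (i + 1) → 0 < redV₁ q φ

lemma exists_wellSeq_one {q : ℝ × ℝ} (hq : q ∈ domI) : Nonempty (WellSeq q 1) := by
  obtain ⟨x, y, h1, h2, h3, h4⟩ := exists_two_zeros hq
  have e : ∀ φ (i : ℤ), redV₁ q φ = redV₁ q (φ - 2 * Real.pi * i) := fun φ i => by
    conv_lhs => rw [← sub_add_cancel φ (2 * Real.pi * i), redV₁_add_int]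
  refine ⟨⟨fun i => x + 2 * Real.pi * i, fun i => y + 2 * Real.pi * i, one_pos, fun i => ?_,
    fun i => ?_, fun i => ?_, fun i => ?_, fun i φ g1 g2 => ?_, fun i φ g1 g2 => ?_⟩⟩
  · linarith
  · push_cast; linarith
  · push_cast; ring
  · push_cast; ring
  · rw [e φ i]; exact h3 _ (by linarith) (by linarith)
  · push_cast at g2
    rw [e φ i]; exact h4 _ (by linarith) (by linarith)

lemma exists_wellSeq_two {q : ℝ × ℝ} (hq : q ∈ domII) :
    ∃ w : WellSeq q 2, ∀ φ, redV q φ ≤ redV q (w.S 0) := by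
  obtain ⟨x₁, x₂, x₃, x₄, l1, l2, l3, l4, h1, h2, h3, h4, hmax⟩ := exists_four_zeros hq
  have e : ∀ φ (i : ℤ), redV₁ q φ = redV₁ q (φ - 2 * Real.pi * i) := fun φ i => by
    conv_lhs => rw [← sub_add_cancel φ (2 * Real.pi * i), redV₁_add_int]
  have ev : ∀ i : ℤ, Even (i + i) := fun i => ⟨i, rfl⟩
  have od : ∀ i : ℤ, ¬ Even (2 * i + 1) := fun i => by simp [parity_simps]
  have ev2 : ∀ i : ℤ, Even (2 * i + 1 + 1) := fun i => ⟨i + 1, by ring⟩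
  have ev3 : ∀ i : ℤ, Even (i + i + 2) := fun i => ⟨i + 1, by ring⟩
  have od3 : ∀ i : ℤ, ¬ Even (2 * i + 1 + 2) := fun i => by simp [parity_simps]
  have od4 : ∀ i : ℤ, ¬ Even (i + i + 1) := fun i =>
    Int.not_even_iff_odd.2 ⟨i, by ring⟩
  -- Both `i = 2j` and `i = 2j + 1` are to be shifted by `2πj`; this is `π i` for even and `π (i -
  -- 1)` for odd `i`. The global maximum gets the index `0`.
  refine ⟨⟨fun i => if Even i then x₁ + Real.pi * i else x₃ + Real.pi * (i - 1),
    fun i => if Even i then x₂ + Real.pi * i else x₄ + Real.pi * (i - 1), two_pos, fun i => ?_,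
    fun i => ?_, fun i => ?_, fun i => ?_, fun i φ g1 g2 => ?_, fun i φ g1 g2 => ?_⟩, ?_⟩
  · split_ifs <;> linarith
  · obtain ⟨j, rfl⟩ | ⟨j, rfl⟩ := Int.even_or_odd i
    · rw [if_pos (ev j), if_neg (od4 j)]; push_cast; linarith
    · rw [if_neg (od j), if_pos (ev2 j)]; push_cast; linarith
  · obtain ⟨j, rfl⟩ | ⟨j, rfl⟩ := Int.even_or_odd i
    · rw [if_pos (ev j), if_pos (ev3 j)]; push_cast; ring
    · rw [if_neg (od j), if_neg (od3 j)]; push_cast; ring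
  · obtain ⟨j, rfl⟩ | ⟨j, rfl⟩ := Int.even_or_odd i
    · rw [if_pos (ev j), if_pos (ev3 j)]; push_cast; ring
    · rw [if_neg (od j), if_neg (od3 j)]; push_cast; ring
  · obtain ⟨j, rfl⟩ | ⟨j, rfl⟩ := Int.even_or_odd i
    · simp only [if_pos (ev j)] at g1 g2
      push_cast at g1 g2
      rw [e φ j]; exact h1 _ (by linarith) (by linarith)
    · simp only [if_neg (od j)] at g1 g2
      push_cast at g1 g2
      rw [e φ j]; exact h3 _ (by linarith) (by linarith)
  · obtain ⟨j, rfl⟩ | ⟨j, rfl⟩ := Int.even_or_odd i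
    · simp only [if_pos (ev j), if_neg (od4 j)] at g1 g2
      push_cast at g1 g2
      rw [e φ j]; exact h2 _ (by linarith) (by linarith)
    · simp only [if_neg (od j), if_pos (ev2 j)] at g1 g2
      push_cast at g1 g2
      rw [e φ j]; exact h4 _ (by linarith) (by linarith)
  · simpa using hmax


/-! ### Sequences which are periodic modulo a translation -/

lemma add_mul_of_add {f : ℤ → ℝ} {n : ℤ} {T : ℝ} (h : ∀ i, f (i + n) = f i + T) (i k : ℤ) :
    f (i + n * k) = f i + T * k := by
  induction k with
  | zero => simp
  | succ k ih =>
    rw [mul_add, mul_one, ← add_assoc, h, ih]; push_cast; ring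
  | pred k ih =>
    have := h (i + n * (-(k : ℤ) - 1))
    rw [show i + n * (-(k : ℤ) - 1) + n = i + n * (-(k : ℤ)) by ring, ih] at this
    push_cast at this ⊢
    linarith

lemma exists_floor {f : ℤ → ℝ} (hf : StrictMono f) {n : ℤ} {T : ℝ} (hT : 0 < T)
    (h : ∀ i, f (i + n) = f i + T) (x : ℝ) : ∃ i, f i ≤ x ∧ x < f (i + 1) := by
  obtain ⟨k, hk⟩ := exists_int_gt ((x - f 0) / T)
  obtain ⟨k', hk'⟩ := exists_int_lt ((x - f 0) / T)
  rw [div_lt_iff₀ hT] at hk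
  rw [lt_div_iff₀ hT] at hk'
  have h1 := add_mul_of_add h 0 k
  have h2 := add_mul_of_add h 0 k'
  obtain ⟨i, hi, hmax⟩ := Int.exists_greatest_of_bdd (P := fun i => f i ≤ x)
    ⟨0 + n * k, fun z hz => by
      by_contra! hlt
      have := hf hlt
      nlinarith⟩ ⟨0 + n * k', by rw [h2]; linarith⟩
  refine ⟨i, hi, ?_⟩
  by_contra! hlt
  have := hmax _ hlt
  omega

/-- The indices from `0` to `n - 1` represent each angle once, since a shift of the index by `n` is
a full turn and `f` is injective. -/
lemma ncard_angle_range {f : ℤ → ℝ} (hf : StrictMono f) {n : ℤ} (hn : 0 < n)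
    (h : ∀ i, f (i + n) = f i + 2 * Real.pi) :
    ((fun φ : ℝ => (φ : Real.Angle)) '' Set.range f).ncard = n.toNat := by
  have h1 : (fun φ : ℝ => (φ : Real.Angle)) '' Set.range f =
      (fun i : ℤ => (f i : Real.Angle)) '' (Finset.Ico 0 n : Finset ℤ) := by
    ext θ
    simp only [Set.mem_image, Set.mem_range, exists_exists_eq_and, Finset.coe_Ico, Set.mem_Ico]
    constructor
    · rintro ⟨i, rfl⟩
      refine ⟨i % n, ⟨Int.emod_nonneg i hn.ne', Int.emod_lt_of_pos i hn⟩, ?_⟩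
      rw [Real.Angle.angle_eq_iff_two_pi_dvd_sub]
      refine ⟨-(i / n), ?_⟩
      have := add_mul_of_add h (i % n) (i / n)
      rw [Int.emod_add_mul_ediv] at this
      push_cast
      linarith
    · rintro ⟨i, -, rfl⟩
      exact ⟨i, rfl⟩
  rw [h1, Set.InjOn.ncard_image, Set.ncard_coe_finset, Int.card_Ico, sub_zero]
  intro i hi j hj hij
  simp only [Finset.coe_Ico, Set.mem_Ico] at hi hj
  obtain ⟨k, hk⟩ := Real.Angle.angle_eq_iff_two_pi_dvd_sub.1 hij
  have h2 : f i = f (j + n * k) := by rw [add_mul_of_add h]; linarith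
  have h3 := hf.injective h2
  have hk0 : k = 0 := by
    by_contra hk0
    rcases lt_or_gt_of_ne hk0 with h4 | h4
    · nlinarith
    · nlinarith
  rw [h3, hk0]; simp

/-! ### Nature of the critical points in a well sequence -/

namespace WellSeq

variable {q : ℝ × ℝ} {n : ℤ}

lemma strictMono_S (w : WellSeq q n) : StrictMono w.S :=
  strictMono_int_of_lt_succ fun i => (w.S_lt i).trans (w.lt_S i)

lemma strictMono_m (w : WellSeq q n) : StrictMono w.m :=
  strictMono_int_of_lt_succ fun i => (w.lt_S i).trans (w.S_lt (i + 1))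

lemma exists_mem (w : WellSeq q n) (φ : ℝ) : ∃ i, w.S i ≤ φ ∧ φ < w.S (i + 1) :=
  exists_floor w.strictMono_S Real.two_pi_pos w.S_add φ

lemma anti (w : WellSeq q n) (i : ℤ) :
    StrictAntiOn (redV q) (Set.Icc (w.S i) (w.m i)) := redV_strictAntiOn (w.neg i)

lemma mono (w : WellSeq q n) (i : ℤ) :
    StrictMonoOn (redV q) (Set.Icc (w.m i) (w.S (i + 1))) :=
  redV_strictMonoOn (w.pos i)

lemma redV₁_m (w : WellSeq q n) (i : ℤ) : redV₁ q (w.m i) = 0 := by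
  refine le_antisymm ?_ ?_
  · refine le_of_tendsto ((continuous_redV₁ q).continuousAt.mono_left nhdsWithin_le_nhds)
      (?_ : ∀ᶠ φ in 𝓝[<] w.m i, _)
    filter_upwards [Ioo_mem_nhdsLT (w.S_lt i)] with φ hφ
    exact (w.neg i φ hφ.1 hφ.2).le
  · refine ge_of_tendsto ((continuous_redV₁ q).continuousAt.mono_left nhdsWithin_le_nhds)
      (?_ : ∀ᶠ φ in 𝓝[>] w.m i, _)
    filter_upwards [Ioo_mem_nhdsGT (w.lt_S i)] with φ hφ
    exact (w.pos i φ hφ.1 hφ.2).le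

lemma redV₁_S (w : WellSeq q n) (i : ℤ) : redV₁ q (w.S i) = 0 := by
  have e : i - 1 + 1 = i := by ring
  have h1 := w.lt_S (i - 1)
  rw [e] at h1
  refine le_antisymm ?_ ?_
  · refine le_of_tendsto ((continuous_redV₁ q).continuousAt.mono_left nhdsWithin_le_nhds)
      (?_ : ∀ᶠ φ in 𝓝[>] w.S i, _)
    filter_upwards [Ioo_mem_nhdsGT (w.S_lt i)] with φ hφ
    exact (w.neg i φ hφ.1 hφ.2).le
  · refine ge_of_tendsto ((continuous_redV₁ q).continuousAt.mono_left nhdsWithin_le_nhds)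
      (?_ : ∀ᶠ φ in 𝓝[<] w.S i, _)
    filter_upwards [Ioo_mem_nhdsLT h1] with φ hφ
    exact (w.pos (i - 1) φ hφ.1 (by rw [e]; exact hφ.2)).le

lemma redV₁_eq_zero_iff (w : WellSeq q n) (φ : ℝ) :
    redV₁ q φ = 0 ↔ φ ∈ Set.range w.S ∨ φ ∈ Set.range w.m := by
  constructor
  · intro h
    obtain ⟨i, h1, h2⟩ := w.exists_mem φ
    rcases h1.eq_or_lt with h1 | h1
    · exact Or.inl ⟨i, h1⟩
    · rcases lt_trichotomy φ (w.m i) with h3 | h3 | h3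
      · exact absurd h (w.neg i φ h1 h3).ne
      · exact Or.inr ⟨i, h3.symm⟩
      · exact absurd h (w.pos i φ h3 h2).ne'
  · rintro (⟨i, rfl⟩ | ⟨i, rfl⟩)
    · exact w.redV₁_S i
    · exact w.redV₁_m i

/-- The sign of the force to the right gives the weak inequality through difference quotients;
nondegeneracy off the critical curve makes it strict. -/
lemma redV₂_S (w : WellSeq q n) (hq : discr q ≠ 0) (i : ℤ) : redV₂ q (w.S i) < 0 := by
  refine lt_of_le_of_ne ?_ (redV₂_ne_zero hq (w.redV₁_S i))
  have h := (hasDerivAt_redV₁ q (w.S i)).tendsto_slope.mono_left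
    (nhdsWithin_mono _ (fun x (hx : x ∈ Set.Ioi (w.S i)) => ne_of_gt hx))
  refine le_of_tendsto h ?_
  filter_upwards [Ioo_mem_nhdsGT (w.S_lt i)] with φ hφ
  rw [slope_def_field, w.redV₁_S, sub_zero]
  exact (div_neg_of_neg_of_pos (w.neg i φ hφ.1 hφ.2) (sub_pos.2 hφ.1)).le

lemma redV₂_m (w : WellSeq q n) (hq : discr q ≠ 0) (i : ℤ) : 0 < redV₂ q (w.m i) := by
  refine lt_of_le_of_ne ?_ (redV₂_ne_zero hq (w.redV₁_m i)).symm
  have h := (hasDerivAt_redV₁ q (w.m i)).tendsto_slope.mono_left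
    (nhdsWithin_mono _ (fun x (hx : x ∈ Set.Ioi (w.m i)) => ne_of_gt hx))
  refine ge_of_tendsto h ?_
  filter_upwards [Ioo_mem_nhdsGT (w.lt_S i)] with φ hφ
  rw [slope_def_field, w.redV₁_m, sub_zero]
  exact (div_pos (w.pos i φ hφ.1 hφ.2) (sub_pos.2 hφ.1)).le

end WellSeq

/-! ### Number of saddles, centres and equilibria on the cylinder -/

section Counting

variable {P : AveragedPendulum} {n : ℤ}

lemma isSaddle_iff_mem_range (w : WellSeq P.param n) (hq : discr P.param ≠ 0)
    (φ : ℝ) : P.IsSaddle φ ↔ φ ∈ Set.range w.S := by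
  rw [isSaddle_iff, w.redV₁_eq_zero_iff]
  constructor
  · rintro ⟨h | ⟨i, rfl⟩, h2⟩
    · exact h
    · exact absurd (w.redV₂_m hq i) (not_lt.2 h2.le)
  · rintro ⟨i, rfl⟩
    exact ⟨Or.inl ⟨i, rfl⟩, w.redV₂_S hq i⟩

lemma isCentre_iff_mem_range (w : WellSeq P.param n) (hq : discr P.param ≠ 0)
    (φ : ℝ) : P.IsCentre φ ↔ φ ∈ Set.range w.m := by
  rw [isCentre_iff, w.redV₁_eq_zero_iff]
  constructor
  · rintro ⟨⟨i, rfl⟩ | h, h2⟩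
    · exact absurd (w.redV₂_S hq i) (not_lt.2 h2.le)
    · exact h
  · rintro ⟨i, rfl⟩
    exact ⟨Or.inr ⟨i, rfl⟩, w.redV₂_m hq i⟩

lemma ncard_saddles (w : WellSeq P.param n) (hq : discr P.param ≠ 0)
    : P.saddles.ncard = n.toNat := by
  rw [← ncard_angle_range w.strictMono_S w.n_pos w.S_add, saddles]
  congr 2
  ext φ
  exact isSaddle_iff_mem_range w hq φ

lemma ncard_centres (w : WellSeq P.param n) (hq : discr P.param ≠ 0)
    : P.centres.ncard = n.toNat := by
  rw [← ncard_angle_range w.strictMono_m w.n_pos w.m_add, centres]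
  congr 2
  ext φ
  exact isCentre_iff_mem_range w hq φ

lemma ncard_equilibria (w : WellSeq P.param n) (hq : discr P.param ≠ 0)
    : P.equilibria.ncard = n.toNat + n.toNat := by
  have h1 : P.equilibria = (fun θ : Real.Angle => (θ, (0 : ℝ))) '' (P.saddles ∪ P.centres) := by
    rw [saddles, centres, ← Set.image_union, Set.image_image, equilibria]
    ext z
    simp only [Set.mem_image, Set.mem_ofPred_eq, Set.mem_union, isSaddle_iff_mem_range w hq,
      isCentre_iff_mem_range w hq, ← w.redV₁_eq_zero_iff, isEquilibrium_iff, toCylinder]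
    constructor
    · rintro ⟨⟨φ, p⟩, ⟨h2, h1⟩, rfl⟩
      exact ⟨φ, h1, by simpa using h2.symm⟩
    · rintro ⟨φ, h1, rfl⟩
      exact ⟨(φ, 0), ⟨rfl, h1⟩, rfl⟩
  have hn := w.n_pos
  have hs := ncard_saddles w hq
  have hc := ncard_centres w hq
  rw [h1, Set.ncard_image_of_injective _ (fun a b h => (Prod.ext_iff.1 h).1),
    Set.ncard_union_eq ?_ (Set.finite_of_ncard_pos (by omega))
      (Set.finite_of_ncard_pos (by omega)), hs, hc]
  · rw [Set.disjoint_left]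
    rintro _ ⟨φ, h1, rfl⟩ ⟨φ', h2, h3⟩
    obtain ⟨k, hk⟩ := Real.Angle.angle_eq_iff_two_pi_dvd_sub.1 h3
    have h1 : P.IsSaddle φ := h1
    have h2 : P.IsCentre φ' := h2
    rw [show φ' = φ + 2 * Real.pi * k by linarith, isCentre_iff, redV₂_add_int] at h2
    exact absurd ((P.isSaddle_iff φ).1 h1).2 (not_lt.2 h2.2.le)

end Counting

/-! ### The potential near a saddle -/

/-- The quotient of `redV q (s + x) - redV q s` by `1 - cos x` for a critical point `s`. -/
noncomputable def loopFn (q : ℝ × ℝ) (s x : ℝ) : ℝ :=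
  q.1 * Real.cos (2 * s) - q.2 * Real.sin (2 * s) + Real.cos s +
    (q.1 * Real.cos (2 * s) - q.2 * Real.sin (2 * s)) * Real.cos x + Real.sin s * Real.sin x

@[fun_prop] lemma continuous_loopFn (q : ℝ × ℝ) (s : ℝ) : Continuous (loopFn q s) := by
  unfold loopFn; fun_prop

/-- A critical point is a double zero of the difference, so `1 - cos x` divides it, and only a
harmonic of degree one remains to be studied. -/
lemma redV_sub_redV {q : ℝ × ℝ} {s : ℝ} (h : redV₁ q s = 0) (x : ℝ) :
    redV q (s + x) - redV q s = (1 - Real.cos x) * loopFn q s x := by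
  simp only [redV₁] at h
  simp only [redV, loopFn]
  rw [show 2 * (s + x) = 2 * s + 2 * x by ring, Real.cos_add, Real.sin_add, Real.cos_add,
    Real.cos_two_mul x, Real.sin_two_mul x]
  have := Real.sin_sq_add_cos_sq x
  linear_combination (Real.sin x * Real.cos x) * h

lemma loopFn_zero (q : ℝ × ℝ) (s : ℝ) : loopFn q s 0 = redV₂ q s := by
  simp [loopFn, redV₂]; ring

lemma one_sub_cos_pos {x : ℝ} (h0 : 0 < x) (h1 : x < 2 * Real.pi) : 0 < 1 - Real.cos x := by
  refine sub_pos.2 ((Real.cos_le_one x).lt_of_ne fun h => ?_)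
  rw [Real.cos_eq_one_iff_of_lt_of_lt (by linarith) h1] at h
  linarith

/-- A saddle at which the potential is not maximal. -/
def IsLowSaddle (q : ℝ × ℝ) (s : ℝ) : Prop :=
  redV₁ q s = 0 ∧ redV₂ q s < 0 ∧ ∃ x, redV q s < redV q x

lemma IsLowSaddle.exists_loopFn_pos {q : ℝ × ℝ} {s : ℝ} (h : IsLowSaddle q s) :
    ∃ x, 0 < x ∧ x < 2 * Real.pi ∧ 0 < loopFn q s x := by
  obtain ⟨h1, h2, x, hx⟩ := h
  obtain ⟨y, hy, hxy⟩ := (show Function.Periodic (fun x => redV q (s + x)) (2 * Real.pi) from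
    fun x => by simp only [← add_assoc, redV_add_two_pi]).exists_mem_Ico₀ Real.two_pi_pos (x - s)
  simp only [add_sub_cancel] at hxy
  rw [hxy] at hx
  have hy0 : 0 < y := hy.1.lt_of_ne (by rintro rfl; simp at hx)
  refine ⟨y, hy0, hy.2, ?_⟩
  have h3 := redV_sub_redV h1 y
  exact pos_of_mul_pos_right (by linarith) (one_sub_cos_pos hy0 hy.2).le

/-- The harmonic `loopFn q s` is negative at `0` and positive somewhere, so its squared amplitude
exceeds the square of its constant term; the excess is `ρ`. Elimination with the equation of
equilibrium gives the identity. Its purpose is that `C` and `sin s` have the same sign. -/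
lemma IsLowSaddle.exists_snd_eq {q : ℝ × ℝ} {s : ℝ} (h : IsLowSaddle q s) :
    ∃ ρ, 0 < ρ ∧ q.2 = Real.sin s * ρ ∧ ρ = (q.1 * Real.cos (2 * s) - q.2 * Real.sin (2 * s)) ^ 2 +
      Real.sin s ^ 2 - (q.1 * Real.cos (2 * s) - q.2 * Real.sin (2 * s) + Real.cos s) ^ 2 := by
  obtain ⟨x, -, -, hx⟩ := h.exists_loopFn_pos
  obtain ⟨h1, h2, -⟩ := h
  rw [← loopFn_zero] at h2
  simp only [loopFn, Real.cos_zero, Real.sin_zero, mul_one, mul_zero, add_zero] at h2 hx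
  refine ⟨_, ?_, ?_, rfl⟩
  · generalize q.1 * Real.cos (2 * s) - q.2 * Real.sin (2 * s) = Y at h2 hx ⊢
    generalize Real.sin s = b at *
    generalize Y + Real.cos s = K at *
    have hx1 := Real.sin_sq_add_cos_sq x
    have h3 : (Y * Real.cos x + b * Real.sin x) ^ 2 ≤ Y ^ 2 + b ^ 2 := by
      nlinarith [sq_nonneg (Y * Real.sin x - b * Real.cos x)]
    -- For `K ≤ 0` positivity at `x` bounds `|K|` by a value of the oscillating part; for `K > 0`
    -- negativity at `0` gives `Y < -K`.
    rcases le_or_gt K 0 with hK | hK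
    · nlinarith
    · nlinarith [sq_nonneg b]
  · simp only [redV₁] at h1
    have hs := Real.sin_sq_add_cos_sq s
    have h2s := Real.sin_sq_add_cos_sq (2 * s)
    have hX : q.2 = -Real.sin s * Real.cos (2 * s) -
        (q.1 * Real.cos (2 * s) - q.2 * Real.sin (2 * s)) * Real.sin (2 * s) := by
      linear_combination Real.cos (2 * s) * h1 - q.2 * h2s
    generalize q.1 * Real.cos (2 * s) - q.2 * Real.sin (2 * s) = Y at hX ⊢
    rw [hX, Real.cos_two_mul', Real.sin_two_mul]
    ring

lemma hasDerivAt_loopFn (q : ℝ × ℝ) (s x : ℝ) : HasDerivAt (loopFn q s)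
    (-(q.1 * Real.cos (2 * s) - q.2 * Real.sin (2 * s)) * Real.sin x +
      Real.sin s * Real.cos x) x := by
  have := (((Real.hasDerivAt_cos x).const_mul
    (q.1 * Real.cos (2 * s) - q.2 * Real.sin (2 * s))).const_add
    (q.1 * Real.cos (2 * s) - q.2 * Real.sin (2 * s) + Real.cos s)).add
    ((Real.hasDerivAt_sin x).const_mul (Real.sin s))
  convert! this using 1
  ring

/-- The first point to the right of a low saddle at which the potential has the same value. -/
lemma IsLowSaddle.exists_turning {q : ℝ × ℝ} {s y : ℝ} (h : IsLowSaddle q s)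
    (hy0 : 0 < y) (hy1 : y < 2 * Real.pi) (hy : 0 < loopFn q s y) :
    ∃ r, 0 < r ∧ r < y ∧ loopFn q s r = 0 ∧ (∀ x, 0 ≤ x → x < r → loopFn q s x < 0) ∧
      0 < redV₁ q (s + r) := by
  have h0 : loopFn q s 0 < 0 := by rw [loopFn_zero]; exact h.2.1
  have hK : IsCompact (Set.Icc 0 y ∩ {x | 0 ≤ loopFn q s x}) :=
    isCompact_Icc.inter_right (isClosed_le continuous_const (continuous_loopFn q s))
  obtain ⟨r, ⟨hr1, hr2⟩, hrmin⟩ := hK.exists_isLeast ⟨y, ⟨hy0.le, le_rfl⟩, hy.le⟩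
  have hr2 : 0 ≤ loopFn q s r := hr2
  have hr0 : 0 < r := hr1.1.lt_of_ne (by rintro rfl; linarith)
  have hneg : ∀ x, 0 ≤ x → x < r → loopFn q s x < 0 := fun x hx0 hxr => by
    by_contra! hx
    exact absurd (hrmin ⟨⟨hx0, hxr.le.trans hr1.2⟩, hx⟩) (not_le.2 hxr)
  have hrz : loopFn q s r = 0 := by
    refine le_antisymm ?_ hr2
    refine le_of_tendsto ((continuous_loopFn q s).continuousAt.mono_left nhdsWithin_le_nhds)
      (?_ : ∀ᶠ φ in 𝓝[<] r, _)
    filter_upwards [Ioo_mem_nhdsLT hr0] with x hx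
    exact (hneg x hx.1.le hx.2).le
  have hry : r < y := hr1.2.lt_of_ne (by rintro rfl; linarith)
  refine ⟨r, hr0, hry, hrz, hneg, ?_⟩
  have hd := hasDerivAt_loopFn q s r
  set d := -(q.1 * Real.cos (2 * s) - q.2 * Real.sin (2 * s)) * Real.sin r +
      Real.sin s * Real.cos r with hd'
  have hd0 : 0 ≤ d := by
    refine ge_of_tendsto (hd.tendsto_slope.mono_left
      (nhdsWithin_mono _ (fun x (hx : x ∈ Set.Iio r) => ne_of_lt hx))) ?_
    filter_upwards [Ioo_mem_nhdsLT hr0] with x hx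
    rw [slope_def_field, hrz, sub_zero]
    exact (div_pos_of_neg_of_neg (hneg x hx.1.le hx.2) (by linarith [hx.2])).le
  -- At a double zero the square of the constant term of `loopFn` would equal its squared amplitude,
  -- contrary to `ρ > 0`.
  have hdne : d ≠ 0 := by
    intro hd1
    obtain ⟨ρ, hρ, -, hρ'⟩ := h.exists_snd_eq
    have hr := Real.sin_sq_add_cos_sq r
    simp only [loopFn] at hrz
    rw [hd1] at hd'
    generalize q.1 * Real.cos (2 * s) - q.2 * Real.sin (2 * s) = Y at *
    generalize Y + Real.cos s = K at *
    generalize Real.sin s = b at *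
    have h5 : K = -(Y * Real.cos r + b * Real.sin r) := by linear_combination hrz
    have h6 : Y ^ 2 + b ^ 2 - K ^ 2 = (-Y * Real.sin r + b * Real.cos r) ^ 2 := by
      rw [h5]; linear_combination (-(Y ^ 2 + b ^ 2)) * hr
    rw [← hd'] at h6
    rw [hρ', h6] at hρ
    norm_num at hρ
  have h7 : HasDerivAt (fun x => redV q (s + x) - redV q s) ((1 - Real.cos r) * d) r := by
    have := ((Real.hasDerivAt_cos r).const_sub 1).mul hd
    rw [hrz] at this
    convert! this using 1
    · funext x; exact redV_sub_redV h.1 x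
    · simp
  have h8 : HasDerivAt (fun x => redV q (s + x) - redV q s) (redV₁ q (s + r)) r := by
    have := ((hasDerivAt_redV q (s + r)).comp_const_add s r).sub_const (redV q s)
    exact this
  rw [h8.unique h7]
  exact mul_pos (one_sub_cos_pos hr0 (hry.trans hy1)) (hd0.lt_of_ne' hdne)

/-- The source of the asymmetry of the eight: only the odd part of `loopFn`, which is `sin s sin x`,
survives. -/
lemma redV_add_sub_redV_sub {q : ℝ × ℝ} {s : ℝ} (h : redV₁ q s = 0) (x : ℝ) :
    redV q (s + x) - redV q (s - x) = 2 * Real.sin s * Real.sin x * (1 - Real.cos x) := by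
  have h1 := redV_sub_redV h x
  have h2 := redV_sub_redV h (-x)
  simp only [loopFn, Real.cos_neg, Real.sin_neg] at h1 h2
  rw [sub_eq_add_neg s x]
  linear_combination h1 - h2

lemma isLowSaddle_reflect {a c s : ℝ} :
    IsLowSaddle (a, -c) (-s) ↔ IsLowSaddle (a, c) s := by
  simp only [IsLowSaddle, redV₁_reflect, redV₂_reflect, redV_reflect, neg_neg, neg_eq_zero]
  refine and_congr_right fun _ => and_congr_right fun _ => ?_
  exact ⟨fun ⟨x, hx⟩ => ⟨-x, hx⟩, fun ⟨x, hx⟩ => ⟨-x, by rwa [neg_neg]⟩⟩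


/-! ### Asymptotics of solutions -/

lemma H_of_tendsto {P : AveragedPendulum} {γ : ℝ → ℝ × ℝ} (h : P.IsSolution γ) {l : Filter ℝ}
    [l.NeBot] {z : ℝ × ℝ} (hz : Tendsto γ l (𝓝 z)) (t : ℝ) :
    P.H (γ t).1 (γ t).2 = P.H z.1 z.2 := by
  have h1 := (P.continuous_H.tendsto z).comp hz
  refine tendsto_nhds_unique (tendsto_const_nhds.congr fun u => ?_) h1
  exact h.H_const t u

lemma snd_eq_zero_of_V_eq {P : AveragedPendulum} {φ p e : ℝ} (h : P.H φ p = e) (h' : e ≤ P.V φ) :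
    p = 0 := by
  rw [H_eq] at h
  have h1 : p ^ 2 / (2 * P.inertia) ≤ 0 := by linarith
  have h2 := P.inertia_pos
  rw [div_le_iff₀ (by positivity), zero_mul] at h1
  exact pow_eq_zero_iff two_ne_zero |>.1 (le_antisymm h1 (sq_nonneg p))

lemma V_le_H (P : AveragedPendulum) (φ p : ℝ) : P.V φ ≤ P.H φ p := by
  rw [H_eq]
  have := P.inertia_pos
  have : 0 ≤ p ^ 2 / (2 * P.inertia) := by positivity
  linarith

lemma H_zero (P : AveragedPendulum) (φ : ℝ) : P.H φ 0 = P.V φ := by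
  rw [H_eq]; simp

/-- A solution which climbs a potential barrier with exactly the energy of its top, an equilibrium,
tends to this equilibrium. -/
lemma IsSolution.climb {P : AveragedPendulum} {γ : ℝ → ℝ × ℝ} (h : P.IsSolution γ) {t₀ y : ℝ}
    (hy : (γ t₀).1 < y) (hp : 0 < (γ t₀).2) (hy0 : redV₁ P.param y = 0)
    (hH : P.H (γ t₀).1 (γ t₀).2 = P.V y)
    (hV : ∀ φ, (γ t₀).1 ≤ φ → φ < y → P.V φ < P.V y) :
    Tendsto γ atTop (𝓝 (y, 0)) := by
  have hc1 : Continuous fun t => (γ t).1 := continuous_fst.comp h.continuous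
  have hc2 : Continuous fun t => (γ t).2 := continuous_snd.comp h.continuous
  have hHt : ∀ t, P.H (γ t).1 (γ t).2 = P.V y := fun t => (h.H_const t t₀).trans hH
  -- On arrival at `y` no kinetic energy would be left, so the point would be the equilibrium, which
  -- no other solution reaches.
  have hne : ∀ t, (γ t).1 ≠ y := fun t ht => by
    have h1 : P.IsEquilibrium (γ t) := by
      rw [AveragedPendulum.isEquilibrium_iff]
      exact ⟨snd_eq_zero_of_V_eq (hHt t) (by rw [ht]), by rw [ht]; exact hy0⟩
    have := h.eq_const h1 t₀
    rw [this, ht] at hy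
    exact lt_irrefl _ hy
  have hlt : ∀ t, (γ t).1 < y := fun t => by
    by_contra! hge
    obtain ⟨u, hu⟩ := mem_range_of_exists_le_of_exists_ge hc1 ⟨t₀, hy.le⟩ ⟨t, hge⟩
    exact hne u hu
  have hmono : ∀ t₁, (∀ t, t₀ ≤ t → t < t₁ → 0 < (γ t).2) →
      MonotoneOn (fun t => (γ t).1) (Set.Icc t₀ t₁) := fun t₁ ht₁ => by
    refine monotoneOn_of_deriv_nonneg (convex_Icc _ _) hc1.continuousOn
      (fun t _ => (h.hasDerivAt_fst t).differentiableAt.differentiableWithinAt) fun t ht => ?_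
    rw [interior_Icc] at ht
    rw [(h.hasDerivAt_fst t).deriv]
    exact (div_pos (ht₁ t ht.1.le ht.2) P.inertia_pos).le
  -- Up to the first zero of the momentum the angle has increased but is still below `y`, where the
  -- potential is less than the energy.
  have hpos : ∀ t, t₀ ≤ t → 0 < (γ t).2 := by
    intro t₂ ht₂
    by_contra! hle
    have hK : IsCompact (Set.Icc t₀ t₂ ∩ {t | (γ t).2 ≤ 0}) :=
      isCompact_Icc.inter_right (isClosed_le hc2 continuous_const)
    obtain ⟨t₁, ⟨h1, h2⟩, hmin⟩ := hK.exists_isLeast ⟨t₂, ⟨ht₂, le_rfl⟩, hle⟩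
    have h2 : (γ t₁).2 ≤ 0 := h2
    have h3 : ∀ t, t₀ ≤ t → t < t₁ → 0 < (γ t).2 := fun t g1 g2 => by
      by_contra! g3
      exact absurd (hmin ⟨⟨g1, g2.le.trans h1.2⟩, g3⟩) (not_le.2 g2)
    have h4 := hmono t₁ h3 ⟨le_rfl, h1.1⟩ ⟨h1.1, le_rfl⟩ h1.1
    have h5 := hV _ h4 (hlt t₁)
    obtain ⟨u, hu1, hu2⟩ := intermediate_value_Icc' h1.1 hc2.continuousOn ⟨h2, hp.le⟩
    have hu2 : (γ u).2 = 0 := hu2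
    rcases hu1.2.eq_or_lt with rfl | hlt'
    · have := hHt u
      rw [hu2, H_zero] at this
      linarith
    · exact absurd hu2 (h3 u hu1.1 hlt').ne'
  have hmono' : MonotoneOn (fun t => (γ t).1) (Set.Ici t₀) := fun a ha b hb hab =>
    hmono b (fun t g1 _ => hpos t g1) ⟨ha, hab⟩ ⟨ha.trans hab, le_rfl⟩ hab
  set g : ℝ → ℝ := fun t => (γ (max t t₀)).1 with hg
  have hgm : Monotone g := fun a b hab =>
    hmono' (Set.mem_Ici.2 (le_max_right _ _)) (Set.mem_Ici.2 (le_max_right _ _))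
      (max_le_max_right _ hab)
  have hgb : BddAbove (Set.range g) := ⟨y, by rintro _ ⟨t, rfl⟩; exact (hlt _).le⟩
  set L := ⨆ t, g t with hL
  have hgL : Tendsto g atTop (𝓝 L) := tendsto_atTop_ciSup hgm hgb
  have hev : ∀ᶠ t in atTop, t₀ ≤ t := eventually_ge_atTop t₀
  have h1 : Tendsto (fun t => (γ t).1) atTop (𝓝 L) := by
    refine hgL.congr' ?_
    filter_upwards [hev] with t ht
    simp [hg, max_eq_left ht]
  have hLy : L ≤ y := ciSup_le fun t => (hlt _).le
  have hL0 : (γ t₀).1 ≤ L := by simpa [hg] using le_ciSup hgb t₀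
  have hI := P.inertia_pos
  have h2 : Tendsto (fun t => (γ t).2) atTop (𝓝 (Real.sqrt (2 * P.inertia * (P.V y - P.V L)))) := by
    have h3 : Tendsto (fun t => Real.sqrt (2 * P.inertia * (P.V y - P.V (γ t).1))) atTop
        (𝓝 (Real.sqrt (2 * P.inertia * (P.V y - P.V L)))) := by
      have : Continuous fun φ => Real.sqrt (2 * P.inertia * (P.V y - P.V φ)) := by fun_prop
      exact (this.tendsto L).comp h1
    refine h3.congr' ?_
    filter_upwards [hev] with t ht
    have h4 := hHt t
    rw [H_eq] at h4
    rw [← Real.sqrt_sq (hpos t ht).le]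
    congr 1
    rw [← h4]
    field_simp
    ring
  have h3 : Tendsto γ atTop (𝓝 (L, Real.sqrt (2 * P.inertia * (P.V y - P.V L)))) :=
    h1.prodMk_nhds h2
  have h4 := h.isEquilibrium_of_tendsto h3
  rw [AveragedPendulum.isEquilibrium_iff] at h4
  have h5 : Real.sqrt (2 * P.inertia * (P.V y - P.V L)) = 0 := h4.1
  -- The limit is an equilibrium, so its momentum vanishes and its potential energy is the whole
  -- energy; below `y` this is impossible.
  have hLy' : L = y := by
    by_contra hne'
    have h6 := hV L hL0 (lt_of_le_of_ne hLy hne')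
    rw [Real.sqrt_eq_zero'] at h5
    have : 0 < 2 * P.inertia * (P.V y - P.V L) := mul_pos (by positivity) (by linarith)
    linarith
  rw [h5, hLy'] at h3
  exact h3

lemma IsSolution.eq_shift {P : AveragedPendulum} {γ δ : ℝ → ℝ × ℝ} (hγ : P.IsSolution γ)
    (hδ : P.IsSolution δ) {t u : ℝ} (h : γ t = δ u) (v : ℝ) : γ v = δ (v + (u - t)) :=
  congrFun (isSolution_unique hγ (hδ.comp_add_const (u - t)) (t₀ := t) (by rw [h]; simp)) v

/-- A right homoclinic loop exists in a potential well. -/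
lemma exists_isHomoclinic {P : AveragedPendulum} {s r : ℝ} (hs : redV₁ P.param s = 0) (hr : 0 < r)
    (hV : ∀ x, 0 < x → x < r → P.V (s + x) < P.V s) (hVr : P.V (s + r) = P.V s)
    (hr1 : 0 < redV₁ P.param (s + r)) :
    ∃ γ : ℝ → ℝ × ℝ, P.IsHomoclinic s γ ∧ ∀ t, s < (γ t).1 := by
  set γ := P.flow (s + r, 0) with hγ
  have h0 : γ 0 = (s + r, 0) := P.flow_zero _
  have h : P.IsSolution γ := P.isSolution_flow _
  -- The solution starts at rest at the turning point, so it is its own time reversal, and only the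
  -- limit at `+∞` has to be found.
  have hrev : ∀ t, γ t = ((γ (-t)).1, -(γ (-t)).2) := fun t =>
    congrFun (isSolution_unique h h.reverse (t₀ := 0) (by simp [h0])) t
  have hc1 : Continuous fun t => (γ t).1 := continuous_fst.comp h.continuous
  have hH : ∀ t, P.H (γ t).1 (γ t).2 = P.V s := fun t => by
    rw [h.H_const t 0, h0, H_zero, hVr]
  have hgt : ∀ t, s < (γ t).1 := fun t => by
    by_contra! hle
    obtain ⟨u, hu⟩ := mem_range_of_exists_le_of_exists_ge hc1 ⟨t, hle⟩
      ⟨0, by rw [h0]; exact (lt_add_of_pos_right s hr).le⟩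
    have hu : (γ u).1 = s := hu
    have h1 : P.IsEquilibrium (γ u) := by
      rw [isEquilibrium_iff]
      exact ⟨snd_eq_zero_of_V_eq (hH u) (by rw [hu]), by rw [hu]; exact hs⟩
    have h2 := congrArg Prod.fst (h.eq_const h1 0)
    rw [h0, hu] at h2
    simp at h2
    exact hr.ne' h2
  have hp0 : ∀ᶠ t in 𝓝[>] (0 : ℝ), (γ t).2 < 0 := by
    have hd := h.hasDerivAt_snd 0
    rw [h0] at hd
    have hneg : -(P.scale * redV₁ P.param (s + r, (0 : ℝ)).1) < 0 :=
      neg_neg_of_pos (mul_pos P.scale_pos hr1)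
    have h1 := hd.tendsto_slope.mono_left
      (nhdsWithin_mono _ (fun x (hx : x ∈ Set.Ioi (0 : ℝ)) => ne_of_gt hx))
    filter_upwards [h1.eventually (gt_mem_nhds hneg), self_mem_nhdsWithin] with t ht ht0
    rw [slope_def_field, h0, sub_zero, sub_zero] at ht
    have ht0 : 0 < t := ht0
    rwa [div_lt_iff₀ ht0, zero_mul] at ht
  obtain ⟨T, hT0, hT⟩ := (mem_nhdsGT_iff_exists_Ioo_subset).1 hp0
  have hT0 : 0 < T := hT0
  have hT' : ∀ t, 0 < t → t < T → (γ t).2 < 0 := fun t g1 g2 => hT ⟨g1, g2⟩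
  have hanti : StrictAntiOn (fun t => (γ t).1) (Set.Icc 0 (T / 2)) := by
    refine strictAntiOn_of_deriv_neg (convex_Icc _ _) hc1.continuousOn fun t ht => ?_
    rw [interior_Icc] at ht
    rw [(h.hasDerivAt_fst t).deriv]
    exact div_neg_of_neg_of_pos (hT' t ht.1 (by linarith [ht.2])) P.inertia_pos
  have hlt : (γ (T / 2)).1 < s + r := by
    have := hanti ⟨le_rfl, by linarith⟩ ⟨by linarith, le_rfl⟩ (by linarith : (0 : ℝ) < T / 2)
    simpa [h0] using this
  -- The saddle is approached from the right; in the reflected pendulum this is a climb from the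
  -- left. It starts at the time `T / 2`, when the momentum is already nonzero.
  have hneg := h.reflect
  have hr' : ∀ φ, P.reflect.V φ = P.V (-φ) := P.V_reflect
  have htop : Tendsto γ atTop (𝓝 (s, 0)) := by
    have := hneg.climb (t₀ := T / 2) (y := -s) (by simpa using hgt _)
      (by simpa using hT' (T / 2) (by linarith) (by linarith))
      (by rw [param_reflect, redV₁_reflect]; simpa using hs)
      (by
        rw [hr', neg_neg, ← hH (T / 2), H_eq, H_eq, hr']
        simp [inertia, AveragedPendulum.reflect])
      (fun φ g1 g2 => by
        rw [hr', hr', neg_neg]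
        have := hV (-φ - s) (by linarith) (by simp at g1; linarith)
        rwa [add_sub_cancel] at this)
    simpa using this.neg
  refine ⟨γ, ⟨h, ?_, htop⟩, hgt⟩
  have h1 := htop.comp tendsto_neg_atBot_atTop
  have h2 : Tendsto (fun t => ((γ (-t)).1, -(γ (-t)).2)) atBot (𝓝 (s, -0)) :=
    ((continuous_fst.tendsto _).comp h1).prodMk_nhds ((continuous_snd.tendsto _).comp h1).neg
  rw [neg_zero] at h2
  exact h2.congr fun t => (hrev t).symm

/-- The shape of a right homoclinic loop. -/
lemma IsHomoclinic.shape {P : AveragedPendulum} {s : ℝ} {γ : ℝ → ℝ × ℝ} (h : P.IsHomoclinic s γ)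
    (hγ : ∀ t, s < (γ t).1) : ∃ r, 0 < r ∧ (∀ x, 0 < x → x < r → P.V (s + x) < P.V s) ∧
      P.V (s + r) = P.V s ∧ redV₁ P.param (s + r) ≠ 0 ∧ (s + r, 0) ∈ Set.range γ ∧
      (∀ t, (γ t).1 ≤ s + r) ∧ (∀ t, P.H (γ t).1 (γ t).2 = P.V s) ∧
      ∀ x, 0 < x → x ≤ r → ∃ t, (γ t).1 = s + x := by
  obtain ⟨hsol, hbot, htop⟩ := h
  have hc1 : Continuous fun t => (γ t).1 := continuous_fst.comp hsol.continuous
  have hbot1 : Tendsto (fun t => (γ t).1) atBot (𝓝 s) := (continuous_fst.tendsto _).comp hbot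
  have htop1 : Tendsto (fun t => (γ t).1) atTop (𝓝 s) := (continuous_fst.tendsto _).comp htop
  have hH : ∀ t, P.H (γ t).1 (γ t).2 = P.V s := fun t => by
    rw [H_of_tendsto hsol htop t, H_zero]
  have hne : ∀ t, ¬ P.IsEquilibrium (γ t) := fun t ht => by
    have h1 : Tendsto (fun u => (γ u).1) atTop (𝓝 (γ t).1) :=
      tendsto_const_nhds.congr fun u => by rw [hsol.eq_const ht u]
    exact absurd (tendsto_nhds_unique htop1 h1) (hγ t).ne
  -- The angle tends to `s < (γ 0).1` at both ends, so it attains its maximum; that is the turning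
  -- point.
  obtain ⟨t₁, ht₁⟩ := hc1.exists_forall_ge' 0 (by
    rw [cocompact_eq_atBot_atTop, eventually_sup]
    exact ⟨(hbot1.eventually (gt_mem_nhds (hγ 0))).mono fun t ht => ht.le,
      (htop1.eventually (gt_mem_nhds (hγ 0))).mono fun t ht => ht.le⟩)
  have hp : (γ t₁).2 = 0 := by
    have h1 : IsLocalMax (fun t => (γ t).1) t₁ := Eventually.of_forall ht₁
    have h2 := h1.hasDerivAt_eq_zero (hsol.hasDerivAt_fst t₁)
    simpa [P.inertia_pos.ne'] using h2
  obtain ⟨r, hr⟩ : ∃ r, (γ t₁).1 = s + r := ⟨_, (add_sub_cancel s _).symm⟩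
  have hr0 : 0 < r := by have := hγ t₁; linarith
  have hatt : ∀ x, 0 < x → x ≤ r → ∃ t, (γ t).1 = s + x := fun x hx0 hxr => by
    obtain ⟨u, hu⟩ := (htop1.eventually (gt_mem_nhds (by linarith : s < s + x))).exists
    exact mem_range_of_exists_le_of_exists_ge hc1 ⟨u, hu.le⟩ ⟨t₁, by linarith⟩
  have hle : ∀ x, 0 < x → x ≤ r → P.V (s + x) ≤ P.V s := fun x hx0 hxr => by
    obtain ⟨t, ht⟩ := hatt x hx0 hxr
    have := P.V_le_H (γ t).1 (γ t).2
    rwa [hH, ht] at this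
  -- Equality at an interior `x` would make `s + x` a local maximum passed with zero momentum, that
  -- is, an equilibrium on the trajectory.
  refine ⟨r, hr0, fun x hx0 hxr => (hle x hx0 hxr.le).lt_of_ne fun heq => ?_, ?_, fun h0 => ?_,
    ⟨t₁, Prod.ext hr hp⟩, fun t => hr ▸ ht₁ t, hH, hatt⟩
  · obtain ⟨t, ht⟩ := hatt x hx0 hxr.le
    refine hne t ?_
    rw [isEquilibrium_iff]
    refine ⟨snd_eq_zero_of_V_eq (hH t) (by rw [ht, heq]), ?_⟩
    rw [ht]
    refine redV₁_eq_zero_of_isLocalMax ?_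
    filter_upwards [Ioo_mem_nhds (by linarith : s < s + x) (by linarith : s + x < s + r)] with φ hφ
    rw [← V_le_V_iff, heq]
    have := hle (φ - s) (by linarith [hφ.1]) (by linarith [hφ.2])
    rwa [add_sub_cancel] at this
  · have := hH t₁
    rwa [hp, H_zero, hr] at this
  · refine hne t₁ ?_
    rw [isEquilibrium_iff, hr]
    exact ⟨hp, h0⟩

/-- The turning point of a right loop is determined by the saddle. -/
lemma turning_unique {V : ℝ → ℝ} {s r r' : ℝ} (hr : 0 < r) (hr' : 0 < r')
    (h : ∀ x, 0 < x → x < r → V (s + x) < V s) (h1 : V (s + r) = V s)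
    (h' : ∀ x, 0 < x → x < r' → V (s + x) < V s) (h1' : V (s + r') = V s) : r = r' := by
  rcases lt_trichotomy r r' with hlt | heq | hlt
  · exact absurd h1 (h' r hr hlt).ne
  · exact heq
  · exact absurd h1' (h r' hr' hlt).ne

/-- Both solutions pass through the same turning point, hence differ by a shift of time. -/
lemma IsHomoclinic.range_eq {P : AveragedPendulum} {s : ℝ} {γ δ : ℝ → ℝ × ℝ}
    (h : P.IsHomoclinic s γ) (hγ : ∀ t, s < (γ t).1) (h' : P.IsHomoclinic s δ)
    (hδ : ∀ t, s < (δ t).1) : Set.range γ = Set.range δ := by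
  obtain ⟨r, h0, h1, h2, -, ⟨t, ht⟩, -⟩ := h.shape hγ
  obtain ⟨r', h0', h1', h2', -, ⟨t', ht'⟩, -⟩ := h'.shape hδ
  obtain rfl := turning_unique h0 h0' h1 h2 h1' h2'
  have h3 := h.1.eq_shift h'.1 (ht.trans ht'.symm)
  have h4 := h'.1.eq_shift h.1 (ht'.trans ht.symm)
  exact Set.Subset.antisymm (by rintro _ ⟨v, rfl⟩; exact ⟨_, (h3 v).symm⟩)
    (by rintro _ ⟨v, rfl⟩; exact ⟨_, (h4 v).symm⟩)

lemma IsHomoclinic.reflect {P : AveragedPendulum} {s : ℝ} {γ : ℝ → ℝ × ℝ}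
    (h : P.IsHomoclinic s γ) : P.reflect.IsHomoclinic (-s) fun t => -γ t := by
  refine ⟨h.1.reflect, ?_, ?_⟩
  · simpa using h.2.1.neg
  · simpa using h.2.2.neg

lemma IsEight.reflect {P : AveragedPendulum} {s : ℝ} {L R : Set (ℝ × ℝ)} (h : P.IsEight s L R) :
    P.reflect.IsEight (-s) (-R) (-L) := by
  obtain ⟨hs, ⟨γ, hγ, hγs, rfl⟩, ⟨δ, hδ, hδs, rfl⟩⟩ := h
  have e : ∀ f : ℝ → ℝ × ℝ, -Set.range f = Set.range fun t => -f t := fun f => by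
    ext z
    simp [neg_eq_iff_eq_neg]
  exact ⟨isSaddle_reflect.2 (by rwa [neg_neg]),
    ⟨_, hδ.reflect, fun t => by simpa using hδs t, e δ⟩,
    ⟨_, hγ.reflect, fun t => by simpa using hγs t, e γ⟩⟩

lemma isLowSaddle_param_reflect {P : AveragedPendulum} {s : ℝ} :
    IsLowSaddle P.reflect.param (-s) ↔ IsLowSaddle P.param s := by
  rw [param_reflect]; exact isLowSaddle_reflect

lemma IsLowSaddle.exists_isHomoclinic {P : AveragedPendulum} {s : ℝ}
    (h : IsLowSaddle P.param s) :
    ∃ γ : ℝ → ℝ × ℝ, P.IsHomoclinic s γ ∧ ∀ t, s < (γ t).1 := by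
  obtain ⟨y, hy0, hy1, hy⟩ := h.exists_loopFn_pos
  obtain ⟨r, hr0, hry, hr, hneg, hr1⟩ := h.exists_turning hy0 hy1 hy
  refine AveragedPendulum.exists_isHomoclinic h.1 hr0 (fun x hx0 hxr => ?_) ?_ hr1
  · rw [V_lt_V_iff, ← sub_neg, redV_sub_redV h.1]
    exact mul_neg_of_pos_of_neg (one_sub_cos_pos hx0 (by linarith)) (hneg x hx0.le hxr)
  · rw [V_eq_V_iff, ← sub_eq_zero, redV_sub_redV h.1, hr, mul_zero]

/-- The eight-shaped separatrices are those of the saddles at which the potential is not maximal. -/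
lemma exists_isEight_iff {P : AveragedPendulum} {s : ℝ} :
    (∃ L R, P.IsEight s L R) ↔ IsLowSaddle P.param s := by
  constructor
  · rintro ⟨L, R, hs, -, ⟨δ, hδ, hδs, rfl⟩⟩
    obtain ⟨r, hr0, h1, h2, h3, -⟩ := hδ.shape hδs
    rw [isSaddle_iff] at hs
    refine ⟨hs.1, hs.2, ?_⟩
    by_contra! hmax
    -- If `s` were a global maximum, the turning point, having the same height, would be one too and
    -- the force would vanish there.
    refine h3 (redV₁_eq_zero_of_isLocalMax (Eventually.of_forall fun x => ?_))
    rw [← V_le_V_iff, h2, V_le_V_iff]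
    exact hmax x
  · intro h
    obtain ⟨γ, hγ, hγs⟩ := h.exists_isHomoclinic
    obtain ⟨δ, hδ, hδs⟩ := (isLowSaddle_param_reflect.2 h).exists_isHomoclinic
    have hδ' := hδ.reflect
    rw [reflect_reflect, neg_neg] at hδ'
    exact ⟨_, _, (isSaddle_iff _ _).2 ⟨h.1, h.2.1⟩,
      ⟨_, hδ', fun t => by have := hδs t; simp only [Prod.fst_neg]; linarith, rfl⟩,
      ⟨γ, hγ, hγs, rfl⟩⟩

/-- If the sine of the saddle is positive, the right loop is the smaller one. -/
lemma IsLowSaddle.redV_lt_of_sin_pos {q : ℝ × ℝ} {s : ℝ} (h : IsLowSaddle q s)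
    (hs : 0 ≤ Real.sin s) : ∃ r, 0 < r ∧ r < Real.pi ∧ (∀ x, 0 < x → x < r → redV q (s + x) <
      redV q s) ∧ redV q (s + r) = redV q s ∧ 0 < redV₁ q (s + r) := by
  obtain ⟨y, hy0, hy1, hy⟩ := h.exists_loopFn_pos
  have hpi := Real.pi_pos
  obtain ⟨z, hz0, hz1, hz⟩ : ∃ z, 0 < z ∧ z ≤ Real.pi ∧ 0 < loopFn q s z := by
    rcases le_or_gt y Real.pi with hle | hlt
    · exact ⟨y, hy0, hle, hy⟩
    -- The passage from `y > π` to `2π - y` reverses the sign of the sine, which increases the term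
    -- `sin s sin y`.
    · refine ⟨2 * Real.pi - y, by linarith, by linarith, ?_⟩
      have h1 : Real.sin (2 * Real.pi - y) = -Real.sin y := by simp [Real.sin_two_pi_sub]
      have h2 : Real.sin y ≤ 0 := by
        have h3 := Real.sin_nonneg_of_nonneg_of_le_pi (x := 2 * Real.pi - y) (by linarith)
          (by linarith)
        linarith
      simp only [loopFn, h1, Real.cos_two_pi_sub] at hy ⊢
      nlinarith
  obtain ⟨r, hr0, hrz, hr, hneg, hr1⟩ := h.exists_turning hz0 (by linarith) hz
  refine ⟨r, hr0, by linarith, fun x hx0 hxr => ?_, ?_, hr1⟩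
  · rw [← sub_neg, redV_sub_redV h.1]
    exact mul_neg_of_pos_of_neg (one_sub_cos_pos hx0 (by linarith)) (hneg x hx0.le hxr)
  · rw [← sub_eq_zero, redV_sub_redV h.1, hr, mul_zero]

lemma redV_sub_lt {q : ℝ × ℝ} {s x : ℝ} (h : redV₁ q s = 0) (hs : 0 < Real.sin s) (hx : 0 < x)
    (hx1 : x < Real.pi) : redV q (s - x) < redV q (s + x) := by
  have h1 := redV_add_sub_redV_sub h x
  have : 0 < 2 * Real.sin s * Real.sin x * (1 - Real.cos x) :=
    mul_pos (mul_pos (by linarith) (Real.sin_pos_of_pos_of_lt_pi hx hx1))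
      (one_sub_cos_pos hx (by linarith [Real.pi_pos]))
  linarith

/-- Here `sin s > 0` and the right loop has width less than `π`, so the potential at `s - x` is
below that at `s + x` over this whole width. Hence the left loop is at least as wide, and at equal
energy it has the larger momentum. -/
lemma IsEight.mirrorInside_of_pos {P : AveragedPendulum} {s : ℝ} {L R : Set (ℝ × ℝ)}
    (h : P.IsEight s L R) (hC : 0 < P.C) : MirrorInside s R L := by
  have hlow := exists_isEight_iff.1 ⟨L, R, h⟩
  have h' := h.reflect
  obtain ⟨hs, ⟨γ, hγ, hγs, rfl⟩, ⟨δ, hδ, hδs, rfl⟩⟩ := h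
  obtain ⟨ρ, hρ, hρ1, -⟩ := hlow.exists_snd_eq
  have hc : 0 < P.param.2 := div_pos hC (mul_pos P.g_pos P.l_pos)
  have hsin : 0 < Real.sin s := by
    rw [hρ1] at hc
    exact pos_of_mul_pos_left hc hρ.le
  obtain ⟨r, hr0, hrpi, hr1, hr2, -⟩ := hlow.redV_lt_of_sin_pos hsin.le
  obtain ⟨r', hr0', hr1', hr2', -, -, hrle, hHR, -⟩ := hδ.shape hδs
  obtain rfl := turning_unique (V := P.V) hr0 hr0' (fun x g1 g2 => P.V_lt_V_iff.2 (hr1 x g1 g2))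
    (P.V_eq_V_iff.2 hr2) hr1' hr2'
  have hγr := hγ.reflect
  obtain ⟨l, hl0, hl1, hl2, -, -, -, hHL, hlatt⟩ := hγr.shape
    (fun t => by have := hγs t; simp only [Prod.fst_neg]; linarith)
  rintro _ ⟨t, rfl⟩
  obtain ⟨x, hx⟩ : ∃ x, (δ t).1 = s + x := ⟨_, (add_sub_cancel s _).symm⟩
  have hx0 : 0 < x := by have := hδs t; linarith
  have hxr : x ≤ r := by have := hrle t; linarith
  have hlt : ∀ x, 0 < x → x ≤ r → P.V (s - x) < P.V (s + x) := fun x h0 h1 =>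
    P.V_lt_V_iff.2 (redV_sub_lt hlow.1 hsin h0 (by linarith))
  have hlr : r ≤ l := by
    by_contra! hlt'
    have h1 := hlt l hl0 hlt'.le
    have h2 := hr1' l hl0 hlt'
    rw [V_reflect, V_reflect, neg_neg] at hl2
    rw [show -(-s + l) = s - l by ring] at hl2
    linarith
  obtain ⟨u, hu⟩ := hlatt x hx0 (hxr.trans hlr)
  have hu1 : (γ u).1 = s - x := by
    simp only [Prod.fst_neg] at hu; linarith
  refine ⟨γ u, ⟨u, rfl⟩, by simp only [mirror]; linarith, ?_⟩
  have hHγ : P.H (γ u).1 (γ u).2 = P.V s := by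
    rw [H_of_tendsto hγ.1 hγ.2.2 u, H_zero]
  have hHδ := hHR t
  rw [H_eq, hx] at hHδ
  rw [H_eq, hu1] at hHγ
  have h3 := hlt x hx0 hxr
  have h4 : (δ t).2 ^ 2 / (2 * P.inertia) < (γ u).2 ^ 2 / (2 * P.inertia) := by linarith
  rw [div_lt_div_iff_of_pos_right (by have := P.inertia_pos; positivity)] at h4
  exact sq_lt_sq.1 h4

lemma IsEight.mirrorInside_of_neg {P : AveragedPendulum} {s : ℝ} {L R : Set (ℝ × ℝ)}
    (h : P.IsEight s L R) (hC : P.C < 0) : MirrorInside s L R := by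
  have h1 := h.reflect.mirrorInside_of_pos (by simpa [AveragedPendulum.reflect] using hC)
  intro z hz
  obtain ⟨z', hz', h2, h3⟩ := h1 (-z) (by simpa using hz)
  refine ⟨-z', hz', ?_, by simpa using h3⟩
  simp only [mirror, Prod.fst_neg] at h2 ⊢
  linarith

/-- For `C = 0` the saddle is a multiple of `π` and the force is odd about it. Reflection with
reversal of time maps the right loop to a left loop, which is unique. -/
lemma IsEight.eq_mirror_image {P : AveragedPendulum} {s : ℝ} {L R : Set (ℝ × ℝ)}
    (h : P.IsEight s L R) (hC : P.C = 0) : L = mirror s '' R := by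
  have hlow := exists_isEight_iff.1 ⟨L, R, h⟩
  obtain ⟨hs, ⟨γ, hγ, hγs, rfl⟩, ⟨δ, hδ, hδs, rfl⟩⟩ := h
  obtain ⟨ρ, hρ, hρ1, -⟩ := hlow.exists_snd_eq
  have hc : P.param.2 = 0 := by simp [param, hC]
  have hsin : Real.sin s = 0 := by
    rw [hc] at hρ1
    exact (mul_eq_zero.1 hρ1.symm).resolve_right hρ.ne'
  obtain ⟨k, hk⟩ := Real.sin_eq_zero_iff.1 hsin
  have hodd : ∀ φ, redV₁ P.param (2 * s - φ) = -redV₁ P.param φ := fun φ => by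
    have h1 : 2 * s - φ = -φ + 2 * Real.pi * k := by rw [← hk]; ring
    have h2 := redV₁_reflect P.param.1 0 φ
    rw [neg_zero, ← hc] at h2
    rw [h1, redV₁_add_int, h2, neg_neg]
  have hsol : P.IsSolution fun t => (2 * s - (δ (-t)).1, (δ (-t)).2) := by
    have h1 := hδ.1.reverse
    refine isSolution_mk (fun t => ?_) fun t => ?_
    · convert! (h1.hasDerivAt_fst t).const_sub (2 * s) using 1
      simp [neg_div]
    · convert! (h1.hasDerivAt_snd t).neg using 1
      · funext t; simp
      · simp [hodd]
  have hlim : ∀ l l' : Filter ℝ, Tendsto (fun t : ℝ => -t) l l' → Tendsto δ l' (𝓝 (s, 0)) →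
      Tendsto (fun t => (2 * s - (δ (-t)).1, (δ (-t)).2)) l (𝓝 (s, 0)) := fun l l' h1 h2 => by
    have h3 := h2.comp h1
    have h4 := (((continuous_fst.tendsto _).comp h3).const_sub (2 * s)).prodMk_nhds
      ((continuous_snd.tendsto _).comp h3)
    simpa [two_mul] using h4
  have hhom : P.IsHomoclinic s fun t => (2 * s - (δ (-t)).1, (δ (-t)).2) :=
    ⟨hsol, hlim _ _ tendsto_neg_atBot_atTop hδ.2.2, hlim _ _ tendsto_neg_atTop_atBot hδ.2.1⟩
  have h1 := (hγ.reflect.range_eq (fun t => by have := hγs t; simp only [Prod.fst_neg]; linarith)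
    hhom.reflect fun t => by have := hδs (-t); simp only [Prod.fst_neg]; linarith)
  have h2 : mirror s '' Set.range δ = Set.range fun t => (2 * s - (δ (-t)).1, (δ (-t)).2) := by
    ext z
    simp only [mirror, Set.mem_image, Set.mem_range, exists_exists_eq_and]
    exact ⟨fun ⟨t, ht⟩ => ⟨-t, by rwa [neg_neg]⟩, fun ⟨t, ht⟩ => ⟨-t, ht⟩⟩
  rw [h2]
  ext z
  have h3 : ∀ f : ℝ → ℝ × ℝ, z ∈ Set.range f ↔ -z ∈ Set.range fun t => -f t := fun f => by
    simp
  rw [h3, h1, ← h3]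


/-! ### Low saddles and the ray -/

/-- Two different saddles of the same height exist only on the ray. -/
lemma mem_ray_of_redV_eq {q : ℝ × ℝ} {x y : ℝ} (hx : redV₁ q x = 0) (hy : redV₁ q y = 0)
    (hx2 : redV₂ q x < 0) (hxy : Real.sin ((x - y) / 2) ≠ 0) (h : redV q x = redV q y) :
    q ∈ ray := by
  obtain ⟨a, c⟩ := q
  obtain ⟨σ, hσ⟩ : ∃ σ, σ = (x + y) / 2 := ⟨_, rfl⟩
  obtain ⟨d, hd⟩ : ∃ d, d = (x - y) / 2 := ⟨_, rfl⟩
  have hx' : x = σ + d := by rw [hσ, hd]; ring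
  have hy' : y = σ + -d := by rw [hσ, hd]; ring
  rw [← hd] at hxy
  have e1 : ∀ ψ, 2 * (σ + ψ) = 2 * σ + 2 * ψ := fun ψ => by ring
  rw [hx'] at hx hx2 h
  rw [hy'] at hy h
  simp only [redV, redV₁, redV₂, e1, Real.sin_add, Real.cos_add, Real.sin_two_mul d,
    Real.cos_two_mul d, Real.sin_neg, Real.cos_neg, mul_neg] at hx hy hx2 h
  set X := a * Real.sin (2 * σ) + c * Real.cos (2 * σ) with hX
  set Y := a * Real.cos (2 * σ) - c * Real.sin (2 * σ) with hY
  have hd1 := Real.sin_sq_add_cos_sq d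
  have hσ1 := Real.sin_sq_add_cos_sq σ
  -- About the midpoint `σ`, the sum and the difference of the equilibrium equations give `h1` and
  -- `h2`, and equal heights give `h3`. Together they leave `X sin² d = 0`, whence `sin σ = 0` and
  -- `c = 0`.
  have h1 : X * (2 * Real.cos d ^ 2 - 1) + Real.sin σ * Real.cos d = 0 := by
    rw [hX]; linear_combination (hx + hy) / 2
  have h2 : 2 * Y * Real.cos d + Real.cos σ = 0 := by
    have : Real.sin d * (2 * Y * Real.cos d + Real.cos σ) = 0 := by
      rw [hY]; linear_combination (hx - hy) / 2
    exact (mul_eq_zero.1 this).resolve_left hxy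
  have h3 : X * Real.cos d + Real.sin σ = 0 := by
    have : Real.sin d * (X * Real.cos d + Real.sin σ) = 0 := by
      rw [hX]; linear_combination h / 2
    exact (mul_eq_zero.1 this).resolve_left hxy
  have h4 : X = 0 := by
    have : Real.sin d ^ 2 * X = 0 := by
      linear_combination (-1 : ℝ) * h1 + Real.cos d * h3 + X * hd1
    exact (mul_eq_zero.1 this).resolve_left (pow_ne_zero 2 hxy)
  have h5 : Real.sin σ = 0 := by rw [h4] at h3; linarith
  have h6 : Real.sin (2 * σ) = 0 := by rw [Real.sin_two_mul, h5]; ring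
  have h7 : Real.cos (2 * σ) = 1 := by
    have h := hσ1
    rw [h5] at h
    rw [Real.cos_two_mul', h5]; linarith
  rw [h6, h7] at hX hY
  have hc : c = 0 := by linarith
  have hYa : Y = a := by linarith
  rw [h5, h6, h7] at hx2
  rw [hYa] at h2
  have h8 : Real.cos σ = -2 * a * Real.cos d := by linarith
  have h9 : 4 * a ^ 2 * Real.cos d ^ 2 = 1 := by
    rw [h8, h5] at hσ1; linarith
  have hs : 0 < Real.sin d ^ 2 := by positivity
  have ha : 0 < a := by
    rw [h8, hc] at hx2
    have : a * Real.sin d ^ 2 > 0 := by nlinarith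
    exact pos_of_mul_pos_left this hs.le
  refine ⟨hc, ?_⟩
  have : 1 < (2 * a) ^ 2 := by nlinarith [pow_pos ha 2]
  change 1 < 2 * a
  nlinarith

/-- The completed square shows that for `2a > 1` all points with `cos φ = -1 / (2a)` are global
maxima of the same height. -/
lemma redV_ray {a : ℝ} (ha : 0 < a) (φ : ℝ) :
    redV (a, 0) φ = 1 / (4 * a) + a / 2 - a * (Real.cos φ + 1 / (2 * a)) ^ 2 := by
  simp only [redV, Real.cos_two_mul]
  field_simp
  ring

lemma redV₁_ray (a φ : ℝ) : redV₁ (a, 0) φ = Real.sin φ * (2 * a * Real.cos φ + 1) := by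
  simp only [redV₁, Real.sin_two_mul]; ring

lemma redV₂_ray (a φ : ℝ) :
    redV₂ (a, 0) φ = 2 * a * (2 * Real.cos φ ^ 2 - 1) + Real.cos φ := by
  simp only [redV₂, Real.cos_two_mul]; ring

lemma not_isLowSaddle_of_mem_ray {q : ℝ × ℝ} (hq : q ∈ ray) (s : ℝ) : ¬ IsLowSaddle q s := by
  obtain ⟨a, c⟩ := q
  obtain ⟨rfl, ha⟩ : c = 0 ∧ 1 < 2 * a := hq
  rintro ⟨h1, h2, x, hx⟩
  rw [redV₁_ray, mul_eq_zero] at h1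
  rw [redV₂_ray] at h2
  have hs := Real.sin_sq_add_cos_sq s
  rcases h1 with h1 | h1
  · rw [h1] at hs
    have : Real.cos s ^ 2 = 1 := by linarith
    rw [this] at h2
    nlinarith [Real.neg_one_le_cos s]
  · rw [redV_ray (by linarith), redV_ray (by linarith)] at hx
    have h3 : Real.cos s + 1 / (2 * a) = 0 := by
      have : 1 / (2 * a) = -Real.cos s := by rw [div_eq_iff (by linarith)]; linarith
      linarith
    rw [h3] at hx
    have : 0 ≤ a * (Real.cos x + 1 / (2 * a)) ^ 2 := mul_nonneg (by linarith) (sq_nonneg _)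
    linarith

/-- The four equilibria on a period to the right of a low saddle. -/
lemma IsLowSaddle.exists_configuration {q : ℝ × ℝ} {s r : ℝ} (h : IsLowSaddle q s) (hr0 : 0 < r)
    (hlt : ∀ x, 0 < x → x < r → redV q (s + x) < redV q s)
    (hr : redV q (s + r) = redV q s) :
    ∃ m M l, s < m ∧ m < s + r ∧ s + r < M ∧ M < l ∧ l < s + 2 * Real.pi ∧
      redV₁ q m = 0 ∧ redV₁ q M = 0 ∧ redV₁ q l = 0 ∧
      (∀ x, s ≤ x → x ≤ s + r → redV q m ≤ redV q x ∧ redV q x ≤ redV q s) ∧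
      redV q s < redV q M ∧ ∀ x, M ≤ x → x ≤ s + 2 * Real.pi → redV q l ≤ redV q x := by
  have hcont := continuous_redV q
  have hle : ∀ x, s ≤ x → x ≤ s + r → redV q x ≤ redV q s := fun x h1 h2 => by
    rcases h1.eq_or_lt with rfl | h1
    · exact le_rfl
    · rcases h2.eq_or_lt with rfl | h2
      · exact hr.le
      · have := hlt (x - s) (by linarith) (by linarith)
        rw [add_sub_cancel] at this
        exact this.le
  obtain ⟨m, hm, hmin⟩ := isCompact_Icc.exists_isMinOn (s := Set.Icc s (s + r))
    ⟨s, le_rfl, by linarith⟩ hcont.continuousOn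
  have hmlt : redV q m < redV q s :=
    (hmin ⟨by linarith, by linarith⟩ : redV q m ≤ redV q (s + r / 2)).trans_lt
      (hlt (r / 2) (by linarith) (by linarith))
  have hm1 : s < m := hm.1.lt_of_ne (by rintro rfl; exact lt_irrefl _ hmlt)
  have hm2 : m < s + r := hm.2.lt_of_ne (by rintro rfl; linarith)
  obtain ⟨M₀, hM₀⟩ := exists_redV_max q
  obtain ⟨y, hy⟩ := h.2.2
  obtain ⟨z, hz, hzM⟩ := (show Function.Periodic (fun x => redV q (s + x)) (2 * Real.pi) from
    fun x => by simp only [← add_assoc, redV_add_two_pi]).exists_mem_Ico₀ Real.two_pi_pos (M₀ - s)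
  simp only [add_sub_cancel] at hzM
  have hmax : ∀ φ, redV q φ ≤ redV q (s + z) := fun φ => hzM ▸ hM₀ φ
  have hsM : redV q s < redV q (s + z) := hy.trans_le (hmax y)
  have hzr : s + r < s + z := by
    by_contra! hzr
    exact absurd (hle (s + z) (by linarith [hz.1]) hzr) (not_le.2 hsM)
  have hz2 : s + z < s + 2 * Real.pi := by linarith [hz.2]
  obtain ⟨l, hl, hlmin⟩ := isCompact_Icc.exists_isMinOn (s := Set.Icc (s + z) (s + 2 * Real.pi))
    ⟨s + z, le_rfl, hz2.le⟩ hcont.continuousOn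
  obtain ⟨a, c⟩ := q
  -- The left loop, seen as a right loop of the reflected potential, provides values below the
  -- saddle level just to the left of `s + 2π`; so the minimum beyond the maximum is interior.
  have h' := isLowSaddle_reflect.2 h
  obtain ⟨y', hy0', hy1', hy'⟩ := h'.exists_loopFn_pos
  obtain ⟨r', hr0', hry', hr', hneg', -⟩ := h'.exists_turning hy0' hy1' hy'
  obtain ⟨x, hx0, hx⟩ := exists_between (lt_min hr0' (by linarith [hz.2] : 0 < 2 * Real.pi - z))
  have hxlt : redV (a, c) (s + 2 * Real.pi - x) < redV (a, c) s := by
    have h1 := redV_sub_redV h'.1 x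
    have h2 := hneg' x hx0.le (hx.trans_le (min_le_left _ _))
    have h3 := one_sub_cos_pos hx0 (by linarith [min_le_left r' (2 * Real.pi - z)])
    rw [redV_reflect, redV_reflect, neg_neg] at h1
    rw [show s + 2 * Real.pi - x = -(-s + x) + 2 * Real.pi by ring, redV_add_two_pi]
    nlinarith
  have hx2 := hx.trans_le (min_le_right _ _)
  have hllt : redV (a, c) l < redV (a, c) s :=
    (hlmin ⟨by linarith, by linarith⟩ : redV (a, c) l ≤ redV (a, c) (s + 2 * Real.pi - x)).trans_lt
      hxlt
  have hl1 : s + z < l := hl.1.lt_of_ne (by rintro rfl; linarith)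
  have hl2 : l < s + 2 * Real.pi := hl.2.lt_of_ne (by
    rintro rfl; rw [redV_add_two_pi] at hllt; exact lt_irrefl _ hllt)
  refine ⟨m, s + z, l, hm1, hm2, hzr, hl1, hl2, redV₁_eq_zero_of_isLocalMin ?_,
    redV₁_eq_zero_of_isLocalMax (.of_forall hmax), redV₁_eq_zero_of_isLocalMin ?_,
    fun x g1 g2 => ⟨hmin ⟨g1, g2⟩, hle x g1 g2⟩, hsM, fun x g1 g2 => hlmin ⟨g1, g2⟩⟩
  · filter_upwards [Icc_mem_nhds hm1 hm2] with x hx using hmin hx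
  · filter_upwards [Icc_mem_nhds hl1 hl2] with x hx using hlmin hx

lemma discr_pos_of_ordered {q : ℝ × ℝ} {x y z w : ℝ} (h1 : x < y) (h2 : y < z) (h3 : z < w)
    (h4 : w < x + 2 * Real.pi) (hx : redV₁ q x = 0) (hy : redV₁ q y = 0)
    (hz : redV₁ q z = 0) (hw : redV₁ q w = 0) : 0 < discr q :=
  discr_pos_of_zeros hx hy hz hw (sin_half_sub_ne_zero h1 (by linarith))
    (sin_half_symm (sin_half_sub_ne_zero (by linarith) (by linarith)))
    (sin_half_symm (sin_half_sub_ne_zero (by linarith) (by linarith)))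
    (sin_half_symm (sin_half_sub_ne_zero (by linarith) (by linarith)))
    (sin_half_symm (sin_half_sub_ne_zero (by linarith) (by linarith)))
    (sin_half_sub_ne_zero (by linarith) (by linarith))

/-- The saddle, the bottoms of its two wells and a higher maximum are four distinct zeros of the
force on a period. -/
lemma IsLowSaddle.mem_domII {q : ℝ × ℝ} {s : ℝ} (h : IsLowSaddle q s) : q ∈ domII := by
  obtain ⟨y, hy0, hy1, hy⟩ := h.exists_loopFn_pos
  obtain ⟨r, hr0, hry, hr, hneg, -⟩ := h.exists_turning hy0 hy1 hy
  obtain ⟨m, M, l, h1, h2, h3, h4, h5, h6, h7, h8, -⟩ := h.exists_configuration hr0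
    (fun x hx0 hxr => by
      rw [← sub_neg, redV_sub_redV h.1]
      exact mul_neg_of_pos_of_neg (one_sub_cos_pos hx0 (by linarith)) (hneg x hx0.le hxr))
    (by rw [← sub_eq_zero, redV_sub_redV h.1, hr, mul_zero])
  exact discr_pos_of_ordered h1 (h2.trans h3) h4 h5 h.1 h6 h7 h8

lemma WellSeq.sin_half_sub_ne_zero {q : ℝ × ℝ} (w : WellSeq q 2) :
    Real.sin ((w.S 0 - w.S 1) / 2) ≠ 0 := by
  have h2 := w.strictMono_S (by norm_num : (1 : ℤ) < 0 + 2)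
  rw [w.S_add] at h2
  exact AveragedPendulum.sin_half_sub_ne_zero (w.strictMono_S one_pos) h2

lemma WellSeq.isLowSaddle {q : ℝ × ℝ} (w : WellSeq q 2) (hmax : ∀ φ, redV q φ ≤ redV q (w.S 0))
    (hq : q ∈ domII \ ray) : IsLowSaddle q (w.S 1) := by
  have hq0 : discr q ≠ 0 := (show 0 < discr q from hq.1).ne'
  refine ⟨w.redV₁_S 1, w.redV₂_S hq0 1, w.S 0, (hmax _).lt_of_ne fun h => hq.2 ?_⟩
  exact mem_ray_of_redV_eq (w.redV₁_S 0) (w.redV₁_S 1) (w.redV₂_S hq0 0) w.sin_half_sub_ne_zero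
    h.symm

lemma exists_isLowSaddle_iff {q : ℝ × ℝ} : (∃ s, IsLowSaddle q s) ↔ q ∈ domII \ ray := by
  constructor
  · rintro ⟨s, hs⟩
    exact ⟨hs.mem_domII, fun hq => not_isLowSaddle_of_mem_ray hq s hs⟩
  · intro hq
    obtain ⟨w, hw⟩ := exists_wellSeq_two hq.1
    exact ⟨_, w.isLowSaddle hw hq⟩

/-- The saddles of even index are global maxima, so only the single class of odd index can be low.
-/
lemma IsLowSaddle.unique {q : ℝ × ℝ} {s s' : ℝ} (h : IsLowSaddle q s) (h' : IsLowSaddle q s') :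
    (s : Real.Angle) = (s' : Real.Angle) := by
  obtain ⟨w, hw⟩ := exists_wellSeq_two h.mem_domII
  have key : ∀ s, IsLowSaddle q s → ∃ k : ℤ, s = w.S 1 + 2 * Real.pi * k := fun s hs => by
    have hq : discr q ≠ 0 := (show 0 < discr q from h.mem_domII).ne'
    rcases (w.redV₁_eq_zero_iff s).1 hs.1 with ⟨i, rfl⟩ | ⟨i, rfl⟩
    · obtain ⟨k, rfl | rfl⟩ := Int.even_or_odd' i
      · have h1 := add_mul_of_add w.S_add 0 k
        obtain ⟨-, -, x, hx⟩ := hs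
        rw [zero_add] at h1
        rw [h1, redV_add_int] at hx
        exact absurd (hw x) (not_le.2 hx)
      · exact ⟨k, by rw [← add_mul_of_add w.S_add, add_comm]⟩
    · exact absurd (w.redV₂_m hq i) (not_lt.2 hs.2.1.le)
  obtain ⟨k, rfl⟩ := key s h
  obtain ⟨k', rfl⟩ := key s' h'
  rw [Real.Angle.angle_eq_iff_two_pi_dvd_sub]
  exact ⟨k - k', by push_cast; ring⟩

/-! ### Heteroclinic trajectories -/

/-- The potential is even with equally high maxima at `±α`. The solution through angle `0` with
exactly this energy and positive momentum climbs to `α`; by reflection combined with time reversal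
it comes from `-α`. -/
lemma exists_heteroclinic_of_mem_ray {P : AveragedPendulum} (hP : P.param ∈ ray) :
    P.HasHeteroclinic := by
  obtain ⟨a, ha⟩ : ∃ a, P.param = (a, 0) := ⟨P.param.1, Prod.ext rfl hP.1⟩
  have ha1 : 1 < 2 * a := by have := hP.2; rwa [ha] at this
  have ha0 : 0 < a := by linarith
  have hlt1 : 1 / (2 * a) < 1 := by rw [div_lt_one (by linarith)]; exact ha1
  have hgt0 : 0 < 1 / (2 * a) := by positivity
  set α := Real.arccos (-(1 / (2 * a))) with hα
  have hcos : Real.cos α = -(1 / (2 * a)) := Real.cos_arccos (by linarith) (by linarith)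
  have hα0 : 0 < α := Real.arccos_pos.2 (by linarith)
  have hαpi : α < Real.pi := (Real.arccos_le_pi _).lt_of_ne fun h => by
    have := Real.arccos_eq_pi.1 h; linarith
  have hsad : ∀ φ, Real.cos φ = -(1 / (2 * a)) → P.IsSaddle φ := fun φ h => by
    rw [isSaddle_iff, ha, redV₁_ray, redV₂_ray, h]
    constructor
    · field_simp; simp
    · have : 2 * a * (2 * (-(1 / (2 * a))) ^ 2 - 1) + -(1 / (2 * a)) = 1 / (2 * a) - 2 * a := by
        field_simp; ring
      rw [this]; linarith
  have hV : ∀ φ, -α < φ → φ < α → P.V φ < P.V α := fun φ h1 h2 => by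
    have h3 : Real.cos α < Real.cos φ := by
      rw [← Real.cos_abs φ]
      exact Real.cos_lt_cos_of_nonneg_of_le_pi (abs_nonneg _) hαpi.le (abs_lt.2 ⟨h1, h2⟩)
    rw [V_lt_V_iff, ha, redV_ray ha0, redV_ray ha0, hcos]
    rw [hcos] at h3
    have : 0 < a * (Real.cos φ + 1 / (2 * a)) ^ 2 := mul_pos ha0 (pow_pos (by linarith) 2)
    simpa using this
  have hI := P.inertia_pos
  have h0 := hV 0 (by linarith) hα0
  have he : 0 < 2 * P.inertia * (P.V α - P.V 0) := mul_pos (by linarith) (by linarith)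
  set γ := P.flow (0, Real.sqrt (2 * P.inertia * (P.V α - P.V 0))) with hγ
  have hγ0 : γ 0 = (0, Real.sqrt (2 * P.inertia * (P.V α - P.V 0))) := P.flow_zero _
  have hsol : P.IsSolution γ := P.isSolution_flow _
  have hrefl : P.reflect = P := by
    have hC : P.C = 0 := by
      have h1 : P.param.2 = 0 := by rw [ha]
      simpa [param, P.g_pos.ne', P.l_pos.ne'] using h1
    cases P
    simp only [AveragedPendulum.reflect] at hC ⊢
    subst hC
    simp
  have hsym : ∀ t, γ t = (-(γ (-t)).1, (γ (-t)).2) := fun t => by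
    have h1 := hsol.reverse.reflect
    rw [hrefl] at h1
    have := congrFun (isSolution_unique hsol h1 (t₀ := 0) (by simp [hγ0])) t
    simpa using this
  have htop : Tendsto γ atTop (𝓝 (α, 0)) := by
    refine hsol.climb (t₀ := 0) (by rw [hγ0]; exact hα0)
      (by rw [hγ0]; exact Real.sqrt_pos.2 he) ((P.isSaddle_iff α).1 (hsad α hcos)).1 ?_ ?_
    · rw [hγ0, H_eq, Real.sq_sqrt he.le]
      field_simp
      ring
    · intro φ h1 h2
      rw [hγ0] at h1
      exact hV φ (by linarith) h2
  refine ⟨-α, α, hsad _ (by rw [Real.cos_neg, hcos]), hsad _ hcos, fun h => ?_, γ, hsol, ?_, htop⟩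
  · rw [Real.Angle.angle_eq_iff_two_pi_dvd_sub] at h
    obtain ⟨k, hk⟩ := h
    rcases lt_trichotomy k 0 with hk0 | rfl | hk0
    · have : (k : ℝ) ≤ -1 := by exact_mod_cast Int.le_sub_one_of_lt hk0
      nlinarith
    · simp at hk; linarith
    · have : (1 : ℝ) ≤ k := by exact_mod_cast hk0
      nlinarith
  · have h1 := htop.comp tendsto_neg_atBot_atTop
    have h2 : Tendsto (fun t => (-(γ (-t)).1, (γ (-t)).2)) atBot (𝓝 (-α, 0)) :=
      ((continuous_fst.tendsto _).comp h1).neg.prodMk_nhds ((continuous_snd.tendsto _).comp h1)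
    exact h2.congr fun t => (hsym t).symm

lemma mem_ray_of_saddles {P : AveragedPendulum} {s₁ s₂ : ℝ} (h1 : P.IsSaddle s₁)
    (h2 : P.IsSaddle s₂) (hne : (s₁ : Real.Angle) ≠ (s₂ : Real.Angle)) (h : P.V s₁ = P.V s₂) :
    P.param ∈ ray := by
  rw [isSaddle_iff] at h1 h2
  refine mem_ray_of_redV_eq h1.1 h2.1 h1.2 (fun h0 => hne ?_) (P.V_eq_V_iff.1 h)
  obtain ⟨k, hk⟩ := sin_half_sub_eq_zero_iff.1 h0
  rw [Real.Angle.angle_eq_iff_two_pi_dvd_sub]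
  exact ⟨k, by linarith⟩

lemma hasHeteroclinic_iff (P : AveragedPendulum) : P.HasHeteroclinic ↔ P.param ∈ ray := by
  refine ⟨?_, exists_heteroclinic_of_mem_ray⟩
  rintro ⟨s₁, s₂, h1, h2, hne, γ, hγ, hbot, htop⟩
  refine mem_ray_of_saddles h1 h2 hne ?_
  have e1 := H_of_tendsto hγ hbot 0
  have e2 := H_of_tendsto hγ htop 0
  rw [H_zero] at e1 e2
  exact e1.symm.trans e2


/-! ### Shrinking of the smaller loop -/

/-- The saddle `v 0`, the bottom `v 1` and the end `v 2` of the right loop, a maximum `v 3` and a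
deeper well `v 4`, and an inflection point `v 5` of the potential between `v 0` and `v 1`. -/
def LoopConfiguration (q : ℝ × ℝ) (v : Fin 6 → ℝ) : Prop :=
  (v 0 ≤ v 1 ∧ v 1 ≤ v 2 ∧ v 2 ≤ v 3 ∧ v 3 ≤ v 4 ∧ v 4 ≤ v 0 + 2 * Real.pi) ∧
  (v 0 ≤ v 5 ∧ v 5 ≤ v 1 ∧ redV₂ q (v 5) = 0) ∧
  (redV₁ q (v 0) = 0 ∧ redV₁ q (v 1) = 0 ∧ redV₁ q (v 3) = 0 ∧ redV₁ q (v 4) = 0) ∧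
  (redV q (v 4) ≤ redV q (v 1) ∧ redV q (v 0) ≤ redV q (v 3)) ∧
  ∀ θ ∈ Set.Icc (0 : ℝ) 1, redV q (v 1) ≤ redV q (v 0 + θ * (v 2 - v 0)) ∧
    redV q (v 0 + θ * (v 2 - v 0)) ≤ redV q (v 0)

lemma LoopConfiguration.shift {q : ℝ × ℝ} {v : Fin 6 → ℝ} (h : LoopConfiguration q v) (k : ℤ) :
    LoopConfiguration q fun i => v i + 2 * Real.pi * k := by
  obtain ⟨⟨h1, h2, h3, h4, h5⟩, ⟨h6, h7, h8⟩, h9, h10, h11⟩ := h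
  have e : ∀ θ, v 0 + 2 * Real.pi * k + θ * (v 2 + 2 * Real.pi * k - (v 0 + 2 * Real.pi * k)) =
      v 0 + θ * (v 2 - v 0) + 2 * Real.pi * k := fun θ => by ring
  simp only [LoopConfiguration, e, redV_add_int, redV₁_add_int, redV₂_add_int]
  exact ⟨⟨by linarith, by linarith, by linarith, by linarith, by linarith⟩,
    ⟨by linarith, by linarith, h8⟩, h9, h10, h11⟩

/-- Four distinct critical points would make the discriminant positive, so two neighbours coincide.
In each case the weak inequalities between the heights make the saddle and the bottom of the loop
equally high; here it matters that the other well is the deeper one. A flat loop has width zero, and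
the inflection point trapped in it makes the saddle degenerate. -/
lemma LoopConfiguration.collapse {q : ℝ × ℝ} {v : Fin 6 → ℝ} (h : LoopConfiguration q v)
    (hq : discr q = 0) : v 1 = v 0 ∧ v 2 = v 0 ∧ q = criticalPoint (v 0) := by
  obtain ⟨⟨h1, h2, h3, h4, h5⟩, ⟨h6, h7, h8⟩, ⟨c0, c1, c3, c4⟩, ⟨h9, h10⟩, h11⟩ := h
  have h01 : redV q (v 1) ≤ redV q (v 0) := by
    simpa using (h11 0 ⟨le_rfl, zero_le_one⟩).1
  have heq : redV q (v 1) = redV q (v 0) := by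
    rcases h1.eq_or_lt with g | g1
    · rw [g]
    rcases (h2.trans h3).eq_or_lt with g | g2
    · rw [← g] at h10; exact le_antisymm h01 h10
    rcases h4.eq_or_lt with g | g3
    · rw [← g] at h9; exact le_antisymm h01 (h10.trans h9)
    rcases h5.eq_or_lt with g | g4
    · rw [g, redV_add_two_pi] at h9; exact le_antisymm h01 h9
    · exact absurd hq (discr_pos_of_ordered g1 g2 g3 g4 c0 c1 c3 c4).ne'
  have h20 : v 2 = v 0 := by
    by_contra hne
    have hlt : v 0 < v 2 := (h1.trans h2).lt_of_ne' hne
    have hconst : ∀ x ∈ Set.Ioo (v 0) (v 2), redV₁ q x = 0 := fun x hx => by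
      have hloc : ∀ x ∈ Set.Ioo (v 0) (v 2), redV q x = redV q (v 0) := fun x hx => by
        have := h11 ((x - v 0) / (v 2 - v 0)) ⟨div_nonneg (by linarith [hx.1]) (by linarith),
          (div_le_one (by linarith)).2 (by linarith [hx.2])⟩
        rw [div_mul_cancel₀ _ (by linarith), add_sub_cancel, heq] at this
        exact le_antisymm this.2 this.1
      refine redV₁_eq_zero_of_isLocalMax ?_
      filter_upwards [Ioo_mem_nhds hx.1 hx.2] with y hy
      rw [hloc y hy, hloc x hx]
    -- Four equally spaced interior points of a flat interval are too many zeros of the force for a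
    -- zero discriminant.
    set d := (v 2 - v 0) / 5 with hd
    have hd0 : 0 < d := by rw [hd]; linarith
    have hd5 : v 2 = v 0 + 5 * d := by rw [hd]; ring
    refine absurd hq (discr_pos_of_ordered (q := q) (x := v 0 + d) (y := v 0 + 2 * d)
      (z := v 0 + 3 * d) (w := v 0 + 4 * d) ?_ ?_ ?_ ?_ ?_ ?_ ?_ ?_).ne'
    iterate 4 linarith
    all_goals exact hconst _ ⟨by linarith, by linarith⟩
  have h10' : v 1 = v 0 := by linarith
  have h50 : v 5 = v 0 := by linarith
  rw [h50] at h8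
  exact ⟨h10', h20, (redV₁_redV₂_eq_zero_iff q _).1 ⟨c0, h8⟩⟩

lemma isClosed_loopConfiguration :
    IsClosed {t : (ℝ × ℝ) × (Fin 6 → ℝ) | LoopConfiguration t.1 t.2} := by
  have k0 : Continuous fun t : (ℝ × ℝ) × ℝ => redV t.1 t.2 := by unfold redV; fun_prop
  have k1 : Continuous fun t : (ℝ × ℝ) × ℝ => redV₁ t.1 t.2 := by unfold redV₁; fun_prop
  have k2 : Continuous fun t : (ℝ × ℝ) × ℝ => redV₂ t.1 t.2 := by unfold redV₂; fun_prop
  have g : ∀ i, Continuous fun t : (ℝ × ℝ) × (Fin 6 → ℝ) => t.2 i := fun i => by fun_prop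
  have c0 : ∀ f : (ℝ × ℝ) × (Fin 6 → ℝ) → ℝ, Continuous f →
      Continuous fun t : (ℝ × ℝ) × (Fin 6 → ℝ) => redV t.1 (f t) := fun f hf =>
    k0.comp (continuous_fst.prodMk hf)
  have c1 : ∀ i, Continuous fun t : (ℝ × ℝ) × (Fin 6 → ℝ) => redV₁ t.1 (t.2 i) := fun i =>
    k1.comp (continuous_fst.prodMk (g i))
  have c2 : ∀ i, Continuous fun t : (ℝ × ℝ) × (Fin 6 → ℝ) => redV₂ t.1 (t.2 i) := fun i =>
    k2.comp (continuous_fst.prodMk (g i))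
  have hall : IsClosed {t : (ℝ × ℝ) × (Fin 6 → ℝ) | ∀ θ ∈ Set.Icc (0 : ℝ) 1,
      redV t.1 (t.2 1) ≤ redV t.1 (t.2 0 + θ * (t.2 2 - t.2 0)) ∧
      redV t.1 (t.2 0 + θ * (t.2 2 - t.2 0)) ≤ redV t.1 (t.2 0)} := by
    have e : {t : (ℝ × ℝ) × (Fin 6 → ℝ) | ∀ θ ∈ Set.Icc (0 : ℝ) 1,
      redV t.1 (t.2 1) ≤ redV t.1 (t.2 0 + θ * (t.2 2 - t.2 0)) ∧
      redV t.1 (t.2 0 + θ * (t.2 2 - t.2 0)) ≤ redV t.1 (t.2 0)} = ⋂ θ ∈ Set.Icc (0 : ℝ) 1,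
      {t : (ℝ × ℝ) × (Fin 6 → ℝ) | redV t.1 (t.2 1) ≤ redV t.1 (t.2 0 + θ * (t.2 2 - t.2 0)) ∧
      redV t.1 (t.2 0 + θ * (t.2 2 - t.2 0)) ≤ redV t.1 (t.2 0)} := by
      ext t; simp
    rw [e]
    refine isClosed_biInter fun θ _ => ?_
    have hf : Continuous fun t : (ℝ × ℝ) × (Fin 6 → ℝ) => t.2 0 + θ * (t.2 2 - t.2 0) := by
      fun_prop
    exact (isClosed_le (c0 _ (g 1)) (c0 _ hf)).and (isClosed_le (c0 _ hf) (c0 _ (g 0)))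
  refine IsClosed.and ?_ (IsClosed.and ?_ (IsClosed.and ?_ (IsClosed.and ?_ hall)))
  · exact (isClosed_le (g 0) (g 1)).and ((isClosed_le (g 1) (g 2)).and ((isClosed_le (g 2) (g 3)).and
      ((isClosed_le (g 3) (g 4)).and (isClosed_le (g 4) ((g 0).add continuous_const)))))
  · exact (isClosed_le (g 0) (g 5)).and ((isClosed_le (g 5) (g 1)).and
      (isClosed_eq (c2 5) continuous_const))
  · exact (isClosed_eq (c1 0) continuous_const).and ((isClosed_eq (c1 1) continuous_const).and
      ((isClosed_eq (c1 3) continuous_const).and (isClosed_eq (c1 4) continuous_const)))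
  · exact (isClosed_le (c0 _ (g 4)) (c0 _ (g 1))).and (isClosed_le (c0 _ (g 0)) (c0 _ (g 3)))

/-- The second coordinate determines the sine, and the first is `-cos φ (1/2 + sin² φ)`, which then
determines the cosine. -/
lemma criticalPoint_inj {x y : ℝ} (h : criticalPoint x = criticalPoint y) :
    ∃ k : ℤ, x = y + 2 * Real.pi * k := by
  simp only [criticalPoint, Prod.mk.injEq] at h
  obtain ⟨h1, h2⟩ := h
  have hs : Real.sin x = Real.sin y := (Odd.strictMono_pow (by decide : Odd 3)).injective h2
  have hc : Real.cos x = Real.cos y := by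
    have hx := Real.sin_sq_add_cos_sq x
    have hy := Real.sin_sq_add_cos_sq y
    have hx2 : Real.cos x ^ 2 = 1 - Real.sin y ^ 2 := by rw [← hs]; linarith
    have hy2 : Real.cos y ^ 2 = 1 - Real.sin y ^ 2 := by linarith
    have h3 : (Real.cos x - Real.cos y) * (1 / 2 + Real.sin y ^ 2) = 0 := by
      linear_combination (-1 : ℝ) * h1 + Real.cos x * hx2 - Real.cos y * hy2
    have h4 : (1 / 2 + Real.sin y ^ 2) ≠ 0 := by positivity
    exact sub_eq_zero.1 ((mul_eq_zero.1 h3).resolve_right h4)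
  obtain ⟨k, hk⟩ := Real.Angle.angle_eq_iff_two_pi_dvd_sub.1 (Real.Angle.cos_sin_inj hc hs)
  exact ⟨k, by linarith⟩

/-- Near a point of the critical curve the loop configurations are small. -/
lemma exists_delta_loopConfiguration (φ₀ : ℝ) {ε : ℝ} (hε : 0 < ε) :
    ∃ δ, 0 < δ ∧ ∀ q, dist q (criticalPoint φ₀) < δ → ∀ v, LoopConfiguration q v →
      ∃ k : ℤ, |v 0 - (φ₀ + 2 * Real.pi * k)| < ε ∧ |v 2 - (φ₀ + 2 * Real.pi * k)| < ε ∧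
        redV q (v 0) - redV q (v 1) < ε := by
  set q₀ := criticalPoint φ₀ with hq₀
  have hd0 : discr q₀ = 0 := (discr_eq_zero_iff q₀).2 ⟨φ₀, rfl⟩
  set B : Set ((ℝ × ℝ) × (Fin 6 → ℝ)) :=
    (Metric.closedBall q₀ 1 ×ˢ Set.univ.pi fun _ => Set.Icc 0 (4 * Real.pi)) ∩
      ({t | LoopConfiguration t.1 t.2} ∩ ⋂ k : ℤ, {t | ε ≤ |t.2 0 - (φ₀ + 2 * Real.pi * k)| ∨
        ε ≤ |t.2 2 - (φ₀ + 2 * Real.pi * k)| ∨ ε ≤ redV t.1 (t.2 0) - redV t.1 (t.2 1)}) with hB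
  have hBc : IsCompact B := by
    refine ((isCompact_closedBall q₀ 1).prod (isCompact_univ_pi fun _ => isCompact_Icc)).inter_right
      (isClosed_loopConfiguration.inter (isClosed_iInter fun k => ?_))
    have a : ∀ (i : Fin 6) (c : ℝ), IsClosed {t : (ℝ × ℝ) × (Fin 6 → ℝ) | ε ≤ |t.2 i - c|} :=
      fun i c => isClosed_le continuous_const (by fun_prop)
    have b : IsClosed {t : (ℝ × ℝ) × (Fin 6 → ℝ) | ε ≤ redV t.1 (t.2 0) - redV t.1 (t.2 1)} := by
      refine isClosed_le continuous_const ?_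
      unfold redV
      fun_prop
    exact (a 0 _).union ((a 2 _).union b)
  -- `B` is the compact set of configurations that are not `ε`-small. Over `q₀` every configuration
  -- has collapsed to a translate of `φ₀`, so none is in `B`; the projection of `B` is closed and
  -- misses a ball about `q₀`.
  have hnot : q₀ ∉ Prod.fst '' B := by
    rintro ⟨⟨q, v⟩, ⟨-, hv, hbad⟩, rfl⟩
    obtain ⟨h1, h2, h3⟩ : v 1 = v 0 ∧ v 2 = v 0 ∧ q₀ = criticalPoint (v 0) :=
      LoopConfiguration.collapse hv hd0
    obtain ⟨k, hk⟩ := criticalPoint_inj (h3.symm.trans hq₀)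
    have : ε ≤ |v 0 - (φ₀ + 2 * Real.pi * k)| ∨ ε ≤ |v 2 - (φ₀ + 2 * Real.pi * k)| ∨
        ε ≤ redV q₀ (v 0) - redV q₀ (v 1) := Set.mem_iInter.1 hbad k
    simp only [h1, h2, hk, sub_self, abs_zero] at this
    simp [hε.not_ge] at this
  have hopen := (hBc.image continuous_fst).isClosed.isOpen_compl
  obtain ⟨δ, hδ, hδB⟩ := Metric.isOpen_iff.1 hopen q₀ hnot
  refine ⟨min δ 1, lt_min hδ one_pos, fun q hq v hv => ?_⟩
  by_contra! hbad
  -- A translation puts the saddle into `[0, 2π)`, hence the whole configuration into `[0, 4π]`.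
  obtain ⟨j, hj, -⟩ := existsUnique_add_zsmul_mem_Ico Real.two_pi_pos (v 0) 0
  rw [zsmul_eq_mul, zero_add] at hj
  have hv' := hv.shift j
  refine hδB (Metric.mem_ball.2 (hq.trans_le (min_le_left _ _)))
    ⟨(q, fun i => v i + 2 * Real.pi * j), ⟨⟨?_, ?_⟩, hv', ?_⟩, rfl⟩
  · exact Metric.mem_closedBall.2 (hq.le.trans (min_le_right _ _))
  · obtain ⟨⟨h1, h2, h3, h4, h5⟩, ⟨h6, h7, -⟩, -⟩ := hv'
    have ha : 0 ≤ v 0 + 2 * Real.pi * j := by linarith [hj.1]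
    have hb : v 0 + 2 * Real.pi * j < 2 * Real.pi := by linarith [hj.2]
    rintro i -
    fin_cases i <;> exact ⟨by simp only [Fin.zero_eta, Fin.mk_one, Fin.reduceFinMk]; linarith,
      by simp only [Fin.zero_eta, Fin.mk_one, Fin.reduceFinMk]; linarith⟩
  · refine Set.mem_iInter.2 fun k => ?_
    simp only [Set.mem_ofPred_eq, redV_add_int]
    have e : ∀ i, v i + 2 * Real.pi * j - (φ₀ + 2 * Real.pi * k) =
        v i - (φ₀ + 2 * Real.pi * (k - j : ℤ)) := fun i => by push_cast; ring
    rw [e, e]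
    by_contra! hc
    exact absurd (hbad (k - j) hc.1 hc.2.1) (not_le.2 hc.2.2)

/-- The loop configuration of the right loop, if it is the smaller one. -/
lemma IsLowSaddle.exists_loopConfiguration {q : ℝ × ℝ} {s r : ℝ} (h : IsLowSaddle q s)
    (hsin : 0 < Real.sin s) (hr0 : 0 < r) (hrpi : r < Real.pi)
    (hlt : ∀ x, 0 < x → x < r → redV q (s + x) < redV q s) (hr : redV q (s + r) = redV q s) :
    ∃ v, LoopConfiguration q v ∧ v 0 = s ∧ v 2 = s + r := by
  obtain ⟨m, M, l, h1, h2, h3, h4, h5, c1, c3, c4, hm, hM, hl⟩ :=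
    h.exists_configuration hr0 hlt hr
  -- Rolle's theorem for the force between the saddle and the bottom of the well gives the
  -- inflection point.
  obtain ⟨ξ, hξ, hξ2⟩ := exists_hasDerivAt_eq_zero h1 (continuous_redV₁ q).continuousOn
    (h.1.trans c1.symm) fun x _ => hasDerivAt_redV₁ q x
  have hside : ∀ y, 0 < y → y ≤ r → redV q (s - y) < redV q s := fun y g1 g2 => by
    have g3 := redV_sub_lt h.1 hsin g1 (g2.trans_lt hrpi)
    rcases g2.eq_or_lt with rfl | g2
    · rwa [hr] at g3
    · exact g3.trans (hlt y g1 g2)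
  -- The mirror image of `m` in the saddle is lower than `m`. After a full turn it lies between `M`
  -- and `s + 2π`, because the mirrored right well is below the saddle level and cannot contain `M`;
  -- so `l` is lower still.
  have hlm : redV q l < redV q m := by
    have hMle : M ≤ 2 * s + 2 * Real.pi - m := by
      by_contra! hc
      have g := hside (s + 2 * Real.pi - M) (by linarith) (by linarith)
      rw [← redV_add_two_pi, show s - (s + 2 * Real.pi - M) + 2 * Real.pi = M by ring] at g
      exact lt_asymm g hM
    have g1 := hl (2 * s + 2 * Real.pi - m) hMle (by linarith)
    have g2 := redV_sub_lt h.1 hsin (x := m - s) (by linarith) (by linarith)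
    rw [add_sub_cancel, ← redV_add_two_pi,
      show s - (m - s) + 2 * Real.pi = 2 * s + 2 * Real.pi - m by ring] at g2
    linarith
  refine ⟨![s, m, s + r, M, l, ξ], ⟨⟨h1.le, h2.le, h3.le, h4.le, h5.le⟩, ⟨hξ.1.le, hξ.2.le, hξ2⟩,
    ⟨h.1, c1, c3, c4⟩, ⟨hlm.le, hM.le⟩, fun θ hθ => ?_⟩, rfl, rfl⟩
  change redV q m ≤ redV q (s + θ * (s + r - s)) ∧ redV q (s + θ * (s + r - s)) ≤ redV q s
  rw [add_sub_cancel_left]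
  have g1 := mul_nonneg hθ.1 hr0.le
  have g2 := mul_le_of_le_one_left hr0.le hθ.2
  exact hm _ (by linarith) (by linarith)

lemma IsEight.sin_pos {P : AveragedPendulum} {s : ℝ} {L R : Set (ℝ × ℝ)} (h : P.IsEight s L R)
    (hC : 0 < P.C) : 0 < Real.sin s := by
  obtain ⟨ρ, hρ, hρ1, -⟩ := (exists_isEight_iff.1 ⟨L, R, h⟩).exists_snd_eq
  have hc : 0 < P.param.2 := div_pos hC (mul_pos P.g_pos P.l_pos)
  rw [hρ1] at hc
  exact pos_of_mul_pos_left hc hρ.le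

lemma exists_delta_right_loop {P₀ : AveragedPendulum} {φ₀ : ℝ} (hφ₀ : P₀.IsDegenerate φ₀) {ε : ℝ}
    (hε : 0 < ε) : ∃ δ, 0 < δ ∧ ∀ P : AveragedPendulum, P.m = P₀.m → P.l = P₀.l → P.g = P₀.g →
      dist P.param P₀.param < δ → ∀ (s : ℝ) (L R : Set (ℝ × ℝ)), P.IsEight s L R → 0 < P.C →
        ∃ k : ℤ, R ⊆ Metric.ball (φ₀ + 2 * Real.pi * k, 0) ε := by
  rw [isDegenerate_iff_param] at hφ₀
  have hI := P₀.inertia_pos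
  have hsc := P₀.scale_pos
  -- On the loop `p²` is `2 * inertia * scale` times the depth below the saddle in the reduced
  -- potential, so depth less than `η` gives `|p| < ε`.
  set η := min ε (ε ^ 2 / (2 * P₀.inertia * P₀.scale)) with hη
  have hη0 : 0 < η := lt_min hε (by positivity)
  obtain ⟨δ, hδ, H⟩ := exists_delta_loopConfiguration φ₀ hη0
  rw [← hφ₀] at H
  refine ⟨δ, hδ, fun P e1 e2 e3 hd s L R h hC => ?_⟩
  have hsin := h.sin_pos hC
  have hlow := exists_isEight_iff.1 ⟨L, R, h⟩
  obtain ⟨hs, -, ⟨γ, hγ, hγs, rfl⟩⟩ := h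
  obtain ⟨r, hr0, hrpi, hr1, hr2, -⟩ := hlow.redV_lt_of_sin_pos hsin.le
  obtain ⟨r', hr0', hr1', hr2', -, -, hrle, hHR, -⟩ := hγ.shape hγs
  obtain rfl := turning_unique (V := P.V) hr0 hr0' (fun x g1 g2 => P.V_lt_V_iff.2 (hr1 x g1 g2))
    (P.V_eq_V_iff.2 hr2) hr1' hr2'
  obtain ⟨v, hv, hv0, hv2⟩ := hlow.exists_loopConfiguration hsin hr0 hrpi hr1 hr2
  obtain ⟨k, hk1, hk2, hk3⟩ := H P.param hd v hv
  refine ⟨k, ?_⟩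
  rintro _ ⟨t, rfl⟩
  rw [hv0] at hk1 hk3
  rw [hv2] at hk2
  have hηε : η ≤ ε := min_le_left _ _
  rw [Metric.mem_ball, Prod.dist_eq, max_lt_iff, Real.dist_eq, Real.dist_eq, sub_zero]
  have g1 := hγs t
  have g2 := hrle t
  constructor
  · rw [abs_lt] at hk1 hk2 ⊢
    constructor <;> linarith
  · have h3 := hHR t
    rw [H_eq] at h3
    have hIe : P.inertia = P₀.inertia := by simp only [inertia, e1, e2]
    have hse : P.scale = P₀.scale := by simp only [scale, e1, e2, e3]
    have h4 : redV P.param (v 1) ≤ redV P.param (γ t).1 := by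
      have := (hv.2.2.2.2 (((γ t).1 - s) / r) ⟨div_nonneg (by linarith) hr0.le,
        (div_le_one hr0).2 (by linarith)⟩).1
      rwa [hv0, hv2, add_sub_cancel_left, div_mul_cancel₀ _ hr0.ne', add_sub_cancel] at this
    rw [V_eq, V_eq, hIe, hse] at h3
    have h5 : (γ t).2 ^ 2 = 2 * P₀.inertia * P₀.scale *
        (redV P.param s - redV P.param (γ t).1) := by
      field_simp at h3
      linarith
    have h6 : redV P.param s - redV P.param (γ t).1 < ε ^ 2 / (2 * P₀.inertia * P₀.scale) := by
      linarith [min_le_right ε (ε ^ 2 / (2 * P₀.inertia * P₀.scale))]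
    rw [lt_div_iff₀ (by positivity)] at h6
    exact abs_lt_of_sq_lt_sq (by linarith) hε.le

lemma exists_delta_loops {P₀ : AveragedPendulum} {φ₀ : ℝ} (hφ₀ : P₀.IsDegenerate φ₀) {ε : ℝ}
    (hε : 0 < ε) : ∃ δ, 0 < δ ∧ ∀ P : AveragedPendulum, P.m = P₀.m → P.l = P₀.l → P.g = P₀.g →
      P.param ∈ domII → dist P.param P₀.param < δ → ∀ (s : ℝ) (L R : Set (ℝ × ℝ)),
        P.IsEight s L R →
        (0 < P.C → ∃ k : ℤ, R ⊆ Metric.ball (φ₀ + 2 * Real.pi * k, 0) ε) ∧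
        (P.C < 0 → ∃ k : ℤ, L ⊆ Metric.ball (φ₀ + 2 * Real.pi * k, 0) ε) := by
  obtain ⟨δ₁, hδ₁, h₁⟩ := exists_delta_right_loop hφ₀ hε
  obtain ⟨δ₂, hδ₂, h₂⟩ := exists_delta_right_loop (P₀ := P₀.reflect) (φ₀ := -φ₀)
    (isDegenerate_reflect.2 (by rwa [neg_neg])) hε
  refine ⟨min δ₁ δ₂, lt_min hδ₁ hδ₂, fun P e1 e2 e3 _ hd s L R h => ⟨fun hC => ?_, fun hC => ?_⟩⟩
  · exact h₁ P e1 e2 e3 (hd.trans_le (min_le_left _ _)) s L R h hC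
  · obtain ⟨k, hk⟩ := h₂ P.reflect e1 e2 e3 (by
      rw [param_reflect, param_reflect]
      refine lt_of_eq_of_lt ?_ (hd.trans_le (min_le_right _ _))
      rw [Prod.dist_eq, Prod.dist_eq, dist_neg_neg]) (-s) (-R) (-L) h.reflect
      (by simpa [AveragedPendulum.reflect] using hC)
    refine ⟨-k, fun z hz => ?_⟩
    have h3 := hk (Set.neg_mem_neg.2 hz)
    rw [Metric.mem_ball, ← dist_neg_neg, neg_neg] at h3
    rw [Metric.mem_ball]
    convert! h3 using 2
    simp
    ring


/-! ### Functions on the line which are alternately decreasing and increasing -/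

/-- The function `v` is strictly decreasing and strictly increasing alternately on the intervals
between successive terms of the sequence `c`. -/
structure Zigzag (v : ℝ → ℝ) (c : ℤ → ℝ) : Prop where
  strictMono : StrictMono c
  exists_mem : ∀ x, ∃ j, c j ≤ x ∧ x < c (j + 1)
  anti : ∀ j, Even j → StrictAntiOn v (Set.Icc (c j) (c (j + 1)))
  mono : ∀ j, Odd j → StrictMonoOn v (Set.Icc (c j) (c (j + 1)))

/-- The points `φ` and `ψ` lie in corresponding intervals and have corresponding values. -/
def ZigzagRel (v v' : ℝ → ℝ) (c c' : ℤ → ℝ) (E : ℤ → ℝ ≃o ℝ) (φ ψ : ℝ) : Prop :=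
  ∃ j, φ ∈ Set.Icc (c j) (c (j + 1)) ∧ ψ ∈ Set.Icc (c' j) (c' (j + 1)) ∧ v' ψ = E j (v φ)

lemma ZigzagRel.symm {v v' : ℝ → ℝ} {c c' : ℤ → ℝ} {E : ℤ → ℝ ≃o ℝ} {φ ψ : ℝ}
    (h : ZigzagRel v v' c c' E φ ψ) : ZigzagRel v' v c' c (fun j => (E j).symm) ψ φ := by
  obtain ⟨j, h1, h2, h3⟩ := h
  exact ⟨j, h2, h1, by rw [h3, OrderIso.symm_apply_apply]⟩

lemma Zigzag.injOn {v : ℝ → ℝ} {c : ℤ → ℝ} (h : Zigzag v c) (j : ℤ) :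
    Set.InjOn v (Set.Icc (c j) (c (j + 1))) := by
  rcases Int.even_or_odd j with hj | hj
  · exact (h.anti j hj).injOn
  · exact (h.mono j hj).injOn

lemma Zigzag.le_succ {v : ℝ → ℝ} {c : ℤ → ℝ} (h : Zigzag v c) (j : ℤ) : c j ≤ c (j + 1) :=
  (h.strictMono (lt_add_one j)).le

/-- In one strip both functions are monotone in the same sense. In different strips the order is
that of the strips, and equality could occur only at a common node, to which both preimages would
belong. -/
lemma ZigzagRel.lt {v v' : ℝ → ℝ} {c c' : ℤ → ℝ} {E : ℤ → ℝ ≃o ℝ} (h : Zigzag v c)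
    (h' : Zigzag v' c') (h1 : ∀ j, v' (c' j) = E j (v (c j)))
    (h2 : ∀ j, v' (c' (j + 1)) = E j (v (c (j + 1)))) {φ ψ φ' ψ' : ℝ}
    (hr : ZigzagRel v v' c c' E φ ψ) (hr' : ZigzagRel v v' c c' E φ' ψ') (hlt : φ < φ') :
    ψ < ψ' := by
  obtain ⟨i, a1, a2, a3⟩ := hr
  obtain ⟨j, b1, b2, b3⟩ := hr'
  rcases lt_trichotomy i j with hij | rfl | hij
  · have g1 := h.strictMono.monotone (show i + 1 ≤ j by omega)
    have g2 := h'.strictMono.monotone (show i + 1 ≤ j by omega)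
    refine ((a2.2.trans g2).trans b2.1).lt_of_ne fun he => ?_
    have e1 : ψ = c' (i + 1) := by linarith [a2.2, b2.1]
    have e2 : ψ' = c' j := by linarith [a2.2, b2.1]
    have e3 : φ = c (i + 1) := h.injOn i a1 ⟨h.le_succ i, le_rfl⟩
      ((E i).injective (by rw [← a3, e1, h2]))
    have e4 : φ' = c j := h.injOn j b1 ⟨le_rfl, h.le_succ j⟩
      ((E j).injective (by rw [← b3, e2, h1]))
    have e5 : i + 1 = j := h'.strictMono.injective (by rw [← e1, ← e2, he])
    rw [e3, e4, e5] at hlt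
    exact lt_irrefl _ hlt
  · rcases Int.even_or_odd i with hi | hi
    · refine ((h'.anti i hi).lt_iff_gt b2 a2).1 ?_
      rw [a3, b3, OrderIso.lt_iff_lt]
      exact h.anti i hi a1 b1 hlt
    · refine ((h'.mono i hi).lt_iff_lt a2 b2).1 ?_
      rw [a3, b3, OrderIso.lt_iff_lt]
      exact h.mono i hi a1 b1 hlt
  · have g1 := h.strictMono.monotone (show j + 1 ≤ i by omega)
    exact absurd hlt (not_lt.2 ((b1.2.trans g1).trans a1.1))

lemma Zigzag.exists_rel {v v' : ℝ → ℝ} {c c' : ℤ → ℝ} {E : ℤ → ℝ ≃o ℝ} (h : Zigzag v c)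
    (h' : Zigzag v' c') (hv' : Continuous v') (h1 : ∀ j, v' (c' j) = E j (v (c j)))
    (h2 : ∀ j, v' (c' (j + 1)) = E j (v (c (j + 1)))) {j : ℤ} {φ : ℝ}
    (hφ : φ ∈ Set.Icc (c j) (c (j + 1))) :
    ∃ ψ ∈ Set.Icc (c' j) (c' (j + 1)), v' ψ = E j (v φ) := by
  rcases Int.even_or_odd j with hj | hj
  · refine intermediate_value_Icc' (h'.le_succ j) hv'.continuousOn ?_
    rw [h1 j, h2 j]
    exact ⟨(E j).monotone ((h.anti j hj).antitoneOn hφ ⟨h.le_succ j, le_rfl⟩ hφ.2),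
      (E j).monotone ((h.anti j hj).antitoneOn ⟨le_rfl, h.le_succ j⟩ hφ hφ.1)⟩
  · refine intermediate_value_Icc (h'.le_succ j) hv'.continuousOn ?_
    rw [h1 j, h2 j]
    exact ⟨(E j).monotone ((h.mono j hj).monotoneOn ⟨le_rfl, h.le_succ j⟩ hφ hφ.1),
      (E j).monotone ((h.mono j hj).monotoneOn hφ ⟨h.le_succ j, le_rfl⟩ hφ.2)⟩

/-- The relation between corresponding points is total by the intermediate value theorem and
preserves order in both directions, so it is the graph of an increasing bijection. The values must
match at both ends of each strip because `E j` may change with `j`. -/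
lemma Zigzag.exists_orderIso {v v' : ℝ → ℝ} {c c' : ℤ → ℝ} {E : ℤ → ℝ ≃o ℝ} (h : Zigzag v c)
    (h' : Zigzag v' c') (hv : Continuous v) (hv' : Continuous v')
    (h1 : ∀ j, v' (c' j) = E j (v (c j))) (h2 : ∀ j, v' (c' (j + 1)) = E j (v (c (j + 1)))) :
    ∃ κ : ℝ ≃o ℝ, ∀ j φ, φ ∈ Set.Icc (c j) (c (j + 1)) →
      κ φ ∈ Set.Icc (c' j) (c' (j + 1)) ∧ v' (κ φ) = E j (v φ) := by
  have s1 : ∀ j, v (c j) = (E j).symm (v' (c' j)) := fun j => by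
    rw [h1, OrderIso.symm_apply_apply]
  have s2 : ∀ j, v (c (j + 1)) = (E j).symm (v' (c' (j + 1))) := fun j => by
    rw [h2, OrderIso.symm_apply_apply]
  have huniq : ∀ φ ψ ψ', ZigzagRel v v' c c' E φ ψ → ZigzagRel v v' c c' E φ ψ' → ψ = ψ' := by
    intro φ ψ ψ' hr hr'
    by_contra hne
    rcases lt_or_gt_of_ne hne with hlt | hlt
    · exact lt_irrefl _ (ZigzagRel.lt h' h s1 s2 hr.symm hr'.symm hlt)
    · exact lt_irrefl _ (ZigzagRel.lt h' h s1 s2 hr'.symm hr.symm hlt)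
  have hex : ∀ φ, ∃ ψ, ZigzagRel v v' c c' E φ ψ := fun φ => by
    obtain ⟨j, hj1, hj2⟩ := h.exists_mem φ
    obtain ⟨ψ, hψ, he⟩ := h.exists_rel h' hv' h1 h2 ⟨hj1, hj2.le⟩
    exact ⟨ψ, j, ⟨hj1, hj2.le⟩, hψ, he⟩
  choose κ hκ using hex
  have hsurj : Function.Surjective κ := fun ψ => by
    obtain ⟨j, hj1, hj2⟩ := h'.exists_mem ψ
    obtain ⟨φ, hφ, he⟩ := h'.exists_rel h hv s1 s2 ⟨hj1, hj2.le⟩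
    exact ⟨φ, huniq φ _ _ (hκ φ) ⟨j, hφ, ⟨hj1, hj2.le⟩, by
      rw [he, OrderIso.apply_symm_apply]⟩⟩
  have hmono : StrictMono κ := fun φ φ' hlt => ZigzagRel.lt h h' h1 h2 (hκ φ) (hκ φ') hlt
  refine ⟨hmono.orderIsoOfSurjective κ hsurj, fun j φ hφ => ?_⟩
  obtain ⟨ψ, hψ, he⟩ := h.exists_rel h' hv' h1 h2 hφ
  rw [StrictMono.coe_orderIsoOfSurjective, huniq φ _ _ (hκ φ) ⟨j, hφ, hψ, he⟩]
  exact ⟨hψ, he⟩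

/-! ### Gluing over strips, and piecewise linear maps of the energy -/

lemma continuous_of_continuousOn_strips {X : Type*} [TopologicalSpace X] {π : X → ℝ}
    (hπ : Continuous π) {c : ℤ → ℝ} (hc : StrictMono c)
    (hex : ∀ x, ∃ j, c j ≤ x ∧ x < c (j + 1)) {f : X → ℝ}
    (hf : ∀ j, ContinuousOn f (π ⁻¹' Set.Icc (c j) (c (j + 1)))) : Continuous f := by
  refine continuous_iff_continuousAt.2 fun x => ?_
  obtain ⟨j, h1, h2⟩ := hex (π x)
  have h3 := (hf (j - 1)).union_of_isClosed (hf j) (isClosed_Icc.preimage hπ)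
    (isClosed_Icc.preimage hπ)
  refine h3.continuousAt (mem_of_superset ((isOpen_Ioo.preimage hπ).mem_nhds
    (show π x ∈ Set.Ioo (c (j - 1)) (c (j + 1)) from ⟨(hc (by omega)).trans_le h1, h2⟩)) ?_)
  rintro y ⟨g1, g2⟩
  rw [sub_add_cancel]
  rcases le_total (π y) (c j) with g | g
  · exact Or.inl ⟨g1.le, g⟩
  · exact Or.inr ⟨g, g2.le⟩

/-- The piecewise linear map with slope `a` below `s` and slope `b` above `s`, where its value is
`s'`. -/
noncomputable def kinkFn (s s' a b x : ℝ) : ℝ := s' + b * max (x - s) 0 - a * max (s - x) 0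

lemma kinkFn_of_le {s x : ℝ} (s' a b : ℝ) (h : s ≤ x) : kinkFn s s' a b x = s' + b * (x - s) := by
  rw [kinkFn, max_eq_left (by linarith), max_eq_right (by linarith)]; ring

lemma kinkFn_of_ge {s x : ℝ} (s' a b : ℝ) (h : x ≤ s) : kinkFn s s' a b x = s' - a * (s - x) := by
  rw [kinkFn, max_eq_right (by linarith), max_eq_left (by linarith)]; ring

lemma strictMono_kinkFn (s s' : ℝ) {a b : ℝ} (ha : 0 < a) (hb : 0 < b) :
    StrictMono (kinkFn s s' a b) := by
  intro x y hxy
  rcases le_total s x with h | h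
  · rw [kinkFn_of_le _ _ _ h, kinkFn_of_le _ _ _ (h.trans hxy.le)]
    have := mul_lt_mul_of_pos_left hxy hb
    linarith
  · rcases le_total s y with h' | h'
    · rw [kinkFn_of_ge _ _ _ h, kinkFn_of_le _ _ _ h']
      have h1 := mul_nonneg ha.le (sub_nonneg.2 h)
      have h2 := mul_nonneg hb.le (sub_nonneg.2 h')
      rcases h.eq_or_lt with rfl | h
      · have := mul_pos hb (sub_pos.2 hxy)
        linarith
      · have := mul_pos ha (sub_pos.2 h)
        linarith
    · rw [kinkFn_of_ge _ _ _ h, kinkFn_of_ge _ _ _ h']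
      have := mul_lt_mul_of_pos_left hxy ha
      linarith

lemma rightInverse_kinkFn (s s' : ℝ) {a b : ℝ} (ha : 0 < a) (hb : 0 < b) :
    Function.RightInverse (kinkFn s' s a⁻¹ b⁻¹) (kinkFn s s' a b) := by
  intro x
  rcases le_total s' x with h | h
  · have := mul_nonneg (inv_nonneg.2 hb.le) (sub_nonneg.2 h)
    rw [kinkFn_of_le _ _ _ h, kinkFn_of_le _ _ _ (by linarith)]
    field_simp
    ring
  · have := mul_nonneg (inv_nonneg.2 ha.le) (sub_nonneg.2 h)
    rw [kinkFn_of_ge _ _ _ h, kinkFn_of_ge _ _ _ (by linarith)]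
    field_simp
    ring

/-- `kinkFn` as an order isomorphism. -/
noncomputable def kink (s s' : ℝ) {a b : ℝ} (ha : 0 < a) (hb : 0 < b) : ℝ ≃o ℝ :=
  (strictMono_kinkFn s s' ha hb).orderIsoOfRightInverse _ _ (rightInverse_kinkFn s s' ha hb)

@[simp] lemma kink_apply (s s' : ℝ) {a b : ℝ} (ha : 0 < a) (hb : 0 < b) (x : ℝ) :
    kink s s' ha hb x = kinkFn s s' a b x := rfl


/-! ### The sequence of all critical points -/

namespace WellSeq

variable {q : ℝ × ℝ} {n : ℤ}

/-- The critical points of the potential: the maxima have even numbers, the minima odd ones. -/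
noncomputable def crit (w : WellSeq q n) (j : ℤ) : ℝ :=
  if Even j then w.S (j / 2) else w.m (j / 2)

lemma crit_two_mul (w : WellSeq q n) (i : ℤ) : w.crit (2 * i) = w.S i := by
  rw [crit, if_pos (even_two_mul i), Int.mul_ediv_cancel_left _ two_ne_zero]

lemma crit_two_mul_add_one (w : WellSeq q n) (i : ℤ) : w.crit (2 * i + 1) = w.m i := by
  rw [crit, if_neg (Int.not_even_two_mul_add_one i)]
  congr 1
  omega

lemma crit_two_mul_add_two (w : WellSeq q n) (i : ℤ) : w.crit (2 * i + 1 + 1) = w.S (i + 1) := by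
  rw [← crit_two_mul]
  congr 1
  ring

lemma strictMono_crit (w : WellSeq q n) : StrictMono w.crit := by
  refine strictMono_int_of_lt_succ fun j => ?_
  obtain ⟨i, rfl | rfl⟩ := Int.even_or_odd' j
  · rw [crit_two_mul, crit_two_mul_add_one]
    exact w.S_lt i
  · rw [crit_two_mul_add_one, crit_two_mul_add_two]
    exact w.lt_S i

lemma crit_add (w : WellSeq q n) (j : ℤ) : w.crit (j + 2 * n) = w.crit j + 2 * Real.pi := by
  obtain ⟨i, rfl | rfl⟩ := Int.even_or_odd' j
  · rw [← mul_add, crit_two_mul, crit_two_mul, S_add]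
  · rw [show 2 * i + 1 + 2 * n = 2 * (i + n) + 1 by ring, crit_two_mul_add_one,
      crit_two_mul_add_one, m_add]

lemma redV₁_eq_zero_iff_crit (w : WellSeq q n) (φ : ℝ) : redV₁ q φ = 0 ↔ ∃ j, φ = w.crit j := by
  rw [w.redV₁_eq_zero_iff]
  constructor
  · rintro (⟨i, rfl⟩ | ⟨i, rfl⟩)
    · exact ⟨2 * i, (w.crit_two_mul i).symm⟩
    · exact ⟨2 * i + 1, (w.crit_two_mul_add_one i).symm⟩
  · rintro ⟨j, rfl⟩
    obtain ⟨i, rfl | rfl⟩ := Int.even_or_odd' j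
    · exact Or.inl ⟨i, (w.crit_two_mul i).symm⟩
    · exact Or.inr ⟨i, (w.crit_two_mul_add_one i).symm⟩

lemma zigzag {P : AveragedPendulum} (w : WellSeq P.param n) : Zigzag P.V w.crit where
  strictMono := w.strictMono_crit
  exists_mem := exists_floor w.strictMono_crit Real.two_pi_pos w.crit_add
  anti := by
    rintro j hj x hx y hy hxy
    obtain ⟨i, rfl⟩ := even_iff_exists_two_mul.1 hj
    rw [crit_two_mul, crit_two_mul_add_one] at hx hy
    exact P.V_lt_V_iff.2 (w.anti i hx hy hxy)
  mono := by
    rintro j hj x hx y hy hxy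
    obtain ⟨i, rfl⟩ := hj
    rw [crit_two_mul_add_one, crit_two_mul_add_two] at hx hy
    exact P.V_lt_V_iff.2 (w.mono i hx hy hxy)

end WellSeq

/-! ### Matching of the potentials of two systems -/

/-- A correspondence between the angles of two systems and, for each angle, between the values
of their energies. -/
structure Matching (P Q : AveragedPendulum) where
  κ : ℝ ≃o ℝ
  e : ℝ → ℝ ≃o ℝ
  κ_add : ∀ φ, κ (φ + 2 * Real.pi) = κ φ + 2 * Real.pi
  e_add : ∀ φ, e (φ + 2 * Real.pi) = e φ
  V_κ : ∀ φ, Q.V (κ φ) = e φ (P.V φ)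
  countable : (Set.range e).Countable
  continuous_e : Continuous fun z : ℝ × ℝ => e z.1 (P.H z.1 z.2)
  continuous_e_symm : Continuous fun z : ℝ × ℝ => (e (κ.symm z.1)).symm (Q.H z.1 z.2)
  crit_iff : ∀ φ, redV₁ Q.param (κ φ) = 0 ↔ redV₁ P.param φ = 0

/-- Wells with levels that correspond to each other under a map which is linear above and below
the value `s`. -/
lemma WellSeq.exists_matching {P Q : AveragedPendulum} {n : ℤ} (w : WellSeq P.param n)
    (w' : WellSeq Q.param n) {s s' D D' : ℝ} {ν : ℤ → ℝ} (hD : 0 < D) (hD' : 0 < D')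
    (hν : ∀ i, 0 ≤ ν i) (hS : ∀ i, P.V (w.S i) = s + D * ν i)
    (hS' : ∀ i, Q.V (w'.S i) = s' + D' * ν i) (hm : ∀ i, P.V (w.m i) < s)
    (hm' : ∀ i, Q.V (w'.m i) < s') : Nonempty (Matching P Q) := by
  -- Above `s` all wells share the slope `D' / D`, which matches the saddle levels; below `s` the
  -- slope is chosen to match the bottom of the well `i`.
  let K : ℤ → ℝ ≃o ℝ := fun i => kink s s'
    (div_pos (sub_pos.2 (hm' i)) (sub_pos.2 (hm i))) (div_pos hD' hD)
  -- The descending strip `2i` and the ascending strip `2i + 1` are the two sides of the well `i`.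
  let E : ℤ → ℝ ≃o ℝ := fun j => K (j / 2)
  have hKS : ∀ i j, K j (P.V (w.S i)) = Q.V (w'.S i) := fun i j => by
    rw [hS, hS', kink_apply, kinkFn_of_le _ _ _ (by nlinarith [hν i])]
    field_simp
    ring
  have hKm : ∀ i, K i (P.V (w.m i)) = Q.V (w'.m i) := fun i => by
    have := sub_pos.2 (hm i)
    rw [kink_apply, kinkFn_of_ge _ _ _ (hm i).le]
    field_simp
    ring
  have hK : ∀ i j x, s ≤ x → K i x = K j x := fun i j x hx => by
    rw [kink_apply, kink_apply, kinkFn_of_le _ _ _ hx, kinkFn_of_le _ _ _ hx]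
  have hKn : ∀ i, K (i + n) = K i := fun i => by
    have h1 : P.V (w.m (i + n)) = P.V (w.m i) := by rw [w.m_add, V_add_two_pi]
    have h2 : Q.V (w'.m (i + n)) = Q.V (w'.m i) := by rw [w'.m_add, V_add_two_pi]
    simp only [K, h1, h2]
  have hE0 : ∀ i, E (2 * i) = K i := fun i => by
    simp only [E]; congr 1; omega
  have hE1 : ∀ i, E (2 * i + 1) = K i := fun i => by
    simp only [E]; congr 1; omega
  have hEn : ∀ j, E (j + 2 * n) = E j := fun j => by
    simp only [E]
    rw [← hKn (j / 2)]; congr 1; omega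
  have h1 : ∀ j, Q.V (w'.crit j) = E j (P.V (w.crit j)) := fun j => by
    obtain ⟨i, rfl | rfl⟩ := Int.even_or_odd' j
    · rw [hE0, w.crit_two_mul, w'.crit_two_mul, hKS]
    · rw [hE1, w.crit_two_mul_add_one, w'.crit_two_mul_add_one, hKm]
  have h2 : ∀ j, Q.V (w'.crit (j + 1)) = E j (P.V (w.crit (j + 1))) := fun j => by
    obtain ⟨i, rfl | rfl⟩ := Int.even_or_odd' j
    · rw [hE0, w.crit_two_mul_add_one, w'.crit_two_mul_add_one, hKm]
    · rw [hE1, w.crit_two_mul_add_two, w'.crit_two_mul_add_two, hKS]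
  -- The map changes only across a saddle. There the energy is at least the saddle level, hence at
  -- least `s`, where all the maps agree.
  have hEE : ∀ j x, P.V (w.crit (j + 1)) ≤ x → E (j + 1) x = E j x := fun j x hx => by
    obtain ⟨i, rfl | rfl⟩ := Int.even_or_odd' j
    · rw [hE0, hE1]
    · rw [show 2 * i + 1 + 1 = 2 * (i + 1) by ring, hE0, hE1]
      rw [w.crit_two_mul_add_two, hS] at hx
      exact hK _ _ _ (by nlinarith [hν (i + 1)])
  have z := w.zigzag
  have z' := w'.zigzag
  obtain ⟨κ, hκ⟩ := z.exists_orderIso z' P.continuous_V Q.continuous_V h1 h2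
  have hκc : ∀ j, κ (w.crit j) = w'.crit j := fun j => by
    obtain ⟨g1, g2⟩ := hκ j _ ⟨le_rfl, z.le_succ j⟩
    exact z'.injOn j g1 ⟨le_rfl, z'.le_succ j⟩ (by rw [g2, h1])
  choose idx hidx1 hidx2 using z.exists_mem
  have hidx : ∀ φ j, w.crit j ≤ φ → φ < w.crit (j + 1) → idx φ = j := fun φ j g1 g2 => by
    have g3 := z.strictMono.lt_iff_lt.1 (g1.trans_lt (hidx2 φ))
    have g4 := z.strictMono.lt_iff_lt.1 ((hidx1 φ).trans_lt g2)
    omega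
  have hstrip : ∀ j φ x, φ ∈ Set.Icc (w.crit j) (w.crit (j + 1)) → P.V φ ≤ x →
      E (idx φ) x = E j x := fun j φ x hφ hx => by
    rcases hφ.2.eq_or_lt with h | h
    · rw [hidx φ (j + 1) h.ge (h.trans_lt (z.strictMono (by omega)))]
      exact hEE j x (h ▸ hx)
    · rw [hidx φ j hφ.1 h]
  have hVκ : ∀ φ, Q.V (κ φ) = E (idx φ) (P.V φ) := fun φ =>
    (hκ (idx φ) φ ⟨hidx1 φ, (hidx2 φ).le⟩).2
  have hidxn : ∀ φ, idx (φ + 2 * Real.pi) = idx φ + 2 * n := fun φ => by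
    refine hidx _ _ ?_ ?_
    · rw [w.crit_add]; linarith [hidx1 φ]
    · rw [show idx φ + 2 * n + 1 = idx φ + 1 + 2 * n by ring, w.crit_add]; linarith [hidx2 φ]
  refine ⟨⟨κ, fun φ => E (idx φ), fun φ => ?_, fun φ => ?_, hVκ, ?_, ?_, ?_, fun φ => ?_⟩⟩
  · obtain ⟨g1, g2⟩ := hκ (idx φ) φ ⟨hidx1 φ, (hidx2 φ).le⟩
    obtain ⟨g3, g4⟩ := hκ (idx φ + 2 * n) (φ + 2 * Real.pi)
      ⟨by rw [← hidxn]; exact hidx1 _, by rw [← hidxn]; exact (hidx2 _).le⟩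
    refine z'.injOn _ g3 ⟨?_, ?_⟩ ?_
    · rw [w'.crit_add]; linarith [g1.1]
    · rw [show idx φ + 2 * n + 1 = idx φ + 1 + 2 * n by ring, w'.crit_add]; linarith [g1.2]
    · rw [g4, V_add_two_pi, V_add_two_pi, g2, hEn]
  · rw [hidxn, hEn]
  · exact (Set.countable_range E).mono (by rintro _ ⟨φ, rfl⟩; exact ⟨idx φ, rfl⟩)
  -- As a function of the angle alone `e` may jump; evaluated at an energy, which is at least the
  -- potential, it agrees with `E j` on the whole closed strip.
  · refine continuous_of_continuousOn_strips continuous_fst z.strictMono z.exists_mem fun j => ?_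
    refine ((E j).continuous.comp P.continuous_H).continuousOn.congr fun x hx => ?_
    exact hstrip j _ _ hx (P.V_le_H _ _)
  · refine continuous_of_continuousOn_strips (κ.symm.continuous.comp continuous_fst) z.strictMono
      z.exists_mem fun j => ?_
    refine ((E j).symm.continuous.comp Q.continuous_H).continuousOn.congr fun x hx => ?_
    change (E (idx (κ.symm x.1))).symm (Q.H x.1 x.2) = (E j).symm (Q.H x.1 x.2)
    have g := hVκ (κ.symm x.1)
    rw [OrderIso.apply_symm_apply] at g
    rw [eq_comm, OrderIso.symm_apply_eq, ← hstrip j _ _ hx, OrderIso.apply_symm_apply]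
    rw [OrderIso.le_symm_apply]
    have g1 := Q.V_le_H x.1 x.2
    rw [g] at g1
    exact g1
  · rw [w.redV₁_eq_zero_iff_crit, w'.redV₁_eq_zero_iff_crit]
    refine exists_congr fun j => ?_
    rw [← hκc, κ.injective.eq_iff]

/-- The inverse matching. -/
noncomputable def Matching.symm {P Q : AveragedPendulum} (M : Matching P Q) : Matching Q P where
  κ := M.κ.symm
  e ψ := (M.e (M.κ.symm ψ)).symm
  κ_add ψ := by
    rw [OrderIso.symm_apply_eq, M.κ_add, OrderIso.apply_symm_apply]
  e_add ψ := by
    have : M.κ.symm (ψ + 2 * Real.pi) = M.κ.symm ψ + 2 * Real.pi := by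
      rw [OrderIso.symm_apply_eq, M.κ_add, OrderIso.apply_symm_apply]
    rw [this, M.e_add]
  V_κ ψ := by
    have := M.V_κ (M.κ.symm ψ)
    rw [OrderIso.apply_symm_apply] at this
    rw [this, OrderIso.symm_apply_apply]
  countable := (M.countable.image OrderIso.symm).mono (by
    rintro _ ⟨φ, rfl⟩
    exact ⟨_, ⟨_, rfl⟩, rfl⟩)
  continuous_e := M.continuous_e_symm
  continuous_e_symm := by
    simp only [OrderIso.symm_symm, OrderIso.symm_apply_apply]
    exact M.continuous_e
  crit_iff ψ := by
    have := M.crit_iff (M.κ.symm ψ)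
    rw [OrderIso.apply_symm_apply] at this
    exact this.symm


/-! ### The homeomorphism given by a matching -/

lemma isOpenQuotientMap_toCylinder : IsOpenQuotientMap toCylinder :=
  IsOpenQuotientMap.prodMap (f := fun φ : ℝ => (φ : Real.Angle)) (g := fun p : ℝ => p)
    QuotientAddGroup.isOpenQuotientMap_mk IsOpenQuotientMap.id

lemma toCylinder_add (z : ℝ × ℝ) : toCylinder (z + (2 * Real.pi, 0)) = toCylinder z := by
  simp [toCylinder]

/-- The map of the cylinder induced by a map of the plane. -/
noncomputable def descend (f : ℝ × ℝ → ℝ × ℝ)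
    (hf : ∀ z, f (z + (2 * Real.pi, 0)) = f z + (2 * Real.pi, 0)) (x : Real.Angle × ℝ) :
    Real.Angle × ℝ :=
  Function.Periodic.lift (f := fun φ : ℝ => toCylinder (f (φ, x.2))) (c := 2 * Real.pi)
    (fun φ => by
      have := hf (φ, x.2)
      rw [Prod.mk_add_mk, add_zero] at this
      simp only [this, toCylinder_add]) x.1

lemma descend_toCylinder {f : ℝ × ℝ → ℝ × ℝ}
    (hf : ∀ z, f (z + (2 * Real.pi, 0)) = f z + (2 * Real.pi, 0)) (z : ℝ × ℝ) :
    descend f hf (toCylinder z) = toCylinder (f z) := rfl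

lemma continuous_descend {f : ℝ × ℝ → ℝ × ℝ}
    (hf : ∀ z, f (z + (2 * Real.pi, 0)) = f z + (2 * Real.pi, 0)) (hc : Continuous f) :
    Continuous (descend f hf) :=
  isOpenQuotientMap_toCylinder.isQuotientMap.continuous_iff.2
    (isOpenQuotientMap_toCylinder.continuous.comp hc)

lemma exists_homeomorph_cylinder {f g : ℝ × ℝ → ℝ × ℝ} (hf : Continuous f) (hg : Continuous g)
    (hfs : ∀ z, f (z + (2 * Real.pi, 0)) = f z + (2 * Real.pi, 0))
    (hgs : ∀ z, g (z + (2 * Real.pi, 0)) = g z + (2 * Real.pi, 0))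
    (hgf : Function.LeftInverse g f) (hfg : Function.RightInverse g f) :
    ∃ h : (Real.Angle × ℝ) ≃ₜ (Real.Angle × ℝ), (∀ z, h (toCylinder z) = toCylinder (f z)) ∧
      ∀ z, h.symm (toCylinder z) = toCylinder (g z) := by
  refine ⟨⟨⟨descend f hfs, descend g hgs, fun x => ?_, fun x => ?_⟩, continuous_descend hfs hf,
    continuous_descend hgs hg⟩, fun z => rfl, fun z => rfl⟩
  · obtain ⟨z, rfl⟩ := isOpenQuotientMap_toCylinder.surjective x
    rw [descend_toCylinder, descend_toCylinder, hgf]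
  · obtain ⟨z, rfl⟩ := isOpenQuotientMap_toCylinder.surjective x
    rw [descend_toCylinder, descend_toCylinder, hfg]

namespace Matching

variable {P Q : AveragedPendulum}

/-- The absolute value of the momentum of the image of a point. -/
noncomputable def absSnd (M : Matching P Q) (z : ℝ × ℝ) : ℝ :=
  √(2 * Q.inertia * (M.e z.1 (P.H z.1 z.2) - Q.V (M.κ z.1)))

/-- The map of the `(φ, p)`-plane given by a matching. -/
noncomputable def map (M : Matching P Q) (z : ℝ × ℝ) : ℝ × ℝ :=
  (M.κ z.1, if 0 ≤ z.2 then M.absSnd z else -M.absSnd z)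

lemma radicand_nonneg (M : Matching P Q) (z : ℝ × ℝ) :
    0 ≤ 2 * Q.inertia * (M.e z.1 (P.H z.1 z.2) - Q.V (M.κ z.1)) := by
  refine mul_nonneg (mul_pos two_pos Q.inertia_pos).le (sub_nonneg.2 ?_)
  rw [M.V_κ]
  exact (M.e z.1).monotone (P.V_le_H _ _)

lemma absSnd_pos (M : Matching P Q) {z : ℝ × ℝ} (hz : z.2 ≠ 0) : 0 < M.absSnd z := by
  refine Real.sqrt_pos.2 (mul_pos (mul_pos two_pos Q.inertia_pos) (sub_pos.2 ?_))
  rw [M.V_κ, OrderIso.lt_iff_lt, H_eq]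
  have := div_pos (pow_pos (abs_pos.2 hz) 2) (mul_pos two_pos P.inertia_pos)
  rw [sq_abs] at this
  linarith

lemma absSnd_eq_zero (M : Matching P Q) {z : ℝ × ℝ} (hz : z.2 = 0) : M.absSnd z = 0 := by
  rw [absSnd, hz, M.V_κ, H_eq]
  simp

lemma H_map (M : Matching P Q) (z : ℝ × ℝ) :
    Q.H (M.map z).1 (M.map z).2 = M.e z.1 (P.H z.1 z.2) := by
  have h1 : (M.map z).2 ^ 2 = 2 * Q.inertia * (M.e z.1 (P.H z.1 z.2) - Q.V (M.κ z.1)) := by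
    rw [← Real.sq_sqrt (M.radicand_nonneg z)]
    simp only [map]
    split_ifs
    · rfl
    · exact neg_sq _
  rw [H_eq, h1]
  have := Q.inertia_pos
  simp only [map]
  field_simp
  ring

lemma map_snd_pos (M : Matching P Q) {z : ℝ × ℝ} (hz : 0 < z.2) : 0 < (M.map z).2 := by
  simp only [map, if_pos hz.le]
  exact M.absSnd_pos hz.ne'

lemma map_snd_neg (M : Matching P Q) {z : ℝ × ℝ} (hz : z.2 < 0) : (M.map z).2 < 0 := by
  simp only [map, if_neg hz.not_ge]
  exact neg_neg_of_pos (M.absSnd_pos hz.ne)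

lemma map_snd_eq_zero_iff (M : Matching P Q) {z : ℝ × ℝ} : (M.map z).2 = 0 ↔ z.2 = 0 := by
  constructor
  · intro h
    rcases lt_trichotomy z.2 0 with h1 | h1 | h1
    · exact absurd h (M.map_snd_neg h1).ne
    · exact h1
    · exact absurd h (M.map_snd_pos h1).ne'
  · intro h
    simp only [map, M.absSnd_eq_zero h, neg_zero, ite_self]

lemma isEquilibrium_map_iff (M : Matching P Q) {z : ℝ × ℝ} :
    Q.IsEquilibrium (M.map z) ↔ P.IsEquilibrium z := by
  rw [isEquilibrium_iff, isEquilibrium_iff, map_snd_eq_zero_iff]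
  exact and_congr_right fun _ => M.crit_iff z.1

lemma continuous_map (M : Matching P Q) : Continuous M.map := by
  have h : Continuous M.absSnd := by
    have h1 := M.continuous_e
    have h2 : Continuous fun z : ℝ × ℝ => Q.V (M.κ z.1) :=
      Q.continuous_V.comp (M.κ.continuous.comp continuous_fst)
    exact ((h1.sub h2).const_mul _).sqrt
  refine (M.κ.continuous.comp continuous_fst).prodMk
    (Continuous.if_le h h.neg continuous_const continuous_snd fun z hz => ?_)
  rw [M.absSnd_eq_zero hz.symm, neg_zero]

lemma map_add (M : Matching P Q) (z : ℝ × ℝ) :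
    M.map (z + (2 * Real.pi, 0)) = M.map z + (2 * Real.pi, 0) := by
  have h : M.absSnd (z + (2 * Real.pi, 0)) = M.absSnd z := by
    simp only [absSnd, Prod.fst_add, Prod.snd_add, add_zero, M.e_add, M.κ_add, H_eq, V_add_two_pi]
  simp only [map, h, Prod.fst_add, Prod.snd_add, add_zero, M.κ_add, Prod.mk_add_mk]

lemma symm_map_map (M : Matching P Q) (z : ℝ × ℝ) : M.symm.map (M.map z) = z := by
  have h1 : M.symm.absSnd (M.map z) = |z.2| := by
    rw [absSnd, H_map]
    simp only [symm, map, OrderIso.symm_apply_apply]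
    rw [H_eq, ← Real.sqrt_sq_eq_abs]
    congr 1
    have := P.inertia_pos
    field_simp
    ring
  refine Prod.ext (M.κ.symm_apply_apply _) ?_
  change (if 0 ≤ (M.map z).2 then M.symm.absSnd (M.map z) else -M.symm.absSnd (M.map z)) = z.2
  rw [h1]
  rcases lt_trichotomy z.2 0 with h | h | h
  · rw [if_neg (M.map_snd_neg h).not_ge, abs_of_neg h, neg_neg]
  · simp [h]
  · rw [if_pos (M.map_snd_pos h).le, abs_of_pos h]

lemma map_symm_map (M : Matching P Q) (z : ℝ × ℝ) : M.map (M.symm.map z) = z := by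
  have h := M.symm.symm_map_map z
  have e : M.symm.symm.map = M.map := by
    funext x
    simp only [map, absSnd, symm, OrderIso.symm_symm, OrderIso.symm_apply_apply]
  rwa [e] at h

/-- The map of the energy varies with the angle but takes only countably many forms. The transformed
energy along a trajectory is continuous with countable, connected range, hence constant. -/
lemma H_map_const (M : Matching P Q) {γ : ℝ → ℝ × ℝ} (hγ : P.IsSolution γ) (t : ℝ) :
    Q.H (M.map (γ t)).1 (M.map (γ t)).2 = Q.H (M.map (γ 0)).1 (M.map (γ 0)).2 := by
  simp only [H_map]
  have h1 : Continuous fun t => M.e (γ t).1 (P.H (γ t).1 (γ t).2) :=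
    M.continuous_e.comp hγ.continuous
  have h2 : (Set.range fun t => M.e (γ t).1 (P.H (γ t).1 (γ t).2)).Countable := by
    refine (M.countable.image fun f => f (P.H (γ 0).1 (γ 0).2)).mono ?_
    rintro _ ⟨t, rfl⟩
    exact ⟨_, ⟨(γ t).1, rfl⟩, by simp only [hγ.H_const t 0]⟩
  exact h2.isTotallyDisconnected _ subset_rfl (isPreconnected_range h1) ⟨t, rfl⟩ ⟨0, rfl⟩

end Matching


/-! ### Reparametrization of level curves by the time of a flow -/

/-- Near a point which is not an equilibrium, the time along the flow is a continuous function on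
the level curve. -/
lemma exists_local_time {Q : AveragedPendulum} {z₀ : ℝ × ℝ} (hz₀ : ¬ Q.IsEquilibrium z₀) :
    ∃ θ : ℝ × ℝ → ℝ, (∀ᶠ z in 𝓝 z₀, ContinuousAt θ z) ∧
      ∀ᶠ z in 𝓝 z₀, Q.H z.1 z.2 = Q.H z₀.1 z₀.2 → z = Q.flow z₀ (θ z) := by
  obtain ⟨x₁, hx₁⟩ : ∃ x, x = (Q.field z₀).1 := ⟨_, rfl⟩
  obtain ⟨x₂, hx₂⟩ : ∃ x, x = (Q.field z₀).2 := ⟨_, rfl⟩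
  have hI := Q.inertia_pos
  have hN : x₁ ^ 2 + x₂ ^ 2 ≠ 0 := fun h => hz₀ <| by
    have h1 : x₁ = 0 := by nlinarith [sq_nonneg x₂, sq_nonneg x₁]
    have h2 : x₂ = 0 := by nlinarith [sq_nonneg x₂, sq_nonneg x₁]
    rw [hx₁, field] at h1
    rw [hx₂, field] at h2
    rw [isEquilibrium_iff]
    exact ⟨by simpa [hI.ne'] using h1, by simpa [Q.scale_pos.ne'] using h2⟩
  -- `ℓ` is the coordinate in the direction of the field at `z₀`. It has nonzero speed along the
  -- flow, so it can be inverted locally to recover the time.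
  set ℓ : ℝ × ℝ →L[ℝ] ℝ := x₁ • ContinuousLinearMap.fst ℝ ℝ ℝ +
    x₂ • ContinuousLinearMap.snd ℝ ℝ ℝ with hℓ
  have hℓa : ∀ z, ℓ z = x₁ * z.1 + x₂ * z.2 := fun z => by simp [hℓ]
  have hu : ∀ t, HasDerivAt (fun t => ℓ (Q.flow z₀ t)) (ℓ (Q.field (Q.flow z₀ t))) t := fun t =>
    ℓ.hasFDerivAt.comp_hasDerivAt t ((Q.isSolution_iff _).1 (Q.isSolution_flow z₀) t)
  have hflow := (Q.isSolution_flow z₀).continuous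
  have hfield : Continuous Q.field := (Q.contDiff_field).continuous
  have hu0 : HasStrictDerivAt (fun t => ℓ (Q.flow z₀ t)) (ℓ (Q.field (Q.flow z₀ 0))) 0 :=
    hasStrictDerivAt_of_hasDerivAt_of_continuousAt (Eventually.of_forall hu)
      (ℓ.continuous.comp (hfield.comp hflow)).continuousAt
  have hne : ℓ (Q.field (Q.flow z₀ 0)) ≠ 0 := by
    rw [flow_zero, hℓa, ← hx₁, ← hx₂, ← sq, ← sq]
    exact hN
  set e := (hu0.hasStrictFDerivAt_equiv hne).toOpenPartialHomeomorph with he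
  have hecoe : ∀ t, e t = ℓ (Q.flow z₀ t) := fun t => rfl
  have he0 : (0 : ℝ) ∈ e.source :=
    (hu0.hasStrictFDerivAt_equiv hne).mem_toOpenPartialHomeomorph_source
  have ht0 : ℓ z₀ ∈ e.target := by
    have := e.map_source he0
    rwa [hecoe, flow_zero] at this
  have htgt : ∀ᶠ z in 𝓝 z₀, ℓ z ∈ e.target :=
    ℓ.continuous.continuousAt.eventually_mem (e.open_target.mem_nhds ht0)
  have hθc : ∀ z, ℓ z ∈ e.target → ContinuousAt (fun z => e.symm (ℓ z)) z := fun z hz =>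
    ContinuousAt.comp (g := e.symm) (e.continuousAt_symm hz) ℓ.continuous.continuousAt
  have hθ0 : e.symm (ℓ z₀) = 0 := by
    have := e.left_inv he0
    rwa [hecoe, flow_zero] at this
  have hVd := (Q.hasDerivAt_V z₀.1).comp_hasFDerivAt z₀ (ContinuousLinearMap.fst ℝ ℝ ℝ).hasFDerivAt
  have hHd : HasFDerivAt (fun z : ℝ × ℝ => Q.H z.1 z.2)
      ((-x₂) • ContinuousLinearMap.fst ℝ ℝ ℝ + x₁ • ContinuousLinearMap.snd ℝ ℝ ℝ) z₀ := by
    simp only [H_eq]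
    have h1 := (((ContinuousLinearMap.snd ℝ ℝ ℝ).hasFDerivAt (x := z₀)).pow 2).mul_const
      (2 * Q.inertia)⁻¹
    simp only [← div_eq_mul_inv] at h1
    convert! h1.add hVd using 1
    refine ContinuousLinearMap.ext fun v => ?_
    simp [hx₁, hx₂, field]
    field_simp
    ring
  have hHs : HasStrictFDerivAt (fun z : ℝ × ℝ => Q.H z.1 z.2)
      ((-x₂) • ContinuousLinearMap.fst ℝ ℝ ℝ + x₁ • ContinuousLinearMap.snd ℝ ℝ ℝ) z₀ := by
    refine ContDiffAt.hasStrictFDerivAt' (n := 1) ?_ hHd one_ne_zero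
    simp only [H, V]
    fun_prop
  -- The gradient of `H` is the field turned by a right angle, so `(ℓ, H)` has determinant `x₁² +
  -- x₂²` at `z₀` and is a local coordinate system.
  set F' : (ℝ × ℝ) ≃L[ℝ] (ℝ × ℝ) := ContinuousLinearEquiv.equivOfInverse
    (ℓ.prod ((-x₂) • ContinuousLinearMap.fst ℝ ℝ ℝ + x₁ • ContinuousLinearMap.snd ℝ ℝ ℝ))
    ((x₁ ^ 2 + x₂ ^ 2)⁻¹ • ((x₁ • ContinuousLinearMap.fst ℝ ℝ ℝ -
      x₂ • ContinuousLinearMap.snd ℝ ℝ ℝ).prod (x₂ • ContinuousLinearMap.fst ℝ ℝ ℝ +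
      x₁ • ContinuousLinearMap.snd ℝ ℝ ℝ)))
    (fun v => by
      refine Prod.ext ?_ ?_ <;> simp [hℓa] <;> field_simp <;> ring)
    (fun v => by
      refine Prod.ext ?_ ?_ <;> simp [hℓa] <;> field_simp <;> ring) with hF'
  have hF : HasStrictFDerivAt (fun z : ℝ × ℝ => (ℓ z, Q.H z.1 z.2))
      (F' : (ℝ × ℝ) →L[ℝ] (ℝ × ℝ)) z₀ := ℓ.hasStrictFDerivAt.prodMk hHs
  set G := hF.toOpenPartialHomeomorph with hG
  have hG0 : z₀ ∈ G.source := hF.mem_toOpenPartialHomeomorph_source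
  have hGn : G.source ∈ 𝓝 z₀ := G.open_source.mem_nhds hG0
  have hback : ContinuousAt (fun z => Q.flow z₀ (e.symm (ℓ z))) z₀ :=
    hflow.continuousAt.comp (hθc z₀ ht0)
  have hback0 : Q.flow z₀ (e.symm (ℓ z₀)) = z₀ := by rw [hθ0, flow_zero]
  refine ⟨fun z => e.symm (ℓ z), htgt.mono hθc, ?_⟩
  filter_upwards [htgt, hGn, hback.eventually_mem (s := G.source)
    (by simpa only [hback0] using hGn)] with z h1 h2 h3 hH
  -- The point and the flow at the time read off from `ℓ` have the same `ℓ` and the same energy,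
  -- hence coincide.
  refine G.injOn h2 h3 (Prod.ext ?_ ?_)
  · have := e.right_inv h1
    rw [hecoe] at this
    exact this.symm
  · change Q.H z.1 z.2 = Q.H (Q.flow z₀ _).1 (Q.flow z₀ _).2
    rw [hH, (Q.isSolution_flow z₀).H_const _ 0, flow_zero]

lemma IsSolution.eventually_snd_ne_zero {P : AveragedPendulum} {γ : ℝ → ℝ × ℝ}
    (hγ : P.IsSolution γ) {t : ℝ} (h : ¬ P.IsEquilibrium (γ t)) :
    ∀ᶠ u in 𝓝[≠] t, (γ u).2 ≠ 0 := by
  by_cases h0 : (γ t).2 = 0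
  · refine (hγ.hasDerivAt_snd t).eventually_ne ?_
    rw [AveragedPendulum.isEquilibrium_iff] at h
    rw [neg_ne_zero]
    exact mul_ne_zero P.scale_pos.ne' fun h1 => h ⟨h0, h1⟩
  · exact ((continuous_snd.comp hγ.continuous).continuousAt.eventually_ne h0).filter_mono
      nhdsWithin_le_nhds

lemma exists_sign_of_ne_zero {f : ℝ → ℝ} (hf : Continuous f) {a b : ℝ}
    (h : ∀ t ∈ Set.Ioo a b, f t ≠ 0) :
    ∃ s : ℝ, (s = 1 ∨ s = -1) ∧ ∀ t ∈ Set.Ioo a b, 0 < s * f t := by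
  rcases (Set.Ioo a b).eq_empty_or_nonempty with he | ⟨c, hc⟩
  · exact ⟨1, Or.inl rfl, fun t ht => by simp [he] at ht⟩
  have key : ∀ s : ℝ, (s = 1 ∨ s = -1) → 0 < s * f c → ∀ t ∈ Set.Ioo a b, 0 < s * f t := by
    intro s hs hc0 t ht
    by_contra! hle
    obtain ⟨x, hx, hx0⟩ := isPreconnected_Ioo.intermediate_value ht hc
      ((continuous_const.mul hf).continuousOn (s := Set.Ioo a b)) ⟨hle, hc0.le⟩
    refine h x hx ((mul_eq_zero.1 hx0).resolve_left ?_)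
    rcases hs with rfl | rfl <;> norm_num
  rcases lt_or_gt_of_ne (h c hc) with hlt | hlt
  · exact ⟨-1, Or.inr rfl, key _ (Or.inr rfl) (by linarith)⟩
  · exact ⟨1, Or.inl rfl, key _ (Or.inl rfl) (by linarith)⟩

lemma IsSolution.strictMonoOn_fst {P : AveragedPendulum} {γ : ℝ → ℝ × ℝ} (hγ : P.IsSolution γ)
    {s a b : ℝ} (h : ∀ t ∈ Set.Ioo a b, 0 < s * (γ t).2) :
    StrictMonoOn (fun t => s * (γ t).1) (Set.Icc a b) := by
  refine strictMonoOn_of_deriv_pos (convex_Icc a b)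
    (continuous_const.mul (continuous_fst.comp hγ.continuous)).continuousOn fun t ht => ?_
  rw [interior_Icc] at ht
  rw [((hγ.hasDerivAt_fst t).const_mul s).deriv, ← mul_div_assoc]
  exact div_pos (h t ht) P.inertia_pos

lemma IsSolution.monotoneOn_fst {P : AveragedPendulum} {γ : ℝ → ℝ × ℝ} (hγ : P.IsSolution γ)
    {s a b : ℝ} (h : ∀ t ∈ Set.Icc a b, 0 ≤ s * (γ t).2) :
    MonotoneOn (fun t => s * (γ t).1) (Set.Icc a b) := by
  refine monotoneOn_of_deriv_nonneg (convex_Icc a b)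
    (continuous_const.mul (continuous_fst.comp hγ.continuous)).continuousOn
    (fun t _ => ((hγ.hasDerivAt_fst t).const_mul s).differentiableAt.differentiableWithinAt)
    fun t ht => ?_
  rw [((hγ.hasDerivAt_fst t).const_mul s).deriv, ← mul_div_assoc]
  exact div_nonneg (h t (interior_subset ht)) P.inertia_pos.le

/-- The time along a solution increases where the angle moves in the direction of the momentum. -/
lemma strictMonoOn_time {Q : AveragedPendulum} {δ σ : ℝ → ℝ × ℝ} (hδ : Q.IsSolution δ) {θ : ℝ → ℝ}
    {a b s : ℝ} (hθ : ContinuousOn θ (Set.Icc a b)) (hσ : ∀ t ∈ Set.Icc a b, σ t = δ (θ t))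
    (hs : ∀ t ∈ Set.Icc a b, 0 ≤ s * (σ t).2)
    (hm : StrictMonoOn (fun t => s * (σ t).1) (Set.Icc a b)) : StrictMonoOn θ (Set.Icc a b) := by
  intro t₁ h₁ t₂ h₂ hlt
  by_contra! hle
  have h1 : s * (σ t₁).1 < s * (σ t₂).1 := hm h₁ h₂ hlt
  have hsub : Set.Icc t₁ t₂ ⊆ Set.Icc a b := Set.Icc_subset_Icc h₁.1 h₂.2
  -- If the time did not increase, every time between `θ t₂` and `θ t₁` would be attained, so `δ`
  -- would move there in the direction `s`, contrary to the motion of `σ`.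
  have h2 := intermediate_value_Icc' hlt.le (hθ.mono hsub)
  have h3 : s * (δ (θ t₂)).1 ≤ s * (δ (θ t₁)).1 :=
    hδ.monotoneOn_fst (s := s) (fun u hu => by
      obtain ⟨t, ht, rfl⟩ := h2 hu
      rw [← hσ t (hsub ht)]
      exact hs t (hsub ht)) ⟨le_rfl, hle⟩ ⟨hle, le_rfl⟩ hle
  rw [← hσ _ h₁, ← hσ _ h₂] at h3
  exact h3.not_gt h1


/-- Between the times `a` and `b` the curve `σ` runs along a trajectory of `Q`, forward in time. -/
def RunsAlong (Q : AveragedPendulum) (σ : ℝ → ℝ × ℝ) (a b : ℝ) : Prop :=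
  ∃ f : ℝ → ℝ, ContinuousOn f (Set.Icc a b) ∧ StrictMonoOn f (Set.Icc a b) ∧ f a = 0 ∧
    ∀ t ∈ Set.Icc a b, σ t = Q.flow (σ a) (f t)

lemma RunsAlong.trans {Q : AveragedPendulum} {σ : ℝ → ℝ × ℝ} {a b c : ℝ} (hab : a ≤ b)
    (hbc : b ≤ c) (h : Q.RunsAlong σ a b) (h' : Q.RunsAlong σ b c) : Q.RunsAlong σ a c := by
  obtain ⟨f, f1, f2, f3, f4⟩ := h
  obtain ⟨g, g1, g2, g3, g4⟩ := h'
  set F : ℝ → ℝ := fun t => if t ≤ b then f t else f b + g t with hF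
  have hFf : Set.EqOn F f (Set.Icc a b) := fun t ht => if_pos ht.2
  have hFg : Set.EqOn F (fun t => f b + g t) (Set.Icc b c) := fun t ht => by
    rcases ht.1.eq_or_lt with rfl | hlt
    · simp [hF, g3]
    · exact if_neg hlt.not_ge
  have hu := Set.Icc_union_Icc_eq_Icc hab hbc
  refine ⟨F, ?_, ?_, (hFf ⟨le_rfl, hab⟩).trans f3, ?_⟩
  · rw [← hu]
    exact (f1.congr hFf).union_of_isClosed ((continuousOn_const.add g1).congr hFg) isClosed_Icc
      isClosed_Icc
  · rw [← hu]
    exact (f2.congr hFf.symm).union ((StrictMonoOn.const_add g2 (f b)).congr hFg.symm)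
      (isGreatest_Icc hab) (isLeast_Icc hbc)
  · intro t ht
    rw [← hu] at ht
    rcases ht with ht | ht
    · rw [hFf ht, f4 t ht]
    · rw [hFg ht, flow_add, ← f4 b ⟨hab, le_rfl⟩, g4 t ht]

/-- By compactness the interval is cut into finitely many pieces, each inside one of the local
neighbourhoods. -/
lemma of_local_of_trans {R : ℝ → ℝ → Prop}
    (hloc : ∀ t, ∃ ε > 0, ∀ a b, t - ε < a → a ≤ b → b < t + ε → R a b)
    (htrans : ∀ a b c, a ≤ b → b ≤ c → R a b → R b c → R a c) {a b : ℝ} (hab : a ≤ b) :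
    R a b := by
  choose ε hε hR using hloc
  obtain ⟨t, ht0, htm, ⟨m, hm⟩, hsub⟩ := exists_monotone_Icc_subset_open_cover_Icc hab
    (c := fun x : ℝ => {y : Set.Icc a b | (y : ℝ) ∈ Set.Ioo (x - ε x) (x + ε x)})
    (fun x => isOpen_Ioo.preimage continuous_subtype_val)
    (fun y _ => Set.mem_iUnion.2 ⟨y, by
      have := hε y
      exact ⟨by linarith, by linarith⟩⟩)
  have key : ∀ n, R a (t n) := fun n => by
    induction n with
    | zero =>
      rw [ht0]
      have := hε a
      exact hR a a a (by linarith) le_rfl (by linarith)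
    | succ n ih =>
      have hle := htm (Nat.le_succ n)
      obtain ⟨x, hx⟩ := hsub n
      exact htrans _ _ _ (t n).2.1 hle ih (hR x _ _ (hx ⟨le_rfl, hle⟩).1 hle (hx ⟨hle, le_rfl⟩).2)
  have := key m
  rwa [hm m le_rfl] at this

/-- While the momentum has a constant sign the angle moves in its direction. The matching preserves
this sign and the order of the angles, so the image runs forward along the trajectory of `Q`. -/
lemma Matching.strictMonoOn_time {P Q : AveragedPendulum} (M : Matching P Q) {γ : ℝ → ℝ × ℝ}
    (hγ : P.IsSolution γ) {δ : ℝ → ℝ × ℝ} (hδ : Q.IsSolution δ) {θ : ℝ → ℝ} {a b : ℝ} (hab : a < b)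
    (hθ : ContinuousOn θ (Set.Icc a b)) (hσ : ∀ t ∈ Set.Icc a b, M.map (γ t) = δ (θ t))
    (h0 : ∀ t ∈ Set.Ioo a b, (γ t).2 ≠ 0) : StrictMonoOn θ (Set.Icc a b) := by
  have hc : Continuous fun t => (γ t).2 := continuous_snd.comp hγ.continuous
  obtain ⟨s, hs, hpos⟩ := exists_sign_of_ne_zero hc h0
  have hmono := hγ.strictMonoOn_fst hpos
  have hnn : ∀ t ∈ Set.Icc a b, 0 ≤ s * (γ t).2 := by
    have := closure_minimal (t := {t | 0 ≤ s * (γ t).2}) (fun t ht => (hpos t ht).le)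
      (isClosed_le continuous_const (continuous_const.mul hc))
    rwa [closure_Ioo hab.ne] at this
  refine AveragedPendulum.strictMonoOn_time hδ hθ hσ (s := s) (fun t ht => ?_) fun x hx y hy hxy => ?_
  · have h1 := hnn t ht
    rcases h1.eq_or_lt with h | h
    · have h2 : (γ t).2 = 0 := by
        rcases hs with rfl | rfl <;> linarith
      rw [M.map_snd_eq_zero_iff.2 h2, mul_zero]
    · rcases hs with rfl | rfl
      · have := M.map_snd_pos (z := γ t) (by linarith)
        linarith
      · have := M.map_snd_neg (z := γ t) (by linarith)
        linarith
  · have h1 : s * (γ x).1 < s * (γ y).1 := hmono hx hy hxy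
    change s * M.κ (γ x).1 < s * M.κ (γ y).1
    rcases hs with rfl | rfl
    · rw [one_mul, one_mul] at h1 ⊢
      exact M.κ.strictMono h1
    · rw [neg_one_mul, neg_one_mul, neg_lt_neg_iff] at h1 ⊢
      exact M.κ.strictMono h1

/-- The image stays on a level curve, which near a nonequilibrium is traced by the flow. Zeros of
the momentum are isolated, so the time increases on either side of `t₀` and therefore across it. -/
lemma Matching.runsAlong_local {P Q : AveragedPendulum} (M : Matching P Q) {γ : ℝ → ℝ × ℝ}
    (hγ : P.IsSolution γ) {t₀ : ℝ} (h : ¬ P.IsEquilibrium (γ t₀)) :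
    ∃ ε > 0, ∀ a b, t₀ - ε < a → a ≤ b → b < t₀ + ε → Q.RunsAlong (fun t => M.map (γ t)) a b := by
  obtain ⟨θ, hθ1, hθ2⟩ := exists_local_time (mt M.isEquilibrium_map_iff.1 h)
  have hσ : Continuous fun t => M.map (γ t) := M.continuous_map.comp hγ.continuous
  have h1 := hσ.continuousAt.eventually hθ1
  have h2 := hσ.continuousAt.eventually hθ2
  have h3 := eventually_nhdsWithin_iff.1 (hγ.eventually_snd_ne_zero h)
  obtain ⟨ε, hε, hall⟩ := Metric.nhds_basis_closedBall.eventually_iff.1 (h1.and (h2.and h3))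
  rw [Real.closedBall_eq_Icc] at hall
  have hrun : ∀ t ∈ Set.Icc (t₀ - ε) (t₀ + ε),
      M.map (γ t) = Q.flow (M.map (γ t₀)) (θ (M.map (γ t))) := fun t ht =>
    (hall ht).2.1 (by rw [M.H_map_const hγ, M.H_map_const hγ t₀])
  have hcont : ContinuousOn (fun t => θ (M.map (γ t))) (Set.Icc (t₀ - ε) (t₀ + ε)) := fun t ht =>
    (ContinuousAt.comp (f := fun t => M.map (γ t)) (hall ht).1
      hσ.continuousAt).continuousWithinAt
  have hl : Set.Icc (t₀ - ε) t₀ ⊆ Set.Icc (t₀ - ε) (t₀ + ε) :=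
    Set.Icc_subset_Icc_right (by linarith)
  have hr : Set.Icc t₀ (t₀ + ε) ⊆ Set.Icc (t₀ - ε) (t₀ + ε) :=
    Set.Icc_subset_Icc_left (by linarith)
  have m1 := M.strictMonoOn_time hγ (Q.isSolution_flow _) (by linarith) (hcont.mono hl)
    (fun t ht => hrun t (hl ht))
    fun t ht => (hall (hl (Set.Ioo_subset_Icc_self ht))).2.2 ht.2.ne
  have m2 := M.strictMonoOn_time hγ (Q.isSolution_flow _) (by linarith) (hcont.mono hr)
    (fun t ht => hrun t (hr ht))
    fun t ht => (hall (hr (Set.Ioo_subset_Icc_self ht))).2.2 ht.1.ne'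
  have m := m1.union m2 (isGreatest_Icc (by linarith)) (isLeast_Icc (by linarith))
  rw [Set.Icc_union_Icc_eq_Icc (by linarith) (by linarith)] at m
  refine ⟨ε, hε, fun a b ha hab hb => ?_⟩
  have hsub : Set.Icc a b ⊆ Set.Icc (t₀ - ε) (t₀ + ε) := Set.Icc_subset_Icc ha.le hb.le
  refine ⟨fun t => θ (M.map (γ t)) - θ (M.map (γ a)), (hcont.mono hsub).sub continuousOn_const,
    fun x hx y hy hxy => sub_lt_sub_right (m (hsub hx) (hsub hy) hxy) _, sub_self _,
    fun t ht => ?_⟩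
  have ha := hrun a (hsub ⟨le_rfl, hab⟩)
  change M.map (γ t) = Q.flow (M.map (γ a)) _
  rw [ha, ← flow_add, ← ha, add_sub_cancel]
  exact hrun t (hsub ht)

/-- Supplies the offsets, in both directions from `0`, with which the times on successive unit
intervals are joined. -/
lemma exists_partial_sums (L : ℤ → ℝ) : ∃ A : ℤ → ℝ, A 0 = 0 ∧ ∀ n, A (n + 1) = A n + L n := by
  refine ⟨fun n => ∑ i ∈ Finset.range n.toNat, L i -
    ∑ i ∈ Finset.range (-n).toNat, L (-(i : ℤ) - 1), by simp, fun n => ?_⟩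
  rcases le_or_gt 0 n with hn | hn
  · lift n to ℕ using hn
    have h1 : ((n : ℤ) + 1).toNat = n + 1 := by omega
    have h2 : (-((n : ℤ) + 1)).toNat = 0 := by omega
    have h3 : (-(n : ℤ)).toNat = 0 := by omega
    simp only [h1, h2, h3, Int.toNat_natCast, Finset.sum_range_succ, Finset.range_zero,
      Finset.sum_empty, sub_zero]
  · obtain ⟨k, rfl⟩ : ∃ k : ℕ, n = -(k : ℤ) - 1 := ⟨(-n - 1).toNat, by omega⟩
    have h1 : (-(k : ℤ) - 1).toNat = 0 := by omega
    have h2 : (-(k : ℤ) - 1 + 1).toNat = 0 := by omega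
    have h3 : (-(-(k : ℤ) - 1)).toNat = k + 1 := by omega
    have h4 : (-(-(k : ℤ) - 1 + 1)).toNat = k := by omega
    simp only [h1, h2, h3, h4, Finset.sum_range_succ, Finset.range_zero, Finset.sum_empty]
    ring

lemma exists_glue {f : ℤ → ℝ → ℝ} (hc : ∀ n : ℤ, ContinuousOn (f n) (Set.Icc n (n + 1)))
    (hm : ∀ n : ℤ, StrictMonoOn (f n) (Set.Icc n (n + 1)))
    (h : ∀ n : ℤ, f n (n + 1) = f (n + 1) (n + 1)) :
    ∃ F : ℝ → ℝ, Continuous F ∧ StrictMono F ∧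
      ∀ n : ℤ, Set.EqOn F (f n) (Set.Icc n (n + 1)) := by
  have heq : ∀ n : ℤ, Set.EqOn (fun t => f ⌊t⌋ t) (f n) (Set.Icc n (n + 1)) := fun n t ht => by
    rcases ht.2.eq_or_lt with rfl | hlt
    · have : ⌊(n : ℝ) + 1⌋ = n + 1 := by rw [Int.floor_add_one, Int.floor_intCast]
      simp only [this]
      exact (h n).symm
    · have : ⌊t⌋ = n := Int.floor_eq_iff.2 ⟨ht.1, hlt⟩
      simp only [this]
  have hmo : ∀ n : ℤ, StrictMonoOn (fun t => f ⌊t⌋ t) (Set.Icc n (n + 1)) := fun n =>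
    (hm n).congr (heq n).symm
  have hint : StrictMono fun n : ℤ => f ⌊(n : ℝ)⌋ n := strictMono_int_of_lt_succ fun n => by
    have := hmo n (a := n) (b := n + 1) ⟨le_rfl, by linarith⟩ ⟨by linarith, le_rfl⟩ (by linarith)
    simpa using this
  refine ⟨fun t => f ⌊t⌋ t, ?_, fun x y hxy => ?_, heq⟩
  · refine continuous_of_continuousOn_strips (c := fun n : ℤ => (n : ℝ)) continuous_id
      Int.cast_strictMono (fun x => ⟨⌊x⌋, Int.floor_le x, by
        push_cast; exact Int.lt_floor_add_one x⟩) fun n => ?_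
    have := (hc n).congr (heq n)
    simpa using this
  · have hx1 := Int.floor_le x
    have hx2 := Int.lt_floor_add_one x
    rcases (Int.floor_mono hxy.le).eq_or_lt with he | hlt
    · have hy2 := Int.lt_floor_add_one y
      rw [← he] at hy2
      exact hmo ⌊x⌋ ⟨hx1, hx2.le⟩ ⟨hx1.trans hxy.le, hy2.le⟩ hxy
    · have h1 := hmo ⌊x⌋ ⟨hx1, hx2.le⟩ ⟨by linarith, le_rfl⟩ hx2
      have h2 := hint.monotone (show ⌊x⌋ + 1 ≤ ⌊y⌋ by omega)
      have h3 := (hmo ⌊y⌋).monotoneOn ⟨le_rfl, by linarith⟩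
        ⟨Int.floor_le y, (Int.lt_floor_add_one y).le⟩ (Int.floor_le y)
      push_cast at h2
      exact (h1.trans_le h2).trans_le h3


/-! ### Global change of time along trajectories -/

namespace Matching

variable {P Q : AveragedPendulum}

lemma exists_time (M : Matching P Q) {γ : ℝ → ℝ × ℝ} (hγ : P.IsSolution γ)
    (h : ¬ P.IsEquilibrium (γ 0)) : ∃ τ : ℝ → ℝ, Continuous τ ∧ StrictMono τ ∧
      ∀ t, M.map (γ t) = Q.flow (M.map (γ 0)) (τ t) := by
  have hrun : ∀ n : ℤ, Q.RunsAlong (fun t => M.map (γ t)) n (n + 1) := fun n =>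
    of_local_of_trans (fun t => M.runsAlong_local hγ (mt (hγ.isEquilibrium_iff t 0).1 h))
      (fun a b c hab hbc => RunsAlong.trans hab hbc) (by linarith)
  choose f f1 f2 f3 f4 using hrun
  obtain ⟨A, hA0, hA⟩ := exists_partial_sums fun n => f n (n + 1)
  obtain ⟨τ, t1, t2, t3⟩ := exists_glue (f := fun n t => A n + f n t)
    (fun n => continuousOn_const.add (f1 n)) (fun n => StrictMonoOn.const_add (f2 n) (A n))
    fun n => by
      have := f3 (n + 1)
      push_cast at this
      rw [hA, this, add_zero]
  have hstep : ∀ n : ℤ, M.map (γ (n + 1)) = Q.flow (M.map (γ n)) (f n (n + 1)) := fun n =>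
    f4 n (n + 1) ⟨by linarith, le_rfl⟩
  have hσ : ∀ n : ℤ, M.map (γ n) = Q.flow (M.map (γ 0)) (A n) := fun n => by
    induction n with
    | zero => simp [hA0]
    | succ n ih =>
      have := hstep n
      push_cast at this ih ⊢
      rw [this, ih, hA, flow_add]
      push_cast
      rfl
    | pred n ih =>
      have h1 := hstep (-n - 1)
      have h2 := hA (-n - 1)
      rw [sub_add_cancel] at h2
      push_cast at h1 h2 ih ⊢
      rw [sub_add_cancel] at h1 h2
      rw [show A (-n - 1) = A (-n) + -f (-n - 1) (-n) by linarith, flow_add, ← ih, h1, ← flow_add,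
        add_neg_cancel, flow_zero]
  refine ⟨τ, t1, t2, fun t => ?_⟩
  have ht : t ∈ Set.Icc (⌊t⌋ : ℝ) (⌊t⌋ + 1) := ⟨Int.floor_le t, (Int.lt_floor_add_one t).le⟩
  rw [t3 ⌊t⌋ ht, flow_add, ← hσ]
  exact f4 ⌊t⌋ t ht

/-- A finite limit of the new time would make the image converge to a point of its own trajectory.
Pulled back, `γ` converges, so this point is an equilibrium, and then so is the whole trajectory. -/
lemma isEquilibrium_of_tendsto (M : Matching P Q) {γ : ℝ → ℝ × ℝ}
    {τ : ℝ → ℝ} (hτ : ∀ t, M.map (γ t) = Q.flow (M.map (γ 0)) (τ t)) {F : Filter ℝ}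
    (hF : ∀ z, Tendsto γ F (𝓝 z) → P.IsEquilibrium z) {T : ℝ} (h : Tendsto τ F (𝓝 T)) :
    P.IsEquilibrium (γ 0) := by
  have h1 : Tendsto γ F (𝓝 (M.symm.map (Q.flow (M.map (γ 0)) T))) := by
    have h2 := (M.symm.continuous_map.comp (Q.isSolution_flow (M.map (γ 0))).continuous).tendsto T
    refine (h2.comp h).congr fun t => ?_
    simp only [Function.comp_apply, ← hτ, symm_map_map]
  have h3 := hF _ h1
  rw [← M.isEquilibrium_map_iff, map_symm_map,
    (Q.isSolution_flow (M.map (γ 0))).isEquilibrium_iff T 0, flow_zero,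
    M.isEquilibrium_map_iff] at h3
  exact h3

/-- A monotone time either diverges or converges at each end, and convergence is excluded for a
nonequilibrium; so the change of time is onto. -/
lemma exists_timeIso (M : Matching P Q) {γ : ℝ → ℝ × ℝ} (hγ : P.IsSolution γ)
    (h : ¬ P.IsEquilibrium (γ 0)) :
    ∃ τ : ℝ ≃o ℝ, ∀ t, M.map (γ t) = Q.flow (M.map (γ 0)) (τ t) := by
  obtain ⟨τ, hc, hm, hτ⟩ := M.exists_time hγ h
  have h1 : Tendsto τ atTop atTop := by
    refine (tendsto_atTop_of_monotone hm.monotone).resolve_right ?_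
    rintro ⟨T, hT⟩
    exact h (M.isEquilibrium_of_tendsto hτ (fun z => hγ.isEquilibrium_of_tendsto) hT)
  have h2 : Tendsto (fun t => -τ (-t)) atTop atTop := by
    refine (tendsto_atTop_of_monotone fun x y hxy =>
      neg_le_neg (hm.monotone (neg_le_neg hxy))).resolve_right ?_
    rintro ⟨T, hT⟩
    have hT' : Tendsto τ atBot (𝓝 (-T)) := by
      simpa [Function.comp_def] using hT.neg.comp tendsto_neg_atBot_atTop
    refine h (M.isEquilibrium_of_tendsto hτ (fun z hz => ?_) hT')
    have h3 : Tendsto (fun t => ((γ (-t)).1, -(γ (-t)).2)) atTop (𝓝 (z.1, -z.2)) := by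
      have h4 := hz.comp tendsto_neg_atTop_atBot
      exact ((continuous_fst.tendsto z).comp h4).prodMk_nhds (((continuous_snd.tendsto z).comp h4).neg)
    have h5 := hγ.reverse.isEquilibrium_of_tendsto h3
    rw [isEquilibrium_iff] at h5 ⊢
    exact ⟨neg_eq_zero.1 h5.1, h5.2⟩
  have h3 : Tendsto τ atBot atBot := by
    simpa [Function.comp_def] using (tendsto_neg_atTop_atBot.comp h2).comp tendsto_neg_atBot_atTop
  exact ⟨hm.orderIsoOfSurjective τ (hc.surjective h1 h3), hτ⟩

lemma mapsPhaseCurves (M : Matching P Q) {h : (Real.Angle × ℝ) ≃ₜ (Real.Angle × ℝ)}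
    (hh : ∀ z, h (toCylinder z) = toCylinder (M.map z)) : MapsPhaseCurves P Q h := by
  intro γ hγ
  by_cases h0 : P.IsEquilibrium (γ 0)
  · refine ⟨fun _ => M.map (γ 0), isSolution_const (M.isEquilibrium_map_iff.2 h0),
      OrderIso.refl ℝ, fun t => ?_⟩
    rw [hh, hγ.eq_const h0 t]
  · obtain ⟨τ, hτ⟩ := M.exists_timeIso hγ h0
    exact ⟨_, Q.isSolution_flow (M.map (γ 0)), τ, fun t => by rw [hh, hτ]⟩

lemma samePortrait (M : Matching P Q) : P.SamePortrait Q := by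
  obtain ⟨h, h1, h2⟩ := exists_homeomorph_cylinder M.continuous_map M.symm.continuous_map
    M.map_add M.symm.map_add M.symm_map_map M.map_symm_map
  exact ⟨h, M.mapsPhaseCurves h1, M.symm.mapsPhaseCurves h2⟩

end Matching

/-! ### Systems with phase portraits of the same type -/

lemma WellSeq.V_m_lt {P : AveragedPendulum} {n : ℤ} (w : WellSeq P.param n) (i : ℤ) :
    P.V (w.m i) < P.V (w.S i) :=
  P.V_lt_V_iff.2 (w.anti i ⟨le_rfl, (w.S_lt i).le⟩ ⟨(w.S_lt i).le, le_rfl⟩ (w.S_lt i))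

lemma WellSeq.V_m_lt' {P : AveragedPendulum} {n : ℤ} (w : WellSeq P.param n) (i : ℤ) :
    P.V (w.m i) < P.V (w.S (i + 1)) :=
  P.V_lt_V_iff.2 (w.mono i ⟨le_rfl, (w.lt_S i).le⟩ ⟨(w.lt_S i).le, le_rfl⟩ (w.lt_S i))

lemma V_add_int (P : AveragedPendulum) (φ : ℝ) (k : ℤ) : P.V (φ + 2 * Real.pi * k) = P.V φ := by
  rw [V_eq, V_eq, redV_add_int]

lemma WellSeq.V_S_add_mul {P : AveragedPendulum} {n : ℤ} (w : WellSeq P.param n) (i k : ℤ) :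
    P.V (w.S (i + n * k)) = P.V (w.S i) := by
  rw [add_mul_of_add w.S_add, V_add_int]

/-- The maxima of the potential have the values `s + D * ν i`, and its minima are below `s`. -/
def HasLevels (P : AveragedPendulum) (n : ℤ) (ν : ℤ → ℝ) : Prop :=
  ∃ (w : WellSeq P.param n) (s D : ℝ), 0 < D ∧ (∀ i, P.V (w.S i) = s + D * ν i) ∧
    ∀ i, P.V (w.m i) < s

lemma HasLevels.samePortrait {P Q : AveragedPendulum} {n : ℤ} {ν : ℤ → ℝ} (hP : P.HasLevels n ν)
    (hQ : Q.HasLevels n ν) (hν : ∀ i, 0 ≤ ν i) : P.SamePortrait Q := by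
  obtain ⟨w, s, D, hD, hS, hm⟩ := hP
  obtain ⟨w', s', D', hD', hS', hm'⟩ := hQ
  obtain ⟨M⟩ := w.exists_matching w' hD hD' hν hS hS' hm hm'
  exact M.samePortrait

lemma hasLevels_of_eq {P : AveragedPendulum} {n : ℤ} (w : WellSeq P.param n)
    (h : ∀ i, P.V (w.S i) = P.V (w.S 0)) : P.HasLevels n fun _ => 0 :=
  ⟨w, P.V (w.S 0), 1, one_pos, fun i => by rw [h, mul_zero, add_zero],
    fun i => (w.V_m_lt i).trans_eq (h i)⟩

lemma hasLevels_of_mem_domI {P : AveragedPendulum} (h : P.param ∈ domI) :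
    P.HasLevels 1 fun _ => 0 := by
  obtain ⟨w⟩ := exists_wellSeq_one h
  exact hasLevels_of_eq w fun i => by simpa using w.V_S_add_mul 0 i

lemma hasLevels_of_mem_ray {P : AveragedPendulum} (h : P.param ∈ ray) :
    P.HasLevels 2 fun _ => 0 := by
  have h2 := ray_subset_domII h
  obtain ⟨w, hw⟩ := exists_wellSeq_two h2
  have h1 : P.V (w.S 1) = P.V (w.S 0) := by
    rw [V_eq_V_iff]
    refine (hw _).eq_of_not_lt fun hlt => not_isLowSaddle_of_mem_ray h (w.S 1)
      ⟨w.redV₁_S 1, w.redV₂_S (ne_of_gt h2) 1, _, hlt⟩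
  refine hasLevels_of_eq w fun i => ?_
  obtain ⟨k, rfl | rfl⟩ := Int.even_or_odd' i
  · simpa using w.V_S_add_mul 0 k
  · rw [add_comm, w.V_S_add_mul, h1]

/-- The reference level is that of the lower saddles, which have odd index. Every well is adjacent
to one of them, so its bottom lies below this level. -/
lemma hasLevels_of_mem_domII {P : AveragedPendulum} (h : P.param ∈ domII \ ray) :
    P.HasLevels 2 fun i => if Even i then 1 else 0 := by
  obtain ⟨w, hw⟩ := exists_wellSeq_two h.1
  have h0 : ∀ k, P.V (w.S (2 * k)) = P.V (w.S 0) := fun k => by simpa using w.V_S_add_mul 0 k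
  have h1 : ∀ k, P.V (w.S (2 * k + 1)) = P.V (w.S 1) := fun k => by
    rw [add_comm, w.V_S_add_mul]
  have hlt : P.V (w.S 1) < P.V (w.S 0) := by
    rw [V_lt_V_iff]
    refine (hw _).lt_of_ne fun he => h.2 ?_
    exact mem_ray_of_redV_eq (w.redV₁_S 0) (w.redV₁_S 1) (w.redV₂_S (ne_of_gt h.1) 0)
      w.sin_half_sub_ne_zero he.symm
  refine ⟨w, P.V (w.S 1), P.V (w.S 0) - P.V (w.S 1), sub_pos.2 hlt, fun i => ?_, fun i => ?_⟩
  · beta_reduce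
    obtain ⟨k, rfl | rfl⟩ := Int.even_or_odd' i
    · rw [h0, if_pos (even_two_mul k)]; ring
    · rw [h1, if_neg (Int.not_even_two_mul_add_one k)]; ring
  · obtain ⟨k, rfl | rfl⟩ := Int.even_or_odd' i
    · exact (w.V_m_lt' _).trans_eq (h1 k)
    · exact (w.V_m_lt _).trans_eq (h1 k)


/-! ### Systems with phase portraits of different types -/

lemma toCylinder_eq_iff {z w : ℝ × ℝ} :
    toCylinder z = toCylinder w ↔ ∃ k : ℤ, z = (w.1 + 2 * Real.pi * k, w.2) := by
  simp only [toCylinder, Prod.mk.injEq, Real.Angle.angle_eq_iff_two_pi_dvd_sub]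
  constructor
  · rintro ⟨⟨k, hk⟩, h⟩
    exact ⟨k, Prod.ext (by linarith) h⟩
  · rintro ⟨k, rfl⟩
    exact ⟨⟨k, by ring⟩, rfl⟩

lemma H_eq_of_toCylinder_eq (P : AveragedPendulum) {z w : ℝ × ℝ}
    (h : toCylinder z = toCylinder w) : P.H z.1 z.2 = P.H w.1 w.2 := by
  obtain ⟨k, rfl⟩ := toCylinder_eq_iff.1 h
  rw [H_eq, H_eq, V_add_int]

lemma isEquilibrium_iff_of_toCylinder_eq (P : AveragedPendulum) {z w : ℝ × ℝ}
    (h : toCylinder z = toCylinder w) : P.IsEquilibrium z ↔ P.IsEquilibrium w := by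
  obtain ⟨k, rfl⟩ := toCylinder_eq_iff.1 h
  rw [isEquilibrium_iff, isEquilibrium_iff, redV₁_add_int]

/-- The image of a constant curve is one point of the cylinder. Its lifts form a countable set, in
which a continuous solution must be constant. -/
lemma MapsPhaseCurves.exists_isEquilibrium {P Q : AveragedPendulum}
    {h : (Real.Angle × ℝ) ≃ₜ (Real.Angle × ℝ)} (hh : MapsPhaseCurves P Q h) {z : ℝ × ℝ}
    (hz : P.IsEquilibrium z) : ∃ w, Q.IsEquilibrium w ∧ h (toCylinder z) = toCylinder w := by
  obtain ⟨δ, hδ, τ, hτ⟩ := hh _ (isSolution_const hz)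
  have h1 : ∀ u, toCylinder (δ u) = toCylinder (δ 0) := fun u => by
    rw [← τ.apply_symm_apply u, ← hτ, hτ (τ.symm 0), τ.apply_symm_apply]
  have h2 : (Set.range δ).Countable := by
    refine (Set.countable_range fun k : ℤ => ((δ 0).1 + 2 * Real.pi * k, (δ 0).2)).mono ?_
    rintro _ ⟨u, rfl⟩
    obtain ⟨k, hk⟩ := toCylinder_eq_iff.1 (h1 u)
    exact ⟨k, hk.symm⟩
  have h3 : ∀ u, δ u = δ 0 := fun u =>
    h2.isTotallyDisconnected _ subset_rfl (isPreconnected_range hδ.continuous) ⟨u, rfl⟩ ⟨0, rfl⟩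
  refine ⟨δ 0, hδ.isEquilibrium_of_tendsto ?_, ?_⟩
  · exact tendsto_const_nhds.congr fun u => (h3 u).symm
  · rw [hτ 0, h3]

lemma SamePortrait.ncard_equilibria_eq {P Q : AveragedPendulum} (h : P.SamePortrait Q) :
    P.equilibria.ncard = Q.equilibria.ncard := by
  obtain ⟨f, h1, h2⟩ := h
  rw [← Set.ncard_image_of_injective _ f.injective]
  congr 1
  refine subset_antisymm ?_ fun y hy => ?_
  · rintro _ ⟨_, ⟨z, hz, rfl⟩, rfl⟩
    obtain ⟨w, hw, he⟩ := h1.exists_isEquilibrium hz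
    exact ⟨w, hw, he.symm⟩
  · obtain ⟨z, hz, rfl⟩ := hy
    obtain ⟨w, hw, he⟩ := h2.exists_isEquilibrium hz
    exact ⟨toCylinder w, ⟨w, hw, rfl⟩, by rw [← he, f.apply_symm_apply]⟩

/-- Convergence is known only on the cylinder, so the argument uses translates of points of the
trajectory arbitrarily near `e`. By continuity and conservation the energy is that of `e`. Near a
local minimum of the potential, points of this energy are equilibria, so `e` is not a centre. -/
lemma IsSolution.isSaddle_of_tendsto_toCylinder {P : AveragedPendulum} (hP : discr P.param ≠ 0)
    {δ : ℝ → ℝ × ℝ} (hδ : P.IsSolution δ) (h0 : ¬ P.IsEquilibrium (δ 0)) {F : Filter ℝ} [F.NeBot]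
    {e : ℝ × ℝ} (he : P.IsEquilibrium e)
    (h : Tendsto (fun u => toCylinder (δ u)) F (𝓝 (toCylinder e))) :
    P.IsSaddle e.1 ∧ P.V e.1 = P.H (δ 0).1 (δ 0).2 := by
  have hev : ∀ N ∈ 𝓝 e, ∃ z ∈ N, ∃ u, toCylinder z = toCylinder (δ u) := fun N hN => by
    obtain ⟨u, z, hz, hzu⟩ :=
      (h.eventually_mem (isOpenQuotientMap_toCylinder.isOpenMap.image_mem_nhds hN)).exists
    exact ⟨z, hz, u, hzu⟩
  obtain ⟨he1, he2⟩ := (P.isEquilibrium_iff e).1 he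
  have hE : P.V e.1 = P.H (δ 0).1 (δ 0).2 := by
    by_contra hne
    have h1 : P.H e.1 e.2 ≠ P.H (δ 0).1 (δ 0).2 := by rwa [he1, H_zero]
    obtain ⟨z, hz, u, hzu⟩ := hev _ (P.continuous_H.continuousAt.eventually_ne h1)
    exact hz (by rw [P.H_eq_of_toCylinder_eq hzu, hδ.H_const u 0])
  refine ⟨?_, hE⟩
  rw [isSaddle_iff]
  refine ⟨he2, (lt_or_gt_of_ne (redV₂_ne_zero hP he2)).resolve_right fun hpos => h0 ?_⟩
  have hmin : IsLocalMin P.V e.1 := isLocalMin_of_deriv_deriv_pos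
    ((P.isCentre_iff e.1).2 ⟨he2, hpos⟩).2 (by rw [deriv_V]; simp [he2])
    P.continuous_V.continuousAt
  obtain ⟨z, hz, u, hzu⟩ := hev _ (continuous_fst.continuousAt.eventually
    (eventually_eventually_nhds.2 hmin))
  have hz' : ∀ᶠ y in 𝓝 z.1, P.V e.1 ≤ P.V y := hz
  have h2 : P.H z.1 z.2 = P.V e.1 := by
    rw [P.H_eq_of_toCylinder_eq hzu, hδ.H_const u 0, hE]
  have h3 : P.V z.1 = P.V e.1 := ((P.V_le_H z.1 z.2).trans_eq h2).antisymm hz'.self_of_nhds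
  have h4 : z.2 = 0 := by
    rw [H_eq, h3] at h2
    have h5 : z.2 ^ 2 / (2 * P.inertia) = 0 := by linarith
    have := P.inertia_pos
    simpa [this.ne'] using h5
  have h5 : redV₁ P.param z.1 = 0 := by
    refine redV₁_eq_zero_of_isLocalMin (hz'.mono fun y hy => ?_)
    rw [← h3] at hy
    exact P.V_le_V_iff.1 hy
  rw [hδ.isEquilibrium_iff 0 u, ← P.isEquilibrium_iff_of_toCylinder_eq hzu]
  exact (P.isEquilibrium_iff z).2 ⟨h4, h5⟩

/-- A heteroclinic trajectory of `Q` is carried to a trajectory of `P` with two different limit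
equilibria on the cylinder. Both are saddles at its energy, and equally high distinct saddles exist
only on the ray. -/
lemma not_samePortrait_ray {P Q : AveragedPendulum} (hP : P.param ∈ domII \ ray)
    (hQ : Q.param ∈ ray) : ¬ P.SamePortrait Q := by
  rintro ⟨f, -, h2⟩
  obtain ⟨s₁, s₂, hs₁, hs₂, hne, γ, hγ, hb, ht⟩ := (hasHeteroclinic_iff Q).2 hQ
  obtain ⟨δ, hδ, τ, hτ⟩ := h2 γ hγ
  obtain ⟨e₁, he₁, h1⟩ := h2.exists_isEquilibrium hs₁.1
  obtain ⟨e₂, he₂, h2⟩ := h2.exists_isEquilibrium hs₂.1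
  have hlim : ∀ {F : Filter ℝ} {s : ℝ} {e : ℝ × ℝ}, f.symm (toCylinder (s, 0)) = toCylinder e →
      Tendsto γ F (𝓝 (s, 0)) → Tendsto τ.symm F F →
      Tendsto (fun u => toCylinder (δ u)) F (𝓝 (toCylinder e)) := by
    intro F s e he hγF hτF
    rw [← he]
    refine (((f.symm.continuous.comp isOpenQuotientMap_toCylinder.continuous).tendsto
      (s, 0)).comp (hγF.comp hτF)).congr fun u => ?_
    simp only [Function.comp_apply, hτ, τ.apply_symm_apply]
  have l1 := hlim h1 hb τ.symm.tendsto_atBot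
  have l2 := hlim h2 ht τ.symm.tendsto_atTop
  have hne' : toCylinder e₁ ≠ toCylinder e₂ := by
    rw [← h1, ← h2]
    exact fun h => hne (congrArg Prod.fst (f.symm.injective h))
  have h0 : ¬ P.IsEquilibrium (δ 0) := fun h => hne' <| by
    simp only [hδ.eq_const h] at l1 l2
    rw [← tendsto_const_nhds_iff.1 l1, ← tendsto_const_nhds_iff.1 l2]
  have hd : discr P.param ≠ 0 := ne_of_gt hP.1
  obtain ⟨g1, g2⟩ := hδ.isSaddle_of_tendsto_toCylinder hd h0 he₁ l1
  obtain ⟨g3, g4⟩ := hδ.isSaddle_of_tendsto_toCylinder hd h0 he₂ l2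
  refine hP.2 (mem_ray_of_saddles g1 g3 (fun h => hne' (Prod.ext h ?_)) (g2.trans g4.symm))
  exact ((P.isEquilibrium_iff e₁).1 he₁).1.trans ((P.isEquilibrium_iff e₂).1 he₂).1.symm

end AveragedPendulum

/-! ### The main theorem -/

theorem mainTheorem1 :
    -- `Γ` consists of the parameters with degenerate equilibria; its parametric representation
    (∀ P : AveragedPendulum,
      P.param ∈ AveragedPendulum.criticalCurve ↔ ∃ φ : ℝ, P.IsDegenerate φ) ∧
    AveragedPendulum.criticalCurve =
      Set.range (fun φ : ℝ =>
        ((Real.cos φ ^ 3 - 3 / 2 * Real.cos φ, Real.sin φ ^ 3) : ℝ × ℝ)) ∧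
    -- `Γ` separates the parameter plane into the domains `I` and `II`
    ∃ I II : Set (ℝ × ℝ),
      IsOpen I ∧ IsOpen II ∧ IsConnected I ∧ IsConnected II ∧ Bornology.IsBounded I ∧
      Disjoint I II ∧ I ∪ II = AveragedPendulum.criticalCurveᶜ ∧
      frontier I = AveragedPendulum.criticalCurve ∧
      frontier II = AveragedPendulum.criticalCurve ∧
      AveragedPendulum.ray ⊆ II ∧
      -- equilibria in the domains `I` and `II`
      (∀ P : AveragedPendulum, P.param ∈ I →
        P.equilibria.ncard = 2 ∧ P.centres.ncard = 1 ∧ P.saddles.ncard = 1) ∧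
      (∀ P : AveragedPendulum, P.param ∈ II →
        P.equilibria.ncard = 4 ∧ P.centres.ncard = 2 ∧ P.saddles.ncard = 2) ∧
      -- the type of the phase portrait is constant on each piece of the partition
      (∀ P Q : AveragedPendulum, P.param ∈ I → Q.param ∈ I → P.SamePortrait Q) ∧
      (∀ P Q : AveragedPendulum, P.param ∈ II \ AveragedPendulum.ray →
        Q.param ∈ II \ AveragedPendulum.ray → P.SamePortrait Q) ∧
      (∀ P Q : AveragedPendulum, P.param ∈ AveragedPendulum.ray →
        Q.param ∈ AveragedPendulum.ray → P.SamePortrait Q) ∧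
      -- and different on different pieces
      (∀ P Q : AveragedPendulum, P.param ∈ I → Q.param ∈ II → ¬ P.SamePortrait Q) ∧
      (∀ P Q : AveragedPendulum, P.param ∈ II \ AveragedPendulum.ray →
        Q.param ∈ AveragedPendulum.ray → ¬ P.SamePortrait Q) ∧
      -- heteroclinic trajectories occur exactly on the ray
      (∀ P : AveragedPendulum, P.HasHeteroclinic ↔ P.param ∈ AveragedPendulum.ray) ∧
      -- an eight-shaped separatrix exists exactly in `II` off the ray, and it is unique
      (∀ P : AveragedPendulum,
        (∃ (s : ℝ) (L R : Set (ℝ × ℝ)), P.IsEight s L R) ↔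
          P.param ∈ II \ AveragedPendulum.ray) ∧
      (∀ (P : AveragedPendulum) (s s' : ℝ) (L R L' R' : Set (ℝ × ℝ)),
        P.IsEight s L R → P.IsEight s' L' R' → (s : Real.Angle) = (s' : Real.Angle)) ∧
      -- its asymmetry: the right loop is the smaller one for `C > 0`, the left one for `C < 0`
      (∀ (P : AveragedPendulum) (s : ℝ) (L R : Set (ℝ × ℝ)), P.IsEight s L R →
        (0 < P.C → AveragedPendulum.MirrorInside s R L) ∧
        (P.C < 0 → AveragedPendulum.MirrorInside s L R) ∧
        (P.C = 0 → L = AveragedPendulum.mirror s '' R)) ∧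
      -- the smaller loop shrinks to a degenerate equilibrium at approach to `Γ` from `II`
      (∀ P₀ : AveragedPendulum, P₀.param ∈ AveragedPendulum.criticalCurve →
        ∃ φ₀ : ℝ, P₀.IsDegenerate φ₀ ∧
          ∀ ε : ℝ, 0 < ε → ∃ δ : ℝ, 0 < δ ∧
            ∀ P : AveragedPendulum, P.m = P₀.m → P.l = P₀.l → P.g = P₀.g →
              P.param ∈ II → dist P.param P₀.param < δ →
              ∀ (s : ℝ) (L R : Set (ℝ × ℝ)), P.IsEight s L R →
                (0 < P.C → ∃ k : ℤ, R ⊆ Metric.ball (φ₀ + 2 * Real.pi * k, 0) ε) ∧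
                (P.C < 0 → ∃ k : ℤ, L ⊆ Metric.ball (φ₀ + 2 * Real.pi * k, 0) ε)) := by
  open AveragedPendulum in
  refine ⟨mem_criticalCurve_iff, criticalCurve_eq_range, domI, domII, isOpen_domI, isOpen_domII,
    isConnected_domI, isConnected_domII, isBounded_domI, ?_, ?_, ?_, ?_, ray_subset_domII,
    fun P hP => ?_, fun P hP => ?_, fun P Q hP hQ => ?_, fun P Q hP hQ => ?_, fun P Q hP hQ => ?_,
    fun P Q hP hQ h => ?_, fun P Q hP hQ => not_samePortrait_ray hP hQ, hasHeteroclinic_iff,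
    fun P => ?_, fun P s s' L R L' R' h h' => ?_,
    fun P s L R h => ⟨h.mirrorInside_of_pos, h.mirrorInside_of_neg, h.eq_mirror_image⟩,
    fun P₀ hP₀ => ?_⟩
  · exact Set.disjoint_left.2 fun q (h1 : discr q < 0) (h2 : 0 < discr q) => lt_asymm h1 h2
  · rw [criticalCurve_eq]
    ext q
    exact lt_or_lt_iff_ne (a := discr q) (b := 0)
  · rw [frontier_domI, criticalCurve_eq]
  · rw [frontier_domII, criticalCurve_eq]
  · obtain ⟨w⟩ := exists_wellSeq_one hP
    exact ⟨ncard_equilibria w (ne_of_lt hP), ncard_centres w (ne_of_lt hP),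
      ncard_saddles w (ne_of_lt hP)⟩
  · obtain ⟨w, -⟩ := exists_wellSeq_two hP
    exact ⟨ncard_equilibria w (ne_of_gt hP), ncard_centres w (ne_of_gt hP),
      ncard_saddles w (ne_of_gt hP)⟩
  · exact (hasLevels_of_mem_domI hP).samePortrait (hasLevels_of_mem_domI hQ) fun _ => le_rfl
  · refine (hasLevels_of_mem_domII hP).samePortrait (hasLevels_of_mem_domII hQ) fun i => ?_
    split_ifs <;> norm_num
  · exact (hasLevels_of_mem_ray hP).samePortrait (hasLevels_of_mem_ray hQ) fun _ => le_rfl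
  · obtain ⟨w⟩ := exists_wellSeq_one hP
    obtain ⟨w', -⟩ := exists_wellSeq_two hQ
    -- The numbers of equilibria, two and four, tell the domains apart.
    have h1 := h.ncard_equilibria_eq
    rw [ncard_equilibria w (ne_of_lt hP), ncard_equilibria w' (ne_of_gt hQ)] at h1
    exact absurd h1 (by decide)
  · rw [← exists_isLowSaddle_iff]
    exact exists_congr fun s => exists_isEight_iff
  · exact (exists_isEight_iff.1 ⟨L, R, h⟩).unique (exists_isEight_iff.1 ⟨L', R', h'⟩)
  · obtain ⟨φ₀, hφ₀⟩ := (mem_criticalCurve_iff P₀).1 hP₀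
    exact ⟨φ₀, hφ₀, fun ε hε => exists_delta_loops hφ₀ hε⟩
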